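/- Theorem. There is a stationary rectifiable $2$-varifold $V$ in $\mathbb R^4$ such that the density $\theta^2(V,0)$ exists with $0<\theta^2(V,0)<\infty$, and $V$ has a non-conical tangent varifold at $0$; in particular the tangent varifold of $V$ at $0$ is not unique. Here a $2$-varifold in $\mathbb R^4$ is a Radon measure on $\mathbb R^4\times G(4,2)$, where $G(4,2)$ is the Grassmann manifold of $2$-dimensional linear subspaces of $\mathbb R^4$, and $\mu_V(A)=V(A\times G(4,2))$ is its weight. $V$ is stationary if $\int \operatorname{div}_S X(x)\,dV(x,S)=0$ for every smooth compactly supported vector field $X$ on $\mathbb R^4$, where $\operatorname{div}_S X(x)=\sum_i\langle\tau_i,DX(x)\tau_i\rangle$ for an orthonormal basis $(\tau_i)$ of $S$. $V$ is rectifiable if there is a $2$-rectifiable Radon measure $\mu$ on $\mathbb R^4$ (that is, $\mu\ll\mathcal H^2$ and $\mu$ is carried by countably many Lipschitz images of $\mathbb R^2$) such that $V(B)=\mu\{x:(x,T_x)\in B\}$ for every Borel set $B$, where $T_x$ is the approximate tangent plane of $\mu$ at $x$. The density is $\theta^2(V,0)=\lim_{r\to0+}r^{-2}\mu_V(\{x:\|x\|\le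 r\})$. A $2$-varifold $C$ is a tangent varifold of $V$ at $0$ if there are $\lambda_i>0$, $\lambda_i\to0$, with $\lambda_i^{-2}\int f(y/\lambda_i,S)\,dV(y,S)\to\int f\,dC$ for every continuous compactly supported $f:\mathbb R^4\times G(4,2)\to\mathbb R$. $C$ is conical if $C(A)=\lambda^{-2}C\{(y,S):(y/\lambda,S)\in A\}$ for every $\lambda>0$ and every Borel set $A$. -/

import Mathlib

open MeasureTheory Filter Topology
open scoped ContDiff

/-- The Grassmann manifold `G(n,m)` of `m`-dimensional linear subspaces of `ℝⁿ`. -/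
def Grass (n m : ℕ) : Type :=
  {S : Submodule ℝ (EuclideanSpace ℝ (Fin n)) // Module.finrank ℝ S = m}

namespace Grass

variable {n m : ℕ}

/-- The underlying linear subspace. -/
def space (S : Grass n m) : Submodule ℝ (EuclideanSpace ℝ (Fin n)) := S.1

/-- The orthogonal projection of `ℝⁿ` onto the subspace, as an operator on `ℝⁿ`. -/
noncomputable def proj (S : Grass n m) :
    EuclideanSpace ℝ (Fin n) →L[ℝ] EuclideanSpace ℝ (Fin n) :=
  S.space.starProjection

/-- The usual topology of `G(n,m)`: subspaces are close if their orthogonal projections are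
close in operator norm. -/
noncomputable instance : TopologicalSpace (Grass n m) := TopologicalSpace.induced proj inferInstance

instance : SecondCountableTopology (Grass n m) :=
  haveI : SecondCountableTopology
      (EuclideanSpace ℝ (Fin n) →L[ℝ] EuclideanSpace ℝ (Fin n)) :=
    secondCountable_of_proper
  (Topology.IsInducing.mk rfl : Topology.IsInducing (proj (n := n) (m := m))).secondCountableTopology

noncomputable instance : MeasurableSpace (Grass n m) := borel _

instance : BorelSpace (Grass n m) := ⟨rfl⟩

end Grass

/-- An `m`-varifold in `ℝⁿ`: a Radon measure on `G_m(ℝⁿ) = ℝⁿ × G(n,m)`. The space is locally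
compact and second countable, so a Radon measure is the same as a Borel measure that is finite on
compact sets. -/
structure Varifold (n m : ℕ) where
  /-- The measure on `ℝⁿ × G(n,m)`. -/
  measure : Measure (EuclideanSpace ℝ (Fin n) × Grass n m)
  finite_on_compacts : IsFiniteMeasureOnCompacts measure

/-- The divergence at `x` of the vector field `X` along the subspace `S`:
`∑ ⟨τᵢ, D X(x) τᵢ⟩` over an orthonormal basis `τᵢ` of `S`, that is, the trace of
`P_S ∘ D X(x)`. -/
noncomputable def divAlong {n m : ℕ} (S : Grass n m)
    (X : EuclideanSpace ℝ (Fin n) → EuclideanSpace ℝ (Fin n)) (x : EuclideanSpace ℝ (Fin n)) : ℝ :=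
  LinearMap.trace ℝ (EuclideanSpace ℝ (Fin n)) (S.proj ∘L fderiv ℝ X x).toLinearMap

/-- `T` is the approximate tangent plane of the measure `μ` at `x`: the rescalings of `μ` about `x`
converge weakly to a positive multiple of the Lebesgue measure of the plane `T`. -/
def IsApproxTangentPlane {n m : ℕ} (μ : Measure (EuclideanSpace ℝ (Fin n)))
    (x : EuclideanSpace ℝ (Fin n)) (T : Grass n m) : Prop :=
  ∃ θ : ℝ, 0 < θ ∧ ∀ f : EuclideanSpace ℝ (Fin n) → ℝ, Continuous f → HasCompactSupport f →
    Tendsto (fun r : ℝ => (r ^ m)⁻¹ * ∫ y, f (r⁻¹ • (y - x)) ∂μ) (𝓝[>] 0)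
      (𝓝 (θ * ∫ z : T.space, f (z : EuclideanSpace ℝ (Fin n))))

/-- `m`-rectifiable Radon measures on `ℝⁿ`: absolutely continuous with respect to the
`m`-dimensional Hausdorff measure and carried by countably many Lipschitz images of `ℝᵐ`. -/
structure IsRectifiableMeasure {n : ℕ} (m : ℕ) (μ : Measure (EuclideanSpace ℝ (Fin n))) : Prop where
  finite_on_compacts : IsFiniteMeasureOnCompacts μ
  abs_cont : μ ≪ Measure.hausdorffMeasure (m : ℝ)
  lipschitz_cover : ∃ g : ℕ → EuclideanSpace ℝ (Fin m) → EuclideanSpace ℝ (Fin n),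
    (∀ i, ∃ K, LipschitzWith K (g i)) ∧ μ (⋃ i, Set.range (g i))ᶜ = 0

namespace Varifold

variable {n m : ℕ}

/-- The weight `μ_V` of `V`, a measure on `ℝⁿ`: `μ_V(A) = V(A × G(n,m))`. -/
noncomputable def weight (V : Varifold n m) : Measure (EuclideanSpace ℝ (Fin n)) :=
  V.measure.map Prod.fst

/-- The first variation `δV(X) = ∫ div_S X(x) dV(x,S)`. -/
noncomputable def firstVariation (V : Varifold n m)
    (X : EuclideanSpace ℝ (Fin n) → EuclideanSpace ℝ (Fin n)) : ℝ :=
  ∫ p, divAlong p.2 X p.1 ∂V.measure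

/-- `V` is stationary: `δV(X) = 0` for every smooth compactly supported vector field `X`. -/
def IsStationary (V : Varifold n m) : Prop :=
  ∀ X : EuclideanSpace ℝ (Fin n) → EuclideanSpace ℝ (Fin n),
    ContDiff ℝ ∞ X → HasCompactSupport X → V.firstVariation X = 0

/-- `V` is rectifiable: it is the varifold associated to an `m`-rectifiable measure `μ`, that is,
`V(B) = μ {x : (x, T_x) ∈ B}` with `T_x` the approximate tangent plane of `μ` at `x`. -/
def IsRectifiable (V : Varifold n m) : Prop :=
  ∃ (μ : Measure (EuclideanSpace ℝ (Fin n))) (T : EuclideanSpace ℝ (Fin n) → Grass n m),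
    IsRectifiableMeasure m μ ∧ (∀ᵐ x ∂μ, IsApproxTangentPlane μ x (T x)) ∧
      ∀ B : Set (EuclideanSpace ℝ (Fin n) × Grass n m), MeasurableSet B →
        V.measure B = μ {x | (x, T x) ∈ B}

/-- The `m`-dimensional density `θᵐ(V,x) = lim_{r → 0+} μ_V(closed ball of radius r at x) / rᵐ`
exists in `[0,∞]` and equals `θ`. -/
def HasDensity (V : Varifold n m) (x : EuclideanSpace ℝ (Fin n)) (θ : ENNReal) : Prop :=
  Tendsto (fun r : ℝ => V.weight (Metric.closedBall x r) / ENNReal.ofReal r ^ m) (𝓝[>] 0) (𝓝 θ)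

/-- The set `VarTan_x V` of tangent varifolds of `V` at `x`: weak limits of rescalings of `V` about
`x` with factors `l i > 0` tending to `0`. -/
def tangents (V : Varifold n m) (x : EuclideanSpace ℝ (Fin n)) : Set (Varifold n m) :=
  {C | ∃ l : ℕ → ℝ, (∀ i, 0 < l i) ∧ Tendsto l atTop (𝓝 0) ∧
    ∀ f : EuclideanSpace ℝ (Fin n) × Grass n m → ℝ, Continuous f → HasCompactSupport f →
      Tendsto (fun i => (l i ^ m)⁻¹ * ∫ p, f ((l i)⁻¹ • (p.1 - x), p.2) ∂V.measure) atTop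
        (𝓝 (∫ p, f p ∂C.measure))}

/-- The image of the varifold `C` under the homothety `y ↦ y / r`:
`A ↦ r⁻ᵐ C {(y,S) : (y / r, S) ∈ A}`. -/
noncomputable def dilate (C : Varifold n m) (r : ℝ) :
    Measure (EuclideanSpace ℝ (Fin n) × Grass n m) :=
  ENNReal.ofReal (r ^ m)⁻¹ • C.measure.map (fun p => (r⁻¹ • p.1, p.2))

/-- `C` is conical: invariant under all homotheties `y ↦ y / r`, `r > 0`. -/
def IsConical (C : Varifold n m) : Prop :=
  ∀ r : ℝ, 0 < r → C.dilate r = C.measure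

end Varifold

/-! The varifold comes from a convex function. Let `u` be a maximum of affine functions `⟪q i, x⟫ -
b i` on `ℝ³`. Its distributional Hessian lives on the facets where two of them tie, and there it is
`|q i - q j| ν ⊗ ν` times area, with `ν` the unit normal. So the facets, weighted by the jump of the
gradient, form a varifold `V` with `∫ div_S X dV = ∑ₐ ∑_c ∫ (∂ₐXₐ dD²u(c,c) - ∂_cXₐ dD²u(c,a))`.
This vanishes after integration by parts, because second derivatives commute
(`IsLeveled.integral_fderiv_symm`, `IsLeveled.isStationary`). The weight of `V` is the trace of
`D²u`. Placing `ℝ³` in `ℝ⁴` as a hyperplane keeps stationarity, since the planes only see the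
`ℝ³`-part of the field.

If `u (r x) / r` approaches a 1-homogeneous function `U` as `r → 0`, the rescaled Hessians converge
to `D²U`, so the mass ratio converges. The plane field is not determined by the matrix-valued limit:
many fine facet patterns approximate the same `D²U` while using different normals. This freedom
breaks conicality.

Here `U` is the support function `paraSupport` of a piece of a paraboloid over the unit disc. At
level `k` the slopes are `1 + 2⁻ᵏ` times lattice points of mesh about `2⁻ᵏ` on this piece, and the
constant is `128⁻ᵏ`. Level `k` is then close to `(1 + 2⁻ᵏ) U - 128⁻ᵏ`, and it alone is active for
`16 · 64⁻ᵏ < ‖x‖ ≤ 31 · 64⁻ᵏ`. Near the axis the active pieces of one level form a Voronoi diagram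
in `(x 0 / x 2, x 1 / x 2)`. Even levels use the square lattice, so the normals satisfy `n 0 * n 1 =
0`; odd levels use the checkerboard sublattice, so `n 0 ^ 2 = n 1 ^ 2` (`ae_normal_annulus`).

The test function `axisTest` integrates `|n 0 * n 1| / ‖n‖²` near the axis. It gives `0` at the
scales `64⁻ᵏ` with `k` even. For `k` odd the integrand is `n 0 ^ 2 / ‖n‖²`, a diagonal entry of the
Hessian, so the integrals tend to the positive number `axisLimit`. A tangent varifold along even
scales, obtained by vague compactness, therefore differs from its dilation by `1 / 64`, which is
again a tangent varifold.

The Hessian formula for finite maxima is proved by smoothing the maximum to `β⁻¹ log ∑ exp (β ·)`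
and letting `β → ∞` (`integral_facetMeasure_finset`). It extends to the infinite family because the
levels accumulate only at the origin and the mass of a ball of radius `r` is at most `M r²`
(`IsLeveled.integral_facetMeasure`). -/

set_option linter.unusedSectionVars false

/-! ### Hyperplane measures and slicing of the volume -/

section Hyperplane

variable {E : Type*} [NormedAddCommGroup E] [InnerProductSpace ℝ E] [FiniteDimensional ℝ E]
  [MeasurableSpace E] [BorelSpace E]

/-- Lebesgue measure of the hyperplane `{x | ⟪n, x⟫ = c}`, as a measure on the ambient space. -/
noncomputable def hyperplaneMeasure (n : E) (c : ℝ) : Measure E :=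
  Measure.map (fun z : (ℝ ∙ n)ᗮ => (c / ‖n‖ ^ 2) • n + (z : E)) volume

/-- Coordinates adapted to the hyperplane orthogonal to the unit vector `n`. -/
noncomputable def normalCoord (n : E) (hn : ‖n‖ = 1) : ℝ × (ℝ ∙ n)ᗮ ≃ᵐ E :=
  ((LinearIsometryEquiv.toSpanUnitSingleton n hn).toHomeomorph.toMeasurableEquiv.prodCongr
    (MeasurableEquiv.refl _)).trans ((ℝ ∙ n).measurableEquivProd (0 : E)).symm

lemma normalCoord_apply (n : E) (hn : ‖n‖ = 1) (p : ℝ × (ℝ ∙ n)ᗮ) :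
    normalCoord n hn p = p.1 • n + (p.2 : E) := by
  simp [normalCoord]
  rfl

lemma measurePreserving_normalCoord (n : E) (hn : ‖n‖ = 1) :
    MeasurePreserving (normalCoord n hn) := by
  have h1 := ((ℝ ∙ n).measurePreserving_measurableEquivProd (0 : E)).symm
  rw [InnerProductSpace.euclideanHausdorffMeasure_eq_volume] at h1
  refine MeasurePreserving.trans (e := (LinearIsometryEquiv.toSpanUnitSingleton n hn).toHomeomorph.toMeasurableEquiv.prodCongr
    (MeasurableEquiv.refl _)) ?_ h1
  exact (LinearIsometryEquiv.toSpanUnitSingleton n hn).measurePreserving.prod (MeasurePreserving.id _)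

lemma map_volume_affine (a b : ℝ) (ha : a ≠ 0) :
    Measure.map (fun s : ℝ => a * s + b) volume = ENNReal.ofReal |a⁻¹| • volume := by
  have : (fun s : ℝ => a * s + b) = (fun s => s + b) ∘ (fun s => a * s) := rfl
  rw [this, ← Measure.map_map (by fun_prop) (by fun_prop), Real.map_volume_mul_left ha,
    Measure.map_smul, (measurePreserving_add_right volume b).map_eq]

lemma integral_affine_fst {Z : Type*} [MeasurableSpace Z] (ν : Measure Z) [SFinite ν]
    (a b : ℝ) (ha : a ≠ 0) (F : ℝ × Z → ℝ) :
    ∫ p, F (a * p.1 + b, p.2) ∂(volume.prod ν) = |a⁻¹| * ∫ p, F p ∂(volume.prod ν) := by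
  let e : ℝ ≃ᵐ ℝ := (Homeomorph.mulLeft₀ a ha |>.trans (Homeomorph.addRight b)).toMeasurableEquiv
  have he : ∀ s, e s = a * s + b := fun s => rfl
  have h := (e.prodCongr (MeasurableEquiv.refl Z)).measurableEmbedding.integral_map
    (μ := volume.prod ν) F
  have h2 : Measure.map (e.prodCongr (MeasurableEquiv.refl Z)) (volume.prod ν)
      = ENNReal.ofReal |a⁻¹| • (volume.prod ν) := by
    have := Measure.map_prod_map (volume : Measure ℝ) ν e.measurable (measurable_id (α := Z))
    rw [Measure.map_id, show Measure.map e volume = ENNReal.ofReal |a⁻¹| • volume from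
      map_volume_affine a b ha, Measure.prod_smul_left] at this
    exact this.symm
  rw [h2, integral_smul_measure, ENNReal.toReal_ofReal (abs_nonneg _), smul_eq_mul] at h
  exact h.symm

/-- Slicing the volume by the hyperplanes parallel to `{x | ⟪n, x⟫ = c}`, with the thickness
variable rescaled by `r`. -/
lemma integral_slice (n : E) (hn : n ≠ 0) (c r : ℝ) (hr : 0 < r) (f : E → ℝ) :
    ∫ x, f x = (r / ‖n‖) *
      ∫ p : ℝ × (ℝ ∙ n)ᗮ, f (((c + r * p.1) / ‖n‖ ^ 2) • n + (p.2 : E)) := by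
  have hn0 : 0 < ‖n‖ := norm_pos_iff.2 hn
  set m : E := ‖n‖⁻¹ • n with hm
  have hm1 : ‖m‖ = 1 := by rw [hm, norm_smul, norm_inv, norm_norm, inv_mul_cancel₀ hn0.ne']
  have hspan : (ℝ ∙ m) = (ℝ ∙ n) := by
    rw [hm]; exact Submodule.span_singleton_smul_eq (IsUnit.mk0 _ (inv_ne_zero hn0.ne')) n
  have key : ∀ (K : Submodule ℝ E) (hK : K = ℝ ∙ n),
      (∫ p : ℝ × (ℝ ∙ n)ᗮ, f (((c + r * p.1) / ‖n‖ ^ 2) • n + (p.2 : E))) =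
      ∫ p : ℝ × Kᗮ, f (((c + r * p.1) / ‖n‖ ^ 2) • n + (p.2 : E)) := by
    rintro K rfl; rfl
  rw [key _ hspan]
  have h1 := (measurePreserving_normalCoord m hm1).integral_comp
    (normalCoord m hm1).measurableEmbedding f
  simp only [normalCoord_apply] at h1
  rw [← h1]
  have h2 := integral_affine_fst (volume : Measure (ℝ ∙ m)ᗮ) (r / ‖n‖) (c / ‖n‖) (by positivity)
    (fun p => f (p.1 • m + (p.2 : E)))
  have h3 : |(r / ‖n‖)⁻¹| = (r / ‖n‖)⁻¹ := abs_of_pos (by positivity)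
  rw [h3] at h2
  rw [show (volume : Measure (ℝ × (ℝ ∙ m)ᗮ)) = volume.prod volume from rfl]
  have h4 : ∀ t : ℝ, ((c + r * t) / ‖n‖ ^ 2) • n = (r / ‖n‖ * t + c / ‖n‖) • m := by
    intro t
    rw [hm, smul_smul]
    congr 1
    field_simp
    ring
  simp only [h4, h2]
  rw [← mul_assoc, mul_inv_cancel₀ (by positivity), one_mul]

lemma integral_hyperplaneMeasure (n : E) (c : ℝ) (f : E → ℝ) :
    ∫ x, f x ∂(hyperplaneMeasure n c) = ∫ z : (ℝ ∙ n)ᗮ, f ((c / ‖n‖ ^ 2) • n + (z : E)) := by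
  refine MeasurableEmbedding.integral_map ?_ _
  exact ((Homeomorph.addLeft ((c / ‖n‖ ^ 2) • n)).isClosedEmbedding.comp
    (ℝ ∙ n)ᗮ.closed_of_finiteDimensional.isClosedEmbedding_subtypeVal).measurableEmbedding

end Hyperplane

/-! ### The smoothed maximum and its Hessian -/

section Softmax

variable {E : Type*} [NormedAddCommGroup E] [InnerProductSpace ℝ E]
variable {ι : Type*} (q : ι → E) (b : ι → ℝ)

/-- The affine function with slope `q i` and constant term `-b i`. -/
noncomputable def affineFun (i : ι) (x : E) : ℝ := inner ℝ (q i) x - b i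

/-- `i` is active at `x`: it attains the maximum of the affine functions indexed by `J`. -/
def IsActive (J : Set ι) (x : E) (i : ι) : Prop :=
  i ∈ J ∧ ∀ j ∈ J, affineFun q b j x ≤ affineFun q b i x

lemma continuous_affineFun (i : ι) : Continuous (affineFun q b i) := by
  unfold affineFun; fun_prop

/-- The `i`-th softmax weight at inverse temperature `β`. -/
noncomputable def softmax (J : Finset ι) (β : ℝ) (i : ι) (x : E) : ℝ :=
  (∑ k ∈ J, Real.exp (β * (affineFun q b k x - affineFun q b i x)))⁻¹

variable {q b} {J : Finset ι} {β : ℝ}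

lemma softmax_denom_pos {i : ι} (hi : i ∈ J) (x : E) :
    0 < ∑ k ∈ J, Real.exp (β * (affineFun q b k x - affineFun q b i x)) :=
  Finset.sum_pos (fun _ _ => Real.exp_pos _) ⟨i, hi⟩

lemma softmax_nonneg (i : ι) (x : E) : 0 ≤ softmax q b J β i x :=
  inv_nonneg.2 (Finset.sum_nonneg fun _ _ => (Real.exp_pos _).le)

/-- The weight is normalised by its own exponential, so only differences of affine functions occur;
this changes the reference index. -/
lemma softmax_mul_exp {i : ι} (k : ι) (x : E) :
    softmax q b J β i x * Real.exp (β * (affineFun q b k x - affineFun q b i x)) =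
      softmax q b J β k x := by
  unfold softmax
  have h : ∑ j ∈ J, Real.exp (β * (affineFun q b j x - affineFun q b i x)) =
      (∑ j ∈ J, Real.exp (β * (affineFun q b j x - affineFun q b k x))) *
        Real.exp (β * (affineFun q b k x - affineFun q b i x)) := by
    rw [Finset.sum_mul]
    refine Finset.sum_congr rfl fun j _ => ?_
    rw [← Real.exp_add]; congr 1; ring
  have := (Real.exp_pos (β * (affineFun q b k x - affineFun q b i x))).ne'
  rw [h, mul_inv, mul_assoc, inv_mul_cancel₀ this, mul_one]

lemma softmax_le_one {i : ι} (hi : i ∈ J) (x : E) : softmax q b J β i x ≤ 1 := by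
  refine inv_le_one_of_one_le₀ ?_
  have := Finset.single_le_sum
    (f := fun k => Real.exp (β * (affineFun q b k x - affineFun q b i x)))
    (fun k _ => (Real.exp_pos _).le) hi
  simpa using this

/-- Dropping all terms of the denominator except `i` and `j` leaves a sigmoid. Across the hyperplane
where `i` and `j` tie, this dominates uniformly in `β` once the thickness is rescaled. -/
lemma softmax_le {i j : ι} (hi : i ∈ J) (hj : j ∈ J) (hij : i ≠ j) (x : E) :
    softmax q b J β i x ≤ Real.sigmoid (β * (affineFun q b i x - affineFun q b j x)) := by
  classical
  refine inv_anti₀ (by positivity) ?_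
  have := Finset.sum_le_sum_of_subset_of_nonneg
    (f := fun k => Real.exp (β * (affineFun q b k x - affineFun q b i x)))
    (s := {i, j}) (t := J) (by intro k; simp; rintro (rfl | rfl) <;> assumption)
    (fun k _ _ => (Real.exp_pos _).le)
  rw [Finset.sum_pair hij] at this
  simp only [sub_self, mul_zero, Real.exp_zero] at this
  convert! this using 3
  ring

lemma contDiff_affineFun (i : ι) : ContDiff ℝ ∞ (affineFun q b i) :=
  (innerSL ℝ (q i)).contDiff.sub contDiff_const

lemma contDiff_softmax {i : ι} (hi : i ∈ J) : ContDiff ℝ ∞ (softmax q b J β i) := by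
  unfold softmax
  refine ContDiff.inv ?_ fun x => (softmax_denom_pos hi x).ne'
  exact ContDiff.sum fun k _ => (contDiff_const.mul
    ((contDiff_affineFun k).sub (contDiff_affineFun i))).exp

lemma hasFDerivAt_affineFun (i : ι) (x : E) :
    HasFDerivAt (affineFun q b i) (innerSL ℝ (q i)) x := by
  unfold affineFun
  exact (innerSL ℝ (q i)).hasFDerivAt.sub_const _

lemma fderiv_softmax {i : ι} (hi : i ∈ J) (x w : E) :
    fderiv ℝ (softmax q b J β i) x w =
      β * ∑ k ∈ J, softmax q b J β i x * softmax q b J β k x * inner ℝ (q i - q k) w := by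
  have h1 : HasFDerivAt (fun y => ∑ k ∈ J, Real.exp (β * (affineFun q b k y - affineFun q b i y)))
      (∑ k ∈ J, Real.exp (β * (affineFun q b k x - affineFun q b i x)) •
        (β • (innerSL ℝ (q k) - innerSL ℝ (q i)))) x := by
    refine HasFDerivAt.fun_sum fun k _ => ?_
    exact (((hasFDerivAt_affineFun k x).sub (hasFDerivAt_affineFun i x)).const_mul β).exp
  have h2 := (hasDerivAt_inv (softmax_denom_pos hi x).ne').comp_hasFDerivAt x h1
  change fderiv ℝ (Inv.inv ∘ _) x w = _
  rw [h2.fderiv]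
  have hS : ∀ k, Real.exp (β * (affineFun q b k x - affineFun q b i x)) =
      (softmax q b J β i x)⁻¹ * softmax q b J β k x := by
    intro k
    rw [← softmax_mul_exp k x, ← mul_assoc, inv_mul_cancel₀, one_mul]
    exact (inv_pos.2 (softmax_denom_pos hi x)).ne'
  have hp : softmax q b J β i x ≠ 0 := (inv_pos.2 (softmax_denom_pos hi x)).ne'
  have hd : ∑ k ∈ J, Real.exp (β * (affineFun q b k x - affineFun q b i x)) =
    (softmax q b J β i x)⁻¹ := by simp [softmax]
  rw [hd]
  change _ = β * ∑ k ∈ J, (∑ k ∈ J, Real.exp (β * (affineFun q b k x - affineFun q b i x)))⁻¹ *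
    softmax q b J β k x * inner ℝ (q i - q k) w
  rw [hd]
  simp only [hS, smul_apply, sum_apply,
    sub_apply, innerSL_apply_apply, smul_eq_mul, inner_sub_left,
    neg_apply, neg_smul]
  rw [Finset.mul_sum, Finset.mul_sum, ← Finset.sum_neg_distrib]
  refine Finset.sum_congr rfl fun k _ => ?_
  field_simp
  ring

/-- The `v`-component of the gradient of the smoothed maximum. -/
noncomputable def softSlope (q : ι → E) (b : ι → ℝ) (J : Finset ι) (β : ℝ) (v x : E) : ℝ :=
  ∑ i ∈ J, softmax q b J β i x * inner ℝ (q i) v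

lemma contDiff_softSlope (v : E) : ContDiff ℝ ∞ (softSlope q b J β v) := by
  unfold softSlope
  exact ContDiff.sum fun i hi => (contDiff_softmax hi).mul contDiff_const

/-- The Hessian of `β⁻¹ log ∑ exp` is `β` times the covariance of the slopes under the softmax
weights. Symmetrising the covariance leaves only differences `q i - q j`, so each term belongs to
one potential facet. -/
lemma fderiv_softSlope (v x w : E) :
    fderiv ℝ (softSlope q b J β v) x w = ∑ i ∈ J, ∑ j ∈ J,
      (β * softmax q b J β i x * softmax q b J β j x) *
        (2⁻¹ * (inner ℝ (q i - q j) v * inner ℝ (q i - q j) w)) := by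
  have h1 : HasFDerivAt (softSlope q b J β v)
      (∑ i ∈ J, (inner ℝ (q i) v) • fderiv ℝ (softmax q b J β i) x) x := by
    refine HasFDerivAt.fun_sum fun i hi => ?_
    exact (((contDiff_softmax hi).differentiable (by simp)).differentiableAt.hasFDerivAt).mul_const _
  rw [h1.fderiv]
  simp only [sum_apply, smul_apply, smul_eq_mul]
  have h2 : ∑ i ∈ J, inner ℝ (q i) v * fderiv ℝ (softmax q b J β i) x w =
      ∑ i ∈ J, ∑ j ∈ J, (β * softmax q b J β i x * softmax q b J β j x) *
        (inner ℝ (q i) v * inner ℝ (q i - q j) w) := by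
    refine Finset.sum_congr rfl fun i hi => ?_
    rw [fderiv_softmax hi, Finset.mul_sum, Finset.mul_sum]
    exact Finset.sum_congr rfl fun j _ => by ring
  have h3 : ∑ i ∈ J, ∑ j ∈ J, (β * softmax q b J β i x * softmax q b J β j x) *
        (inner ℝ (q i) v * inner ℝ (q i - q j) w) = ∑ i ∈ J, ∑ j ∈ J,
        (β * softmax q b J β i x * softmax q b J β j x) *
        (inner ℝ (q j) v * inner ℝ (q j - q i) w) := by
    rw [Finset.sum_comm]
    exact Finset.sum_congr rfl fun i _ => Finset.sum_congr rfl fun j _ => by ring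
  have h4 : ∀ a c : ℝ, a = c → a = 2⁻¹ * (a + c) := by intro a c h; rw [h]; ring
  rw [h2, h4 _ _ h3, ← Finset.sum_add_distrib, Finset.mul_sum]
  refine Finset.sum_congr rfl fun i _ => ?_
  rw [← Finset.sum_add_distrib, Finset.mul_sum]
  refine Finset.sum_congr rfl fun j _ => ?_
  simp only [inner_sub_left]
  ring

variable [FiniteDimensional ℝ E] [MeasurableSpace E] [BorelSpace E]

lemma integral_softSlope_mul_fderiv {ψ : E → ℝ} (hψ : ContDiff ℝ 1 ψ) (hc : HasCompactSupport ψ)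
    (v w : E) :
    ∑ i ∈ J, ∑ j ∈ J, 2⁻¹ * (inner ℝ (q i - q j) v * inner ℝ (q i - q j) w) *
      ∫ x, β * softmax q b J β i x * softmax q b J β j x * ψ x =
      - ∫ x, softSlope q b J β v x * fderiv ℝ ψ x w := by
  have hcG : Continuous (softSlope q b J β v) := (contDiff_softSlope v).continuous
  have hcG' : Continuous fun x => fderiv ℝ (softSlope q b J β v) x w :=
    ((contDiff_softSlope v).continuous_fderiv (by simp)).clm_apply continuous_const
  have hcψ' : Continuous fun x => fderiv ℝ ψ x w :=
    (hψ.continuous_fderiv (by simp)).clm_apply continuous_const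
  rw [integral_mul_fderiv_eq_neg_fderiv_mul_of_integrable (μ := volume), neg_neg]
  · simp only [fderiv_softSlope, Finset.sum_mul]
    rw [integral_finsetSum]
    · refine Finset.sum_congr rfl fun i hi => ?_
      rw [integral_finsetSum]
      · refine Finset.sum_congr rfl fun j hj => ?_
        rw [← integral_const_mul]
        congr 1; ext x; ring
      · intro j hj
        refine Continuous.integrable_of_hasCompactSupport ?_ (hc.mul_left)
        exact (((continuous_const.mul (contDiff_softmax hi).continuous).mul
          (contDiff_softmax hj).continuous).mul continuous_const).mul hψ.continuous
    · intro i hi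
      refine integrable_finsetSum _ fun j hj => ?_
      refine Continuous.integrable_of_hasCompactSupport ?_ (hc.mul_left)
      exact (((continuous_const.mul (contDiff_softmax hi).continuous).mul
          (contDiff_softmax hj).continuous).mul continuous_const).mul hψ.continuous
  · exact (hcG'.mul hψ.continuous).integrable_of_hasCompactSupport hc.mul_left
  · exact (hcG.mul hcψ').integrable_of_hasCompactSupport
      ((hc.fderiv_apply ℝ w).mul_left)
  · exact (hcG.mul hψ.continuous).integrable_of_hasCompactSupport hc.mul_left
  · intro x _; exact ((contDiff_softSlope v).differentiable (by simp)).differentiableAt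
  · intro x _; exact (hψ.differentiable (by simp)).differentiableAt

end Softmax

/-! ### The transverse profile of a facet -/

section Logistic

lemma integrable_sigmoid_mul_sigmoid_neg :
    Integrable (fun s : ℝ => Real.sigmoid s * Real.sigmoid (-s)) := by
  have h1 : IntegrableOn (fun s : ℝ => Real.sigmoid s * Real.sigmoid (-s)) (Set.Ioi 0) := by
    refine integrableOn_Ioi_deriv_of_nonneg' (g := Real.sigmoid) (fun x _ => ?_)
      (fun x _ => mul_nonneg (Real.sigmoid_nonneg _) (Real.sigmoid_nonneg _))
      Real.tendsto_sigmoid_atTop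
    rw [Real.sigmoid_neg]; exact Real.hasDerivAt_sigmoid x
  have h2 : IntegrableOn (fun s : ℝ => Real.sigmoid s * Real.sigmoid (-s)) (Set.Iic 0) := by
    have h3 := (integrableOn_Ici_iff_integrableOn_Ioi enorm_ne_top).2 h1
    rw [← neg_zero] at h3
    simpa [mul_comm] using h3.comp_neg_Iic
  rw [← integrableOn_univ, ← Set.Iic_union_Ioi (a := (0 : ℝ))]
  exact h2.union h1

lemma integral_sigmoid_mul_sigmoid_neg :
    ∫ s : ℝ, Real.sigmoid s * Real.sigmoid (-s) = 1 := by
  have := integral_of_hasDerivAt_of_tendsto (f := Real.sigmoid) (fun x => by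
    simpa [Real.sigmoid_neg] using Real.hasDerivAt_sigmoid x) integrable_sigmoid_mul_sigmoid_neg
    Real.tendsto_sigmoid_atBot Real.tendsto_sigmoid_atTop
  simpa using this

end Logistic

/-! ### Concentration of the smoothed Hessian on the facets -/

section FacetLimit

variable {E : Type*} [NormedAddCommGroup E] [InnerProductSpace ℝ E]
variable {ι : Type*} (q : ι → E) (b : ι → ℝ)

/-- The points at which both indices of the pair `p` are active. -/
def facet (J : Set ι) (p : ι × ι) : Set E := {x | IsActive q b J x p.1 ∧ IsActive q b J x p.2}

variable {q b}

lemma isClosed_isActive (J : Set ι) (i : ι) : IsClosed {x | IsActive q b J x i} := by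
  unfold IsActive
  simp only [Set.ofPred_and, Set.ofPred_forall]
  refine isClosed_const.inter (isClosed_iInter fun j => isClosed_iInter fun _ => ?_)
  exact isClosed_le (continuous_affineFun q b j) (continuous_affineFun q b i)

lemma isClosed_facet (J : Set ι) (p : ι × ι) : IsClosed (facet q b J p) :=
  (isClosed_isActive J p.1).inter (isClosed_isActive J p.2)

lemma IsActive.eq {J : Set ι} {x : E} {i j : ι} (hi : IsActive q b J x i)
    (hj : IsActive q b J x j) : affineFun q b i x = affineFun q b j x :=
  le_antisymm (hj.2 i hi.1) (hi.2 j hj.1)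

/-- At distance of order `1 / β` from a point `y` of the tie hyperplane, `β` times the difference of
`i` and `j` is the constant `s`. On the facet all other indices are exponentially small, so the
weights become those of a two-term softmax; off the facet some `k` strictly beats `i` and kills the
product. -/
lemma tendsto_softmax_mul_softmax {J : Finset ι} {i j : ι} (hi : i ∈ J) (hj : j ∈ J) (hij : i ≠ j)
    {y m : E} (hy : affineFun q b i y = affineFun q b j y) {s : ℝ}
    (hm : inner ℝ (q i - q j) m = s)
    (hgen : ∀ k ∈ J, k ≠ i → k ≠ j → ¬ (IsActive q b J y i ∧ IsActive q b J y j ∧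
      IsActive q b J y k)) [Decidable (y ∈ facet q b J (i, j))] :
    Tendsto (fun β : ℝ => softmax q b J β i (y + β⁻¹ • m) * softmax q b J β j (y + β⁻¹ • m)) atTop
      (𝓝 (if y ∈ facet q b J (i, j) then Real.sigmoid s * Real.sigmoid (-s) else 0)) := by
  classical
  have hdiff : ∀ β : ℝ, β ≠ 0 → ∀ k l, β * (affineFun q b k (y + β⁻¹ • m) -
      affineFun q b l (y + β⁻¹ • m)) =
      β * (affineFun q b k y - affineFun q b l y) + inner ℝ (q k - q l) m := by
    intro β hβ k l
    simp only [affineFun, inner_add_right, inner_smul_right, inner_sub_left]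
    field_simp
    ring
  split_ifs with hF
  · have hlt : ∀ k ∈ J, k ≠ i → k ≠ j → affineFun q b k y < affineFun q b i y := by
      intro k hk hki hkj
      refine lt_of_le_of_ne (hF.1.2 k hk) fun h => hgen k hk hki hkj ⟨hF.1, hF.2, hk, ?_⟩
      intro l hl
      rw [h]; exact hF.1.2 l hl
    have key : ∀ i j : ι, i ∈ J → j ∈ J → i ≠ j → affineFun q b i y = affineFun q b j y →
        (∀ k ∈ J, k ≠ i → k ≠ j → affineFun q b k y < affineFun q b i y) →
        Tendsto (fun β : ℝ => softmax q b J β i (y + β⁻¹ • m)) atTop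
          (𝓝 (Real.sigmoid (inner ℝ (q i - q j) m))) := by
      intro i j hi hj hij hy hlt
      have h1 : ∀ k ∈ J, Tendsto (fun β : ℝ => Real.exp (β * (affineFun q b k (y + β⁻¹ • m) -
          affineFun q b i (y + β⁻¹ • m)))) atTop
          (𝓝 ((if k = i then 1 else 0) +
            (if k = j then Real.exp (-inner ℝ (q i - q j) m) else 0))) := by
        intro k hk
        have hev : (fun β : ℝ => Real.exp (β * (affineFun q b k y - affineFun q b i y) +
            inner ℝ (q k - q i) m)) =ᶠ[atTop] (fun β : ℝ => Real.exp (β *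
            (affineFun q b k (y + β⁻¹ • m) - affineFun q b i (y + β⁻¹ • m)))) := by
          filter_upwards [eventually_ne_atTop 0] with β hβ
          rw [hdiff β hβ]
        refine Tendsto.congr' hev ?_
        rcases eq_or_ne k i with rfl | hki
        · simp [hij]
        rcases eq_or_ne k j with rfl | hkj
        · simp only [hki, if_false, if_true, zero_add, hy, sub_self, mul_zero]
          rw [← inner_neg_left, neg_sub]
          exact tendsto_const_nhds
        · simp only [hki, hkj, if_false, zero_add]
          refine Real.tendsto_exp_atBot.comp ?_
          refine tendsto_atBot_add_const_right _ _ ?_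
          exact tendsto_id.atTop_mul_const_of_neg (sub_neg.2 (hlt k hk hki hkj))
      have h2 := tendsto_finsetSum J h1
      rw [Finset.sum_add_distrib, Finset.sum_ite_eq' J i, Finset.sum_ite_eq' J j, if_pos hi,
        if_pos hj] at h2
      exact h2.inv₀ (by positivity)
    have hi' := key i j hi hj hij hy hlt
    have hj' := key j i hj hi hij.symm hy.symm (fun k hk h1 h2 => hy ▸ hlt k hk h2 h1)
    rw [hm] at hi'
    rw [← neg_sub, inner_neg_left, hm] at hj'
    exact hi'.mul hj'
  · obtain ⟨k, hk, hlt⟩ : ∃ k ∈ J, affineFun q b i y < affineFun q b k y := by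
      by_contra! hcon
      exact hF ⟨⟨hi, hcon⟩, ⟨hj, fun k hk => hy ▸ hcon k hk⟩⟩
    have h1 : Tendsto (fun β : ℝ => Real.exp (-(β * (affineFun q b k y - affineFun q b i y) +
            inner ℝ (q k - q i) m))) atTop (𝓝 0) := by
      refine Real.tendsto_exp_atBot.comp (tendsto_neg_atTop_atBot.comp ?_)
      exact tendsto_atTop_add_const_right _ _ (tendsto_id.atTop_mul_const (sub_pos.2 hlt))
    refine squeeze_zero' (Eventually.of_forall fun β => mul_nonneg (softmax_nonneg _ _)
      (softmax_nonneg _ _)) ?_ h1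
    filter_upwards [eventually_ne_atTop 0] with β hβ
    refine (mul_le_of_le_one_right (softmax_nonneg _ _) (softmax_le_one hj _)).trans ?_
    rw [← hdiff β hβ, Real.exp_neg]
    refine inv_anti₀ (Real.exp_pos _) ?_
    exact Finset.single_le_sum
      (f := fun k => Real.exp (β * (affineFun q b k (y + β⁻¹ • m) -
        affineFun q b i (y + β⁻¹ • m)))) (fun k _ => (Real.exp_pos _).le) hk

lemma inner_hyperplane_point {n : E} (hn : n ≠ 0) (c : ℝ) (z : (ℝ ∙ n)ᗮ) :
    inner ℝ n ((c / ‖n‖ ^ 2) • n + (z : E)) = c := by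
  have hz : inner ℝ n (z : E) = 0 :=
    (Submodule.mem_orthogonal_singleton_iff_inner_right).1 z.2
  have : ‖n‖ ≠ 0 := norm_ne_zero_iff.2 hn
  rw [inner_add_right, inner_smul_right, hz, real_inner_self_eq_norm_sq]
  field_simp
  ring

lemma norm_le_hyperplane_point {n : E} (t : ℝ) (z : (ℝ ∙ n)ᗮ) : ‖z‖ ≤ ‖t • n + (z : E)‖ := by
  have hz : inner ℝ (t • n) (z : E) = 0 := by
    rw [inner_smul_left, (Submodule.mem_orthogonal_singleton_iff_inner_right).1 z.2, mul_zero]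
  have := norm_add_sq_eq_norm_sq_add_norm_sq_of_inner_eq_zero _ _ hz
  rw [Submodule.coe_norm]
  nlinarith [norm_nonneg (t • n), norm_nonneg (z : E), norm_nonneg (t • n + (z : E))]

variable [FiniteDimensional ℝ E] [MeasurableSpace E] [BorelSpace E]

/-- The concentration of the softmax weights on the facets. -/
lemma tendsto_integral_softmax {J : Finset ι} {i j : ι} (hi : i ∈ J) (hj : j ∈ J)
    (hq : q i ≠ q j)
    (hgen : ∀ k ∈ J, k ≠ i → k ≠ j → ∀ᵐ x ∂(hyperplaneMeasure (q i - q j) (b i - b j)),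
      ¬ (IsActive q b J x i ∧ IsActive q b J x j ∧ IsActive q b J x k))
    {ψ : E → ℝ} (hψ : Continuous ψ) (hc : HasCompactSupport ψ) :
    Tendsto (fun β : ℝ => ∫ x, β * softmax q b J β i x * softmax q b J β j x * ψ x) atTop
      (𝓝 (‖q i - q j‖⁻¹ * ∫ x in facet q b J (i, j), ψ x
        ∂(hyperplaneMeasure (q i - q j) (b i - b j)))) := by
  classical
  have hij : i ≠ j := fun h => hq (h ▸ rfl)
  set n := q i - q j with hn_def
  set c := b i - b j with hc_def
  have hn : n ≠ 0 := sub_ne_zero.2 hq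
  have hn0 : 0 < ‖n‖ := norm_pos_iff.2 hn
  set P : (ℝ ∙ n)ᗮ → E := fun z => (c / ‖n‖ ^ 2) • n + (z : E) with hP
  have hPcont : Continuous P := by fun_prop
  set m : ℝ → E := fun s => (s / ‖n‖ ^ 2) • n with hm
  have hms : ∀ s, inner ℝ n (m s) = s := by
    intro s
    rw [hm, inner_smul_right, real_inner_self_eq_norm_sq]; field_simp
  have hgen' : ∀ᵐ z : (ℝ ∙ n)ᗮ, ∀ k ∈ J, k ≠ i → k ≠ j →
      ¬ (IsActive q b J (P z) i ∧ IsActive q b J (P z) j ∧ IsActive q b J (P z) k) := by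
    have h1 : ∀ᵐ x ∂(hyperplaneMeasure n c), ∀ k ∈ J, k ≠ i → k ≠ j →
        ¬ (IsActive q b J x i ∧ IsActive q b J x j ∧ IsActive q b J x k) := by
      refine (Finset.eventually_all J).2 fun k hk => ?_
      by_cases hki : k = i
      · simp [hki]
      by_cases hkj : k = j
      · simp [hkj]
      filter_upwards [hgen k hk hki hkj] with x hx _ _ using hx
    exact ae_of_ae_map hPcont.measurable.aemeasurable h1
  obtain ⟨M, hM⟩ := hψ.bounded_above_of_compact_support hc
  obtain ⟨R, hR⟩ := hc.isCompact.isBounded.subset_closedBall (0 : E)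
  -- With thickness measured in units of `β⁻¹`, the Jacobian `β⁻¹ / ‖n‖` cancels the factor `β`.
  have hslice : ∀ β : ℝ, 0 < β →
      ∫ x, β * softmax q b J β i x * softmax q b J β j x * ψ x =
      ‖n‖⁻¹ * ∫ p : ℝ × (ℝ ∙ n)ᗮ, (softmax q b J β i (P p.2 + β⁻¹ • m p.1) *
        softmax q b J β j (P p.2 + β⁻¹ • m p.1)) * ψ (P p.2 + β⁻¹ • m p.1) := by
    intro β hβ
    rw [integral_slice n hn c β⁻¹ (inv_pos.2 hβ)]
    have : ∀ p : ℝ × (ℝ ∙ n)ᗮ, ((c + β⁻¹ * p.1) / ‖n‖ ^ 2) • n + (p.2 : E) =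
        P p.2 + β⁻¹ • m p.1 := by
      intro p
      simp only [hP, hm, smul_smul, add_div, add_smul, mul_div_assoc]
      abel
    simp only [this, mul_assoc]
    rw [integral_const_mul]
    field_simp
  have hlim : Tendsto (fun β : ℝ => ∫ p : ℝ × (ℝ ∙ n)ᗮ, (softmax q b J β i (P p.2 + β⁻¹ • m p.1) *
        softmax q b J β j (P p.2 + β⁻¹ • m p.1)) * ψ (P p.2 + β⁻¹ • m p.1)) atTop
      (𝓝 (∫ p : ℝ × (ℝ ∙ n)ᗮ, (Real.sigmoid p.1 * Real.sigmoid (-p.1)) *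
        ((facet q b J (i, j)).indicator ψ (P p.2)))) := by
    -- The dominating function: sigmoids transversally, and tangentially a ball that contains the
    -- projection of the support of `ψ`.
    have hbd : Integrable (fun p : ℝ × (ℝ ∙ n)ᗮ => (Real.sigmoid p.1 * Real.sigmoid (-p.1)) *
        ((Metric.closedBall (0 : (ℝ ∙ n)ᗮ) R).indicator (fun _ => M) p.2))
        ((volume : Measure ℝ).prod volume) := by
      refine integrable_sigmoid_mul_sigmoid_neg.mul_prod ?_
      exact (integrable_indicator_iff Metric.isClosed_closedBall.measurableSet).2
        (integrableOn_const (isCompact_closedBall _ _).measure_lt_top.ne)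
    refine tendsto_integral_filter_of_dominated_convergence _ ?_ ?_ hbd ?_
    · filter_upwards with β
      refine Continuous.aestronglyMeasurable ?_
      have hx : Continuous fun p : ℝ × (ℝ ∙ n)ᗮ => P p.2 + β⁻¹ • m p.1 := by fun_prop
      exact (((contDiff_softmax hi).continuous.comp hx).mul
        ((contDiff_softmax hj).continuous.comp hx)).mul (hψ.comp hx)
    · filter_upwards [eventually_gt_atTop 0] with β hβ
      refine Eventually.of_forall fun p => ?_
      have hval : β * (affineFun q b i (P p.2 + β⁻¹ • m p.1) -
          affineFun q b j (P p.2 + β⁻¹ • m p.1)) = p.1 := by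
        have h1 : affineFun q b i (P p.2 + β⁻¹ • m p.1) - affineFun q b j (P p.2 + β⁻¹ • m p.1) =
            inner ℝ n (P p.2 + β⁻¹ • m p.1) - c := by
          simp only [affineFun, hn_def, hc_def, inner_sub_left]; ring
        rw [h1, inner_add_right, inner_smul_right, hms, inner_hyperplane_point hn]
        field_simp
        ring
      have h1 := softmax_le (q := q) (b := b) (β := β) hi hj hij (P p.2 + β⁻¹ • m p.1)
      have h2 := softmax_le (q := q) (b := b) (β := β) hj hi hij.symm (P p.2 + β⁻¹ • m p.1)
      rw [hval] at h1
      rw [← neg_sub, mul_neg, hval] at h2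
      rw [norm_mul, norm_mul, Real.norm_of_nonneg (softmax_nonneg _ _),
        Real.norm_of_nonneg (softmax_nonneg _ _)]
      by_cases hz : p.2 ∈ Metric.closedBall (0 : (ℝ ∙ n)ᗮ) R
      · rw [Set.indicator_of_mem hz]
        exact mul_le_mul (mul_le_mul h1 h2 (softmax_nonneg _ _) (Real.sigmoid_nonneg _)) (hM _)
          (norm_nonneg _) (mul_nonneg (Real.sigmoid_nonneg _) (Real.sigmoid_nonneg _))
      · rw [Set.indicator_of_notMem hz]
        have : ψ (P p.2 + β⁻¹ • m p.1) = 0 := by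
          by_contra hne
          have h3 := hR (subset_tsupport _ hne)
          apply hz
          rw [mem_closedBall_zero_iff] at h3 ⊢
          refine le_trans ?_ h3
          have h4 : P p.2 + β⁻¹ • m p.1 = (c / ‖n‖ ^ 2 + β⁻¹ * (p.1 / ‖n‖ ^ 2)) • n + (p.2 : E) := by
            simp only [hP, hm, smul_smul, add_smul]; abel
          rw [h4]
          exact norm_le_hyperplane_point _ _
        simp [this]
    · have hprod : ∀ᵐ p ∂((volume : Measure ℝ).prod (volume : Measure (ℝ ∙ n)ᗮ)),
          ∀ k ∈ J, k ≠ i → k ≠ j →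
          ¬ (IsActive q b J (P p.2) i ∧ IsActive q b J (P p.2) j ∧ IsActive q b J (P p.2) k) :=
        Measure.quasiMeasurePreserving_snd.ae hgen'
      filter_upwards [hprod] with p hp
      have hy : affineFun q b i (P p.2) = affineFun q b j (P p.2) := by
        have h1 : affineFun q b i (P p.2) - affineFun q b j (P p.2) =
            inner ℝ n (P p.2) - c := by
          simp only [affineFun, hn_def, hc_def, inner_sub_left]; ring
        rw [inner_hyperplane_point hn, sub_self] at h1
        exact sub_eq_zero.1 h1
      have h1 := tendsto_softmax_mul_softmax hi hj hij hy (hms p.1) hp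
      have h2 : Tendsto (fun β : ℝ => ψ (P p.2 + β⁻¹ • m p.1)) atTop (𝓝 (ψ (P p.2))) := by
        have : Tendsto (fun β : ℝ => P p.2 + β⁻¹ • m p.1) atTop (𝓝 (P p.2 + (0 : ℝ) • m p.1)) :=
          tendsto_const_nhds.add (tendsto_inv_atTop_zero.smul_const _)
        rw [zero_smul, add_zero] at this
        exact (hψ.tendsto _).comp this
      convert! h1.mul h2 using 2
      by_cases h : P p.2 ∈ facet q b J (i, j) <;> simp [h]
  have hval : ∫ p : ℝ × (ℝ ∙ n)ᗮ, (Real.sigmoid p.1 * Real.sigmoid (-p.1)) *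
        ((facet q b J (i, j)).indicator ψ (P p.2)) =
      ∫ x in facet q b J (i, j), ψ x ∂(hyperplaneMeasure n c) := by
    rw [← integral_indicator (isClosed_facet _ _).measurableSet, integral_hyperplaneMeasure]
    have := integral_prod_mul (μ := (volume : Measure ℝ)) (ν := (volume : Measure (ℝ ∙ n)ᗮ))
      (fun s => Real.sigmoid s * Real.sigmoid (-s))
      (fun z => (facet q b J (i, j)).indicator ψ (P z))
    -- The profile is the derivative of the sigmoid, so it integrates to 1.
    rw [integral_sigmoid_mul_sigmoid_neg, one_mul] at this
    exact this
  rw [← hval]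
  refine Tendsto.congr' ?_ (hlim.const_mul ‖n‖⁻¹)
  filter_upwards [eventually_gt_atTop 0] with β hβ
  rw [hslice β hβ]

end FacetLimit

/-! ### The facet measure as the Hessian of a finite maximum -/

section FacetMeasure

variable {E : Type*} [NormedAddCommGroup E] [InnerProductSpace ℝ E] [FiniteDimensional ℝ E]
  [MeasurableSpace E] [BorelSpace E]
variable {ι : Type*} (q : ι → E) (b : ι → ℝ)

instance (n : E) (c : ℝ) : IsFiniteMeasureOnCompacts (hyperplaneMeasure n c) where
  lt_top_of_isCompact := by
    intro K hK
    obtain ⟨R, hR⟩ := hK.isBounded.subset_closedBall (0 : E)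
    refine (measure_mono hR).trans_lt ?_
    rw [hyperplaneMeasure, Measure.map_apply (by fun_prop) Metric.isClosed_closedBall.measurableSet]
    refine (measure_mono (t := Metric.closedBall (0 : (ℝ ∙ n)ᗮ) R) fun z hz => ?_).trans_lt
      (isCompact_closedBall _ _).measure_lt_top
    rw [Set.mem_preimage, mem_closedBall_zero_iff] at hz
    rw [mem_closedBall_zero_iff]
    exact (norm_le_hyperplane_point _ z).trans hz

lemma ae_hyperplaneMeasure {n : E} (hn : n ≠ 0) (c : ℝ) :
    ∀ᵐ x ∂hyperplaneMeasure n c, inner ℝ n x = c := by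
  rw [hyperplaneMeasure, ae_map_iff (by fun_prop)
    (isClosed_eq (by fun_prop) continuous_const).measurableSet]
  exact Eventually.of_forall fun z => inner_hyperplane_point hn c z

lemma volume_hyperplane {n : E} (hn : n ≠ 0) (c : ℝ) : volume {x : E | inner ℝ n x = c} = 0 := by
  rcases Set.eq_empty_or_nonempty {x : E | inner ℝ n x = c} with h | ⟨y, hy⟩
  · rw [h, measure_empty]
  · have h1 : {x : E | inner ℝ n x = c} = (fun x => x + -y) ⁻¹' ((ℝ ∙ n)ᗮ : Submodule ℝ E) := by
      ext x
      simp only [Set.mem_preimage, SetLike.mem_coe,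
        Submodule.mem_orthogonal_singleton_iff_inner_right, inner_add_right, inner_neg_right,
        Set.mem_ofPred_eq] at hy ⊢
      rw [hy]
      constructor <;> intro h <;> linarith
    rw [h1, measure_preimage_add_right]
    refine Measure.addHaar_submodule _ _ fun htop => hn ?_
    have : n ∈ (ℝ ∙ n)ᗮ := htop ▸ Submodule.mem_top
    exact inner_self_eq_zero.1 ((Submodule.mem_orthogonal_singleton_iff_inner_right).1 this)

/-- The measure carried by the facets of the maximum of the affine functions indexed by `J`,
together with the normal directions, weighted by the jump of the gradient. -/
noncomputable def facetMeasure (J : Set ι) : Measure (E × E) :=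
  Measure.sum fun p : ι × ι => ENNReal.ofReal (‖q p.1 - q p.2‖ / 2) •
    Measure.map (fun x => (x, q p.1 - q p.2))
      ((hyperplaneMeasure (q p.1 - q p.2) (b p.1 - b p.2)).restrict (facet q b J p))

/-- At almost every point of the hyperplane on which two affine functions agree, no third one is
active together with them. -/
def IsGeneric (J : Set ι) : Prop :=
  ∀ i j k, k ≠ i → k ≠ j → q i ≠ q j → ∀ᵐ x ∂hyperplaneMeasure (q i - q j) (b i - b j),
    ¬ (IsActive q b J x i ∧ IsActive q b J x j ∧ IsActive q b J x k)

open Classical in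
/-- The slope of an active affine function. -/
noncomputable def activeSlope (J : Set ι) (x : E) : E :=
  if h : ∃ i, IsActive q b J x i then q h.choose else 0

variable {q b}

lemma facet_eq_empty {J : Set ι} {p : ι × ι} (hp : p ∉ J ×ˢ J) : facet q b J p = ∅ := by
  ext x
  simp only [facet, Set.mem_ofPred_eq, Set.mem_empty_iff_false, iff_false]
  exact fun h => hp ⟨h.1.1, h.2.1⟩

lemma facetMeasure_finset (J : Finset ι) :
    facetMeasure q b (J : Set ι) = ∑ p ∈ J ×ˢ J, ENNReal.ofReal (‖q p.1 - q p.2‖ / 2) •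
    Measure.map (fun x => (x, q p.1 - q p.2))
      ((hyperplaneMeasure (q p.1 - q p.2) (b p.1 - b p.2)).restrict (facet q b J p)) := by
  ext s hs
  rw [facetMeasure, Measure.sum_apply _ hs, Measure.finsetSum_apply]
  refine tsum_eq_sum fun p hp => ?_
  rw [facet_eq_empty (by simpa using hp)]
  simp

/-- Indices with different slopes tie only on a null hyperplane; with equal slopes a tie forces
equal constants, hence equal indices. -/
lemma ae_unique_active [Countable ι] (hinj : Function.Injective fun i => (q i, b i))
    (J : Set ι) :
    ∀ᵐ x : E, ∀ i j, IsActive q b J x i → IsActive q b J x j → i = j := by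
  rw [ae_all_iff]; intro i
  rw [ae_all_iff]; intro j
  by_cases hij : i = j
  · simp [hij]
  by_cases hq : q i = q j
  · refine Eventually.of_forall fun x hi hj => hinj ?_
    have := hi.eq hj
    simp only [affineFun, hq, sub_right_inj] at this
    simp [hq, this]
  · have h := volume_hyperplane (sub_ne_zero.2 hq) (b i - b j)
    rw [← compl_compl {x : E | inner ℝ (q i - q j) x = b i - b j}] at h
    filter_upwards [compl_mem_ae_iff.2 (by simpa using h)] with x hx hi hj
    exfalso
    apply hx
    have := hi.eq hj
    simp only [affineFun, inner_sub_left, Set.mem_ofPred_eq] at this ⊢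
    linarith

lemma activeSlope_eq {J : Set ι} {x : E} {i : ι} (hi : IsActive q b J x i)
    (huniq : ∀ i j, IsActive q b J x i → IsActive q b J x j → i = j) :
    activeSlope q b J x = q i := by
  have h : ∃ i, IsActive q b J x i := ⟨i, hi⟩
  rw [activeSlope, dif_pos h, huniq _ _ h.choose_spec hi]

lemma exists_isActive {J : Finset ι} (hJ : J.Nonempty) (x : E) : ∃ i, IsActive q b J x i := by
  obtain ⟨i, hi, h⟩ := J.exists_max_image (fun i => affineFun q b i x) hJ
  exact ⟨i, hi, h⟩

lemma tendsto_softSlope {J : Finset ι} (hJ : J.Nonempty) (v : E) {x : E}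
    (huniq : ∀ i j, IsActive q b J x i → IsActive q b J x j → i = j) :
    Tendsto (fun β : ℝ => softSlope q b J β v x) atTop
      (𝓝 (inner ℝ (activeSlope q b J x) v)) := by
  classical
  obtain ⟨i, hi⟩ := exists_isActive (q := q) (b := b) hJ x
  rw [activeSlope_eq hi huniq]
  have hlt : ∀ k ∈ J, k ≠ i → affineFun q b k x < affineFun q b i x := by
    intro k hk hki
    refine lt_of_le_of_ne (hi.2 k hk) fun h => hki (huniq _ _ ⟨hk, ?_⟩ hi)
    intro l hl
    rw [h]; exact hi.2 l hl
  have h1 : ∀ k ∈ J, Tendsto (fun β : ℝ => Real.exp (β * (affineFun q b k x - affineFun q b i x)))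
      atTop (𝓝 (if k = i then 1 else 0)) := by
    intro k hk
    split_ifs with hki
    · simp [hki]
    · exact Real.tendsto_exp_atBot.comp
        (tendsto_id.atTop_mul_const_of_neg (sub_neg.2 (hlt k hk hki)))
  have h2 : Tendsto (fun β : ℝ => softmax q b J β i x) atTop (𝓝 1) := by
    have := tendsto_finsetSum J h1
    rw [Finset.sum_ite_eq' J i, if_pos (by simpa using hi.1)] at this
    simpa [softmax] using this.inv₀ one_ne_zero
  have h3 : ∀ k ∈ J, Tendsto (fun β : ℝ => softmax q b J β k x * inner ℝ (q k) v) atTop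
      (𝓝 (if k = i then inner ℝ (q i) v else 0)) := by
    intro k hk
    have := ((h2.mul (h1 k hk)).mul_const (inner ℝ (q k) v))
    simp only [softmax_mul_exp k x] at this
    convert this using 2
    split_ifs with hki <;> simp [hki]
  have := tendsto_finsetSum J h3
  rwa [Finset.sum_ite_eq' J i, if_pos (by simpa using hi.1)] at this

/-- `activeSlope` is defined by choice; it is measurable because it is almost everywhere the limit
of the smooth slopes. -/
lemma aestronglyMeasurable_inner_activeSlope [Countable ι]
    (hinj : Function.Injective fun i => (q i, b i)) {J : Finset ι} (hJ : J.Nonempty) (v : E) :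
    AEStronglyMeasurable (fun x => inner ℝ (activeSlope q b J x) v) := by
  refine aestronglyMeasurable_of_tendsto_ae (atTop : Filter ℝ)
    (f := fun β x => softSlope q b J β v x)
    (fun β => (contDiff_softSlope v).continuous.aestronglyMeasurable) ?_
  filter_upwards [ae_unique_active hinj (J : Set ι)] with x hx
  exact tendsto_softSlope hJ v hx

lemma norm_activeSlope_le {J : Set ι} {C : ℝ} (hC : 0 ≤ C) (hq : ∀ i, ‖q i‖ ≤ C) (x : E) :
    ‖activeSlope q b J x‖ ≤ C := by
  unfold activeSlope
  split_ifs
  · exact hq _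
  · simpa using hC

lemma integrable_facet_term (J : Set ι) (p : ι × ι) {ψ : E → ℝ} (hψ : Continuous ψ)
    (hc : HasCompactSupport ψ) (g : E → ℝ) :
    Integrable (fun z : E × E => ψ z.1 * g z.2) (ENNReal.ofReal (‖q p.1 - q p.2‖ / 2) •
      Measure.map (fun x => (x, q p.1 - q p.2))
        ((hyperplaneMeasure (q p.1 - q p.2) (b p.1 - b p.2)).restrict (facet q b J p))) := by
  refine Integrable.smul_measure ?_ ENNReal.ofReal_ne_top
  rw [(measurableEmbedding_prod_mk_right _).integrable_map_iff]
  have h : Integrable ψ (hyperplaneMeasure (q p.1 - q p.2) (b p.1 - b p.2)) :=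
    hψ.integrable_of_hasCompactSupport hc
  exact (h.mul_const (g (q p.1 - q p.2))).integrableOn

lemma integral_facet_term (J : Set ι) (p : ι × ι) (F : E × E → ℝ) :
    ∫ z, F z ∂(ENNReal.ofReal (‖q p.1 - q p.2‖ / 2) •
      Measure.map (fun x => (x, q p.1 - q p.2))
        ((hyperplaneMeasure (q p.1 - q p.2) (b p.1 - b p.2)).restrict (facet q b J p))) =
      (‖q p.1 - q p.2‖ / 2) * ∫ x in facet q b J p, F (x, q p.1 - q p.2)
        ∂(hyperplaneMeasure (q p.1 - q p.2) (b p.1 - b p.2)) := by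
  rw [integral_smul_measure, (measurableEmbedding_prod_mk_right _).integral_map,
    ENNReal.toReal_ofReal (by positivity), smul_eq_mul]

/-- The Hessian of the maximum of finitely many affine functions, tested against `ψ`. -/
theorem integral_facetMeasure_finset [Countable ι] {J : Finset ι} (hJ : J.Nonempty)
    (hinj : Function.Injective fun i => (q i, b i)) (hgen : IsGeneric q b (J : Set ι))
    {ψ : E → ℝ} (hψ : ContDiff ℝ 1 ψ) (hc : HasCompactSupport ψ) (v w : E) :
    ∫ z, ψ z.1 * (inner ℝ z.2 v * inner ℝ z.2 w / ‖z.2‖ ^ 2) ∂(facetMeasure q b (J : Set ι)) =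
      - ∫ x, inner ℝ (activeSlope q b J x) v * fderiv ℝ ψ x w := by
  have hcψ' : Continuous fun x => fderiv ℝ ψ x w :=
    (hψ.continuous_fderiv (by simp)).clm_apply continuous_const
  have hcs' : HasCompactSupport fun x => fderiv ℝ ψ x w := hc.fderiv_apply ℝ w
  have hR : Tendsto (fun β : ℝ => - ∫ x, softSlope q b J β v x * fderiv ℝ ψ x w) atTop
      (𝓝 (- ∫ x, inner ℝ (activeSlope q b J x) v * fderiv ℝ ψ x w)) := by
    refine Tendsto.neg ?_
    refine tendsto_integral_filter_of_dominated_convergence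
      (fun x => (∑ i ∈ J, ‖(inner ℝ (q i) v : ℝ)‖) * ‖fderiv ℝ ψ x w‖) ?_ ?_ ?_ ?_
    · exact Eventually.of_forall fun β =>
        ((contDiff_softSlope v).continuous.mul hcψ').aestronglyMeasurable
    · refine Eventually.of_forall fun β => Eventually.of_forall fun x => ?_
      rw [norm_mul]
      refine mul_le_mul_of_nonneg_right ?_ (norm_nonneg _)
      refine (norm_sum_le _ _).trans (Finset.sum_le_sum fun i hi => ?_)
      rw [norm_mul, Real.norm_of_nonneg (softmax_nonneg _ _)]
      exact mul_le_of_le_one_left (norm_nonneg _) (softmax_le_one hi _)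
    · exact (hcψ'.norm.integrable_of_hasCompactSupport hcs'.norm).const_mul _
    · filter_upwards [ae_unique_active hinj (J : Set ι)] with x hx
      exact (tendsto_softSlope hJ v hx).mul_const _
  have hL : Tendsto (fun β : ℝ => ∑ i ∈ J, ∑ j ∈ J,
      2⁻¹ * (inner ℝ (q i - q j) v * inner ℝ (q i - q j) w) *
      ∫ x, β * softmax q b J β i x * softmax q b J β j x * ψ x) atTop
      (𝓝 (∑ i ∈ J, ∑ j ∈ J, 2⁻¹ * (inner ℝ (q i - q j) v * inner ℝ (q i - q j) w) *
        (‖q i - q j‖⁻¹ * ∫ x in facet q b J (i, j), ψ x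
        ∂(hyperplaneMeasure (q i - q j) (b i - b j))))) := by
    refine tendsto_finsetSum _ fun i hi => tendsto_finsetSum _ fun j hj => ?_
    by_cases hq : q i = q j
    · simp [hq]
    · exact (tendsto_integral_softmax hi hj hq (fun k _ hki hkj => hgen i j k hki hkj hq)
        hψ.continuous hc).const_mul _
  simp only [integral_softSlope_mul_fderiv hψ hc v w] at hL
  rw [← tendsto_nhds_unique hL hR, facetMeasure_finset, integral_finsetSum_measure
    fun p _ => integrable_facet_term _ p hψ.continuous hc
      fun n => inner ℝ n v * inner ℝ n w / ‖n‖ ^ 2, Finset.sum_product]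
  refine Finset.sum_congr rfl fun i hi => Finset.sum_congr rfl fun j hj => ?_
  rw [integral_facet_term]
  simp only
  rw [integral_mul_const]
  -- The constants agree: weight `‖n‖ / 2` divided by `‖n‖²` against `2⁻¹ * ‖n‖⁻¹`.
  by_cases hn : ‖q i - q j‖ = 0
  · simp [hn]
  · field_simp

end FacetMeasure

/-- Euclidean three-space. -/
abbrev E3 := EuclideanSpace ℝ (Fin 3)

/-! ### Almost-everywhere statements and locality of the facet measure -/

section AeFacet

variable {E : Type*} [NormedAddCommGroup E] [InnerProductSpace ℝ E] [FiniteDimensional ℝ E]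
  [MeasurableSpace E] [BorelSpace E]
variable {ι : Type*} {q : ι → E} {b : ι → ℝ}

lemma ae_facetMeasure [Countable ι] {J : Set ι} {P : E × E → Prop}
    (h : ∀ i j, q i ≠ q j → ∀ᵐ x ∂hyperplaneMeasure (q i - q j) (b i - b j),
      IsActive q b J x i → IsActive q b J x j → P (x, q i - q j)) :
    ∀ᵐ z ∂facetMeasure q b J, P z := by
  rw [facetMeasure, Measure.ae_sum_iff]
  intro p
  by_cases hp : q p.1 = q p.2
  · simp [hp]
  refine Measure.ae_smul_measure ?_ _
  rw [(measurableEmbedding_prod_mk_right _).ae_map_iff,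
    ae_restrict_iff' (isClosed_facet J p).measurableSet]
  filter_upwards [h p.1 p.2 hp] with x hx hF using hx hF.1 hF.2

lemma ae_facetMeasure_ne_zero [Countable ι] (J : Set ι) :
    ∀ᵐ z ∂facetMeasure q b J, z.2 ≠ 0 :=
  ae_facetMeasure fun i j hij => Eventually.of_forall fun _ _ _ => sub_ne_zero.2 hij

lemma ae_facetMeasure_pair [Countable ι] {J : Set ι} (hgen : IsGeneric q b J) :
    ∀ᵐ z ∂facetMeasure q b J, ∃ i j, q i ≠ q j ∧ IsActive q b J z.1 i ∧ IsActive q b J z.1 j ∧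
      z.2 = q i - q j ∧ ∀ k, IsActive q b J z.1 k → k = i ∨ k = j := by
  refine ae_facetMeasure fun i j hij => ?_
  have : ∀ᵐ x ∂hyperplaneMeasure (q i - q j) (b i - b j), ∀ k, k ≠ i → k ≠ j →
      ¬ (IsActive q b J x i ∧ IsActive q b J x j ∧ IsActive q b J x k) := by
    rw [ae_all_iff]; intro k
    by_cases hki : k = i
    · simp [hki]
    by_cases hkj : k = j
    · simp [hkj]
    filter_upwards [hgen i j k hki hkj hij] with x hx _ _ using hx
  filter_upwards [this] with x hx hi hj
  refine ⟨i, j, hij, hi, hj, rfl, fun k hk => ?_⟩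
  by_contra! hne
  exact hx k hne.1 hne.2 ⟨hi, hj, hk⟩

lemma restrict_facetMeasure_congr {J J' : Set ι} {O : Set E} (hO : MeasurableSet O)
    (h : ∀ x ∈ O, ∀ i, IsActive q b J x i ↔ IsActive q b J' x i) :
    (facetMeasure q b J).restrict (O ×ˢ Set.univ) =
      (facetMeasure q b J').restrict (O ×ˢ Set.univ) := by
  have hO' : MeasurableSet (O ×ˢ (Set.univ : Set E)) := hO.prod MeasurableSet.univ
  simp only [facetMeasure, Measure.restrict_sum _ hO', Measure.restrict_smul]
  congr 1
  ext1 p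
  congr 1
  rw [Measure.restrict_map (by fun_prop) hO', Measure.restrict_map (by fun_prop) hO',
    Measure.restrict_restrict ((measurable_prodMk_right) hO'),
    Measure.restrict_restrict ((measurable_prodMk_right) hO')]
  congr 2
  ext x
  simp only [Set.mem_inter_iff, Set.mem_preimage, Set.mem_prod, Set.mem_univ, and_true, facet,
    Set.mem_ofPred_eq]
  constructor
  · rintro ⟨hx, h1, h2⟩; exact ⟨hx, (h x hx _).1 h1, (h x hx _).1 h2⟩
  · rintro ⟨hx, h1, h2⟩; exact ⟨hx, (h x hx _).2 h1, (h x hx _).2 h2⟩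

end AeFacet

/-! ### Leveled infinite families and the quadratic mass bound -/

section Leveled

variable {ι : Type*}

/-- A countable family of affine functions on `ℝ³`, organised in finite levels, such that outside
the ball of radius `R K` only the levels up to `K` contribute to the maximum. -/
structure IsLeveled (q : ι → E3) (b : ι → ℝ) (lev : ι → ℕ) (R : ℕ → ℝ) (C : ℝ) : Prop where
  inj : Function.Injective fun i => (q i, b i)
  finite : ∀ K, {i | lev i ≤ K}.Finite
  nonempty : ∀ K, {i | lev i ≤ K}.Nonempty
  pos : ∀ K, 0 < R K
  anti : Antitone R
  tendsto : Tendsto R atTop (𝓝 0)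
  dom : ∀ K x, R K < ‖x‖ → ∀ j, K < lev j → ∃ i, lev i ≤ K ∧ affineFun q b j x < affineFun q b i x
  bound : ∀ i, ‖q i‖ ≤ C
  generic : ∀ K, IsGeneric q b {i | lev i ≤ K}
  zero : ∀ i, ∃ j, affineFun q b i 0 < affineFun q b j 0

variable {q : ι → E3} {b : ι → ℝ} {lev : ι → ℕ} {R : ℕ → ℝ} {C : ℝ}

/-- Away from the origin the infinite maximum is locally a finite one, so finite-level facts
transfer. -/
lemma IsLeveled.isActive_iff (H : IsLeveled q b lev R C) {K : ℕ} {x : E3} (hx : R K < ‖x‖)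
    (i : ι) : IsActive q b Set.univ x i ↔ IsActive q b {i | lev i ≤ K} x i := by
  constructor
  · intro hi
    refine ⟨?_, fun j _ => hi.2 j (Set.mem_univ j)⟩
    by_contra hlev
    obtain ⟨j, -, hj⟩ := H.dom K x hx i (not_le.1 hlev)
    exact absurd (hi.2 j (Set.mem_univ j)) (not_le.2 hj)
  · intro hi
    refine ⟨Set.mem_univ _, fun j _ => ?_⟩
    by_cases hj : lev j ≤ K
    · exact hi.2 j hj
    · obtain ⟨k, hk, hlt⟩ := H.dom K x hx j (not_le.1 hj)
      exact hlt.le.trans (hi.2 k hk)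

lemma IsLeveled.exists_lt (H : IsLeveled q b lev R C) {r : ℝ} (hr : 0 < r) :
    ∃ K, R K < r := (H.tendsto.eventually_lt_const hr).exists

lemma IsLeveled.eventually_lt (H : IsLeveled q b lev R C) {x : E3} (hx : x ≠ 0) :
    ∀ᶠ K in atTop, R K < ‖x‖ := H.tendsto.eventually_lt_const (norm_pos_iff.2 hx)

lemma IsLeveled.ne_zero (H : IsLeveled q b lev R C) {x : E3} {i : ι}
    (hi : IsActive q b Set.univ x i) : x ≠ 0 := by
  rintro rfl
  obtain ⟨j, hj⟩ := H.zero i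
  exact absurd (hi.2 j (Set.mem_univ j)) (not_le.2 hj)

lemma IsLeveled.nonneg (H : IsLeveled q b lev R C) : 0 ≤ C := by
  obtain ⟨i, -⟩ := H.nonempty 0
  exact (norm_nonneg _).trans (H.bound i)

lemma IsLeveled.isGeneric_univ (H : IsLeveled q b lev R C) : IsGeneric q b Set.univ := by
  intro i j k hki hkj hij
  have : ∀ᵐ x ∂hyperplaneMeasure (q i - q j) (b i - b j), ∀ K : ℕ,
      ¬ (IsActive q b {i | lev i ≤ K} x i ∧ IsActive q b {i | lev i ≤ K} x j ∧
        IsActive q b {i | lev i ≤ K} x k) :=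
    ae_all_iff.2 fun K => H.generic K i j k hki hkj hij
  filter_upwards [this] with x hx hact
  obtain ⟨K, hK⟩ := H.exists_lt (norm_pos_iff.2 (H.ne_zero hact.1))
  simp only [H.isActive_iff hK] at hact
  exact hx K hact

lemma IsLeveled.exists_isActive (H : IsLeveled q b lev R C) {x : E3} (hx : x ≠ 0) :
    ∃ i, IsActive q b Set.univ x i := by
  obtain ⟨K, hK⟩ := H.exists_lt (norm_pos_iff.2 hx)
  simp only [H.isActive_iff hK]
  have := _root_.exists_isActive (q := q) (b := b) (J := (H.finite K).toFinset)
    (by simpa using H.nonempty K) x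
  simpa using this

variable [Countable ι]

lemma IsLeveled.integral_level (H : IsLeveled q b lev R C) (K : ℕ)
    {ψ : E3 → ℝ} (hψ : ContDiff ℝ 1 ψ) (hc : HasCompactSupport ψ) (v w : E3) :
    ∫ z, ψ z.1 * (inner ℝ z.2 v * inner ℝ z.2 w / ‖z.2‖ ^ 2)
      ∂(facetMeasure q b {i | lev i ≤ K}) =
      - ∫ x, inner ℝ (activeSlope q b {i | lev i ≤ K} x) v * fderiv ℝ ψ x w := by
  have := integral_facetMeasure_finset (q := q) (b := b) (J := (H.finite K).toFinset)
    (by simpa using H.nonempty K) H.inj (by simpa using H.generic K) hψ hc v w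
  simpa using this

/-- The form `n ⊗ n / ‖n‖²` has trace 1; this recovers the scalar weight from the entries of the
Hessian. -/
lemma sum_inner_sq_div (n : E3) (hn : n ≠ 0) :
    ∑ a : Fin 3, inner ℝ n (EuclideanSpace.single a (1 : ℝ)) *
      inner ℝ n (EuclideanSpace.single a (1 : ℝ)) / ‖n‖ ^ 2 = 1 := by
  rw [← Finset.sum_div, div_eq_one_iff_eq (by simpa using hn), EuclideanSpace.norm_sq_eq]
  refine Finset.sum_congr rfl fun a _ => ?_
  simp [EuclideanSpace.inner_single_right, sq]

lemma fderiv_comp_inv_smul (ψ : E3 → ℝ) (r : ℝ) (x w : E3) :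
    fderiv ℝ (fun y => ψ (r⁻¹ • y)) x w = r⁻¹ * fderiv ℝ ψ (r⁻¹ • x) w := by
  rw [fderiv_comp_smul]; simp

lemma hasCompactSupport_comp_inv_smul {ψ : E3 → ℝ} (hc : HasCompactSupport ψ) {r : ℝ}
    (hr : 0 < r) : HasCompactSupport fun y => ψ (r⁻¹ • y) :=
  hc.comp_homeomorph (Homeomorph.smulOfNeZero r⁻¹ (inv_ne_zero hr.ne'))

lemma contDiff_comp_inv_smul {ψ : E3 → ℝ} (hψ : ContDiff ℝ 1 ψ) (r : ℝ) :
    ContDiff ℝ 1 fun y => ψ (r⁻¹ • y) := hψ.comp (contDiff_const_smul _)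

lemma integral_fderiv_scaled (g : E3 → ℝ) (ψ : E3 → ℝ) {r : ℝ} (hr : 0 < r) (w : E3) :
    ∫ x, g x * fderiv ℝ (fun y => ψ (r⁻¹ • y)) x w =
      r ^ 2 * ∫ x, g (r • x) * fderiv ℝ ψ x w := by
  have h := Measure.integral_comp_inv_smul (volume : Measure E3)
    (fun y => g (r • y) * (r⁻¹ * fderiv ℝ ψ y w)) r
  simp only [smul_smul, mul_inv_cancel₀ hr.ne', one_smul] at h
  simp only [fderiv_comp_inv_smul]
  rw [h, finrank_euclideanSpace_fin, abs_of_pos (by positivity), smul_eq_mul]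
  rw [← integral_const_mul, ← integral_const_mul]
  congr 1; ext x; field_simp

/-- The weight is the trace of the Hessian. Tested against a bump of scale `r` it becomes an
integral of the slopes, bounded by `C`, against the gradient of the bump, whose integral is of order
`r²`. Nothing depends on the level. -/
lemma IsLeveled.exists_mass_bound_level (H : IsLeveled q b lev R C) :
    ∃ M : ℝ, 0 ≤ M ∧ ∀ K : ℕ, ∀ r : ℝ, 0 < r →
      facetMeasure q b {i | lev i ≤ K} (Metric.closedBall 0 r ×ˢ Set.univ) ≤
        ENNReal.ofReal (M * r ^ 2) := by
  let φ : ContDiffBump (0 : E3) := ⟨1, 2, one_pos, one_lt_two⟩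
  have hφ : ContDiff ℝ 1 φ := φ.contDiff
  have hcφ : HasCompactSupport φ := φ.hasCompactSupport
  have hint : Integrable fun x => ‖fderiv ℝ φ x‖ :=
    ((hφ.continuous_fderiv (by simp)).norm).integrable_of_hasCompactSupport (hcφ.fderiv ℝ).norm
  refine ⟨3 * (C * ∫ x, ‖fderiv ℝ φ x‖), by
    have := H.nonneg
    have : 0 ≤ ∫ x, ‖fderiv ℝ φ x‖ := integral_nonneg fun _ => norm_nonneg _
    positivity, fun K r hr => ?_⟩
  set ψ : E3 → ℝ := fun y => φ (r⁻¹ • y) with hψdef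
  have hψ : ContDiff ℝ 1 ψ := contDiff_comp_inv_smul hφ r
  have hcψ : HasCompactSupport ψ := hasCompactSupport_comp_inv_smul hcφ hr
  set W := facetMeasure q b {i | lev i ≤ K} with hW
  have hWfin : W = facetMeasure q b ((H.finite K).toFinset : Set ι) := by simp [hW]
  have hI : ∀ g : E3 → ℝ, Integrable (fun z : E3 × E3 => ψ z.1 * g z.2) W := by
    intro g
    rw [hWfin, facetMeasure_finset]
    exact integrable_finsetSum_measure.2 fun p _ =>
      integrable_facet_term _ p hψ.continuous hcψ g
  have h1 : ∫ z, ψ z.1 ∂W ≤ 3 * (C * ∫ x, ‖fderiv ℝ φ x‖) * r ^ 2 := by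
    have h2 : ∫ z, ψ z.1 ∂W = ∑ a : Fin 3, ∫ z, ψ z.1 *
        (inner ℝ z.2 (EuclideanSpace.single a (1 : ℝ)) *
          inner ℝ z.2 (EuclideanSpace.single a (1 : ℝ)) / ‖z.2‖ ^ 2) ∂W := by
      rw [← integral_finsetSum _ fun a _ => hI fun n =>
        inner ℝ n (EuclideanSpace.single a (1 : ℝ)) *
          inner ℝ n (EuclideanSpace.single a (1 : ℝ)) / ‖n‖ ^ 2]
      refine integral_congr_ae ?_
      filter_upwards [ae_facetMeasure_ne_zero (q := q) (b := b) {i | lev i ≤ K}] with z hz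
      rw [← Finset.mul_sum, sum_inner_sq_div _ hz, mul_one]
    have h3 : ∀ a : Fin 3, ∫ z, ψ z.1 *
        (inner ℝ z.2 (EuclideanSpace.single a (1 : ℝ)) *
          inner ℝ z.2 (EuclideanSpace.single a (1 : ℝ)) / ‖z.2‖ ^ 2) ∂W ≤
          (C * ∫ x, ‖fderiv ℝ φ x‖) * r ^ 2 := by
      intro a
      rw [H.integral_level K hψ hcψ, integral_fderiv_scaled (fun x =>
        inner ℝ (activeSlope q b {i | lev i ≤ K} x) (EuclideanSpace.single a (1 : ℝ))) φ hr,
        ← mul_neg, mul_comm]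
      refine mul_le_mul_of_nonneg_right ?_ (by positivity)
      refine (neg_le_abs _).trans ?_
      rw [← integral_const_mul, ← Real.norm_eq_abs]
      refine norm_integral_le_of_norm_le (hint.const_mul C) (Eventually.of_forall fun x => ?_)
      rw [norm_mul]
      have h4 : ‖(inner ℝ (activeSlope q b {i | lev i ≤ K} (r • x))
          (EuclideanSpace.single a (1 : ℝ)) : ℝ)‖ ≤ C := by
        refine (norm_inner_le_norm _ _).trans ?_
        simpa using norm_activeSlope_le H.nonneg H.bound _
      have h5 : ‖fderiv ℝ φ x (EuclideanSpace.single a (1 : ℝ))‖ ≤ ‖fderiv ℝ φ x‖ := by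
        simpa using (fderiv ℝ φ x).le_opNorm (EuclideanSpace.single a (1 : ℝ))
      exact mul_le_mul h4 h5 (norm_nonneg _) H.nonneg
    rw [h2]
    refine (Finset.sum_le_sum fun a _ => h3 a).trans ?_
    simp; linarith
  calc W (Metric.closedBall 0 r ×ˢ Set.univ)
      = ∫⁻ z, (Metric.closedBall (0 : E3) r ×ˢ (Set.univ : Set E3)).indicator 1 z ∂W := by
        rw [lintegral_indicator_one (Metric.isClosed_closedBall.measurableSet.prod
          MeasurableSet.univ)]
    _ ≤ ∫⁻ z, ENNReal.ofReal (ψ z.1) ∂W := by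
        refine lintegral_mono fun z => ?_
        refine Set.indicator_le (s := Metric.closedBall (0 : E3) r ×ˢ (Set.univ : Set E3))
          (f := 1) (g := fun z => ENNReal.ofReal (ψ z.1)) (fun z hz => ?_) z
        have hz1 : ψ z.1 = 1 := by
          refine φ.one_of_mem_closedBall ?_
          have := hz.1
          rw [mem_closedBall_zero_iff] at this ⊢
          rw [norm_smul, norm_inv, Real.norm_of_nonneg hr.le, inv_mul_le_iff₀ hr]
          simpa [φ] using this
        simp [hz1]
    _ = ENNReal.ofReal (∫ z, ψ z.1 ∂W) := by
        rw [ofReal_integral_eq_lintegral_ofReal]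
        · simpa using hI fun _ => 1
        · exact Eventually.of_forall fun z => φ.nonneg
    _ ≤ _ := ENNReal.ofReal_le_ofReal h1

lemma IsLeveled.restrict_eq (H : IsLeveled q b lev R C) (K : ℕ) :
    (facetMeasure q b Set.univ).restrict ({x | R K < ‖x‖} ×ˢ Set.univ) =
      (facetMeasure q b {i | lev i ≤ K}).restrict ({x | R K < ‖x‖} ×ˢ Set.univ) :=
  restrict_facetMeasure_congr (isOpen_lt continuous_const continuous_norm).measurableSet
    fun _ hx i => H.isActive_iff hx i

/-- No index is active at the origin, so almost all of the ball is exhausted by the regions `R K <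
‖x‖`, where the full measure agrees with a finite level. -/
lemma IsLeveled.mass_bound (H : IsLeveled q b lev R C) {M : ℝ}
    (hM : ∀ K : ℕ, ∀ r : ℝ, 0 < r →
      facetMeasure q b {i | lev i ≤ K} (Metric.closedBall 0 r ×ˢ Set.univ) ≤
        ENNReal.ofReal (M * r ^ 2)) {r : ℝ} (hr : 0 < r) :
    facetMeasure q b Set.univ (Metric.closedBall 0 r ×ˢ Set.univ) ≤ ENNReal.ofReal (M * r ^ 2) := by
  set W := facetMeasure q b Set.univ
  have hO : ∀ K, MeasurableSet ({x : E3 | R K < ‖x‖} ×ˢ (Set.univ : Set E3)) := fun K =>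
    (isOpen_lt continuous_const continuous_norm).measurableSet.prod MeasurableSet.univ
  have h0 : W (Metric.closedBall 0 r ×ˢ Set.univ) ≤
      W (⋃ K, (Metric.closedBall 0 r ×ˢ Set.univ) ∩ ({x : E3 | R K < ‖x‖} ×ˢ Set.univ)) := by
    refine measure_mono_ae ?_
    have hne : ∀ᵐ z ∂W, z.1 ≠ 0 :=
      ae_facetMeasure fun i j _ => Eventually.of_forall fun x hi _ => H.ne_zero hi
    filter_upwards [hne] with z hz hzB
    obtain ⟨K, hK⟩ := H.exists_lt (norm_pos_iff.2 hz)
    exact Set.mem_iUnion.2 ⟨K, hzB, hK, Set.mem_univ _⟩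
  refine h0.trans ?_
  rw [Monotone.measure_iUnion]
  · refine iSup_le fun K => ?_
    rw [← Measure.restrict_apply' (hO K), H.restrict_eq K]
    exact (Measure.restrict_apply_le _ _).trans (hM K r hr)
  · intro K L hKL
    exact Set.inter_subset_inter_right _
      (Set.prod_mono (fun x hx => (H.anti hKL).trans_lt hx) subset_rfl)

end Leveled

/-! ### The Hessian of the infinite maximum, its blow-up and the density -/

section Blowup

variable {ι : Type*} [Countable ι] {q : ι → E3} {b : ι → ℝ} {lev : ι → ℕ} {R : ℕ → ℝ} {C : ℝ}

/-- The product of a ball in the first factor and the whole space in the second one. -/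
def cyl (r : ℝ) : Set (E3 × E3) := Metric.closedBall 0 r ×ˢ Set.univ

lemma measurableSet_cyl (r : ℝ) : MeasurableSet (cyl r) :=
  Metric.isClosed_closedBall.measurableSet.prod MeasurableSet.univ

lemma mem_cyl {r : ℝ} {z : E3 × E3} : z ∈ cyl r ↔ ‖z.1‖ ≤ r := by simp [cyl]

lemma integrable_of_bounded {W : Measure (E3 × E3)} {F : E3 × E3 → ℝ} {r : ℝ}
    (hfin : W (cyl r) < ⊤) (hF : AEStronglyMeasurable F W) {B : ℝ} (hB : ∀ z, ‖F z‖ ≤ B)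
    (hr : ∀ z, F z ≠ 0 → ‖z.1‖ ≤ r) : Integrable F W := by
  have h : IntegrableOn F (cyl r) W := Measure.integrableOn_of_bounded hfin.ne hF
    (Eventually.of_forall hB)
  rw [← integrable_indicator_iff (measurableSet_cyl r)] at h
  refine h.congr (Eventually.of_forall fun z => ?_)
  by_cases hz : z ∈ cyl r
  · simp [hz]
  · rw [Set.indicator_of_notMem hz]
    by_contra hne
    exact hz (mem_cyl.2 (hr z (Ne.symm hne)))

lemma norm_normal_form_le (n v w : E3) :
    ‖(inner ℝ n v * inner ℝ n w / ‖n‖ ^ 2 : ℝ)‖ ≤ ‖v‖ * ‖w‖ := by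
  rcases eq_or_ne n 0 with rfl | hn
  · simp; positivity
  · have hn0 : 0 < ‖n‖ := norm_pos_iff.2 hn
    rw [norm_div, norm_mul, norm_pow, norm_norm, div_le_iff₀ (by positivity)]
    calc ‖(inner ℝ n v : ℝ)‖ * ‖(inner ℝ n w : ℝ)‖ ≤ (‖n‖ * ‖v‖) * (‖n‖ * ‖w‖) :=
          mul_le_mul (norm_inner_le_norm _ _) (norm_inner_le_norm _ _) (norm_nonneg _)
            (by positivity)
      _ = _ := by ring

lemma measurable_normal_form (v w : E3) :
    Measurable fun n : E3 => (inner ℝ n v * inner ℝ n w / ‖n‖ ^ 2 : ℝ) := by fun_prop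

lemma exists_support_bound {ψ : E3 → ℝ} (hc : HasCompactSupport ψ) :
    ∃ r, 0 < r ∧ ∀ x, ψ x ≠ 0 → ‖x‖ ≤ r := by
  obtain ⟨r, hr⟩ := hc.isCompact.isBounded.subset_closedBall (0 : E3)
  refine ⟨max r 1, by positivity, fun x hx => ?_⟩
  have := hr (subset_tsupport _ hx)
  rw [mem_closedBall_zero_iff] at this
  exact this.trans (le_max_left _ _)

lemma integrable_test {W : Measure (E3 × E3)} (hfin : ∀ r, 0 < r → W (cyl r) < ⊤)
    {ψ : E3 → ℝ} (hψ : Continuous ψ) (hc : HasCompactSupport ψ) {g : E3 → ℝ} (hg : Measurable g)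
    {B : ℝ} (hB : ∀ n, ‖g n‖ ≤ B) : Integrable (fun z : E3 × E3 => ψ z.1 * g z.2) W := by
  obtain ⟨M, hM⟩ := hψ.bounded_above_of_compact_support hc
  obtain ⟨r, hr, hs⟩ := exists_support_bound hc
  refine integrable_of_bounded (hfin r hr) (B := M * B) ?_ (fun z => ?_)
    fun z hz => hs _ (left_ne_zero_of_mul hz)
  · exact ((hψ.measurable.comp measurable_fst).mul
      (hg.comp measurable_snd)).aestronglyMeasurable
  · rw [norm_mul]
    exact mul_le_mul (hM _) (hB _) (norm_nonneg _) ((norm_nonneg _).trans (hM z.1))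

lemma IsLeveled.tendsto_activeSlope (H : IsLeveled q b lev R C) {x : E3} (hx : x ≠ 0) :
    ∀ᶠ K in atTop, activeSlope q b {i | lev i ≤ K} x = activeSlope q b Set.univ x := by
  filter_upwards [H.eventually_lt hx] with K hK
  have : IsActive q b {i | lev i ≤ K} x = IsActive q b Set.univ x :=
    funext fun i => propext (H.isActive_iff hK i).symm
  have aux : ∀ P P' : ι → Prop, P = P' → ∀ [Decidable (∃ i, P i)] [Decidable (∃ i, P' i)],
      (if h : ∃ i, P i then q h.choose else 0) = if h : ∃ i, P' i then q h.choose else 0 := by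
    rintro P _ rfl _ _
    congr
  classical exact aux _ _ this

lemma IsLeveled.aestronglyMeasurable_level (H : IsLeveled q b lev R C) (K : ℕ) (v : E3) :
    AEStronglyMeasurable (fun x => inner ℝ (activeSlope q b {i | lev i ≤ K} x) v) := by
  have := aestronglyMeasurable_inner_activeSlope (q := q) (b := b) H.inj
    (J := (H.finite K).toFinset) (by simpa using H.nonempty K) v
  simpa using this

lemma ae_ne_zero : ∀ᵐ x : E3, x ≠ 0 := by
  rw [ae_iff]
  simp

lemma IsLeveled.aestronglyMeasurable_univ (H : IsLeveled q b lev R C) (v : E3) :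
    AEStronglyMeasurable (fun x => inner ℝ (activeSlope q b Set.univ x) v) := by
  refine aestronglyMeasurable_of_tendsto_ae (atTop : Filter ℕ)
    (fun K => H.aestronglyMeasurable_level K v) ?_
  filter_upwards [ae_ne_zero] with x hx
  exact tendsto_const_nhds.congr' (by
    filter_upwards [H.tendsto_activeSlope hx] with K hK; rw [hK])

lemma IsLeveled.exists_mass_bound (H : IsLeveled q b lev R C) :
    ∃ M : ℝ, 0 ≤ M ∧ (∀ K : ℕ, ∀ r : ℝ, 0 < r →
      facetMeasure q b {i | lev i ≤ K} (cyl r) ≤ ENNReal.ofReal (M * r ^ 2)) ∧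
      ∀ r : ℝ, 0 < r → facetMeasure q b Set.univ (cyl r) ≤ ENNReal.ofReal (M * r ^ 2) := by
  obtain ⟨M, hM0, hM⟩ := H.exists_mass_bound_level
  exact ⟨M, hM0, hM, fun r hr => H.mass_bound hM hr⟩

lemma IsLeveled.cyl_lt_top (H : IsLeveled q b lev R C) (r : ℝ) (hr : 0 < r) :
    facetMeasure q b Set.univ (cyl r) < ⊤ := by
  obtain ⟨M, -, -, h⟩ := H.exists_mass_bound
  exact (h r hr).trans_lt ENNReal.ofReal_lt_top

/-- The two measures agree outside the ball of radius `R K`, and inside it each has mass at most `M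
* R K ^ 2`, which tends to 0. -/
lemma IsLeveled.tendsto_integral_level (H : IsLeveled q b lev R C) {F : E3 × E3 → ℝ} {B : ℝ}
    (hFB : ∀ z, ‖F z‖ ≤ B) (hIu : Integrable F (facetMeasure q b Set.univ))
    (hIl : ∀ K, Integrable F (facetMeasure q b {i | lev i ≤ K})) :
    Tendsto (fun K : ℕ => ∫ z, F z ∂(facetMeasure q b {i | lev i ≤ K})) atTop
      (𝓝 (∫ z, F z ∂(facetMeasure q b Set.univ))) := by
  obtain ⟨M, hM0, hMl, hMu⟩ := H.exists_mass_bound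
  rw [tendsto_iff_norm_sub_tendsto_zero]
  have hlim : Tendsto (fun K => 2 * (B * (M * R K ^ 2))) atTop (𝓝 0) := by
    have := (((H.tendsto.pow 2).const_mul M).const_mul B).const_mul 2
    simpa using this
  refine squeeze_zero (fun K => norm_nonneg _) (fun K => ?_) hlim
  set O : Set (E3 × E3) := {x : E3 | R K < ‖x‖} ×ˢ (Set.univ : Set E3) with hO
  have hOm : MeasurableSet O :=
    (isOpen_lt continuous_const continuous_norm).measurableSet.prod MeasurableSet.univ
  have hOc : Oᶜ = cyl (R K) := by
    ext z; simp [hO, mem_cyl]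
  have hrest : ∀ W' : Measure (E3 × E3), W' (cyl (R K)) ≤ ENNReal.ofReal (M * R K ^ 2) →
      ‖∫ z in Oᶜ, F z ∂W'‖ ≤ B * (M * R K ^ 2) := by
    intro W' hW'
    rw [hOc]
    have hfin : W' (cyl (R K)) < ⊤ := hW'.trans_lt ENNReal.ofReal_lt_top
    refine (norm_setIntegral_le_of_norm_le_const hfin fun z _ => hFB z).trans ?_
    refine mul_le_mul_of_nonneg_left ?_ ((norm_nonneg _).trans (hFB 0))
    exact ENNReal.toReal_le_of_le_ofReal (by positivity) hW'
  have h1 := hrest _ (hMl K _ (H.pos K))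
  have h2 := hrest _ (hMu _ (H.pos K))
  have h3 := H.restrict_eq K
  rw [← integral_add_compl hOm (hIl K), ← integral_add_compl hOm hIu, hO, h3, ← hO,
    add_sub_add_left_eq_sub]
  exact (norm_sub_le _ _).trans (by linarith)

lemma IsLeveled.tendsto_integral_activeSlope (H : IsLeveled q b lev R C)
    {φ : E3 → ℝ} (hφ : Continuous φ) (hc : HasCompactSupport φ) (v : E3) :
    Tendsto (fun K : ℕ => ∫ x, inner ℝ (activeSlope q b {i | lev i ≤ K} x) v * φ x) atTop
      (𝓝 (∫ x, inner ℝ (activeSlope q b Set.univ x) v * φ x)) := by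
  refine tendsto_integral_of_dominated_convergence
    (fun x => (C * ‖v‖) * ‖φ x‖) (fun K => ?_) ?_ (fun K => ?_) ?_
  · exact (H.aestronglyMeasurable_level K v).mul hφ.aestronglyMeasurable
  · exact (hφ.norm.integrable_of_hasCompactSupport hc.norm).const_mul _
  · refine Eventually.of_forall fun x => ?_
    rw [norm_mul]
    refine mul_le_mul_of_nonneg_right ((norm_inner_le_norm _ _).trans ?_) (norm_nonneg _)
    exact mul_le_mul_of_nonneg_right (norm_activeSlope_le H.nonneg H.bound x) (norm_nonneg _)
  · filter_upwards [ae_ne_zero] with x hx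
    exact tendsto_const_nhds.congr' (by
      filter_upwards [H.tendsto_activeSlope hx] with K hK; rw [hK])

/-- The Hessian of the maximum of a leveled family of affine functions. -/
theorem IsLeveled.integral_facetMeasure (H : IsLeveled q b lev R C)
    {ψ : E3 → ℝ} (hψ : ContDiff ℝ 1 ψ) (hc : HasCompactSupport ψ) (v w : E3) :
    ∫ z, ψ z.1 * (inner ℝ z.2 v * inner ℝ z.2 w / ‖z.2‖ ^ 2) ∂(facetMeasure q b Set.univ) =
      - ∫ x, inner ℝ (activeSlope q b Set.univ x) v * fderiv ℝ ψ x w := by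
  obtain ⟨M, hM0, hMl, -⟩ := H.exists_mass_bound
  obtain ⟨B, hB⟩ := hψ.continuous.bounded_above_of_compact_support hc
  have hR := (H.tendsto_integral_activeSlope
    ((hψ.continuous_fderiv (by simp)).clm_apply continuous_const)
    (hc.fderiv_apply ℝ w) v).neg
  set F : E3 × E3 → ℝ := fun z => ψ z.1 * (inner ℝ z.2 v * inner ℝ z.2 w / ‖z.2‖ ^ 2) with hF
  have hFB : ∀ z, ‖F z‖ ≤ B * (‖v‖ * ‖w‖) := fun z => by
    rw [hF, norm_mul]
    exact mul_le_mul (hB _) (norm_normal_form_le _ _ _) (norm_nonneg _)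
      ((norm_nonneg _).trans (hB z.1))
  have hI : ∀ W : Measure (E3 × E3), (∀ r, 0 < r → W (cyl r) < ⊤) → Integrable F W :=
    fun W hW => integrable_test hW hψ.continuous hc (measurable_normal_form v w)
      fun n => norm_normal_form_le n v w
  have hL := H.tendsto_integral_level hFB (hI _ H.cyl_lt_top)
    fun K => hI _ fun r hr => (hMl K r hr).trans_lt ENNReal.ofReal_lt_top
  have heq := fun K => H.integral_level K hψ hc v w
  simp only [hF, heq] at hL
  exact tendsto_nhds_unique hL hR

/-- Blow-up at the origin, when the active slopes converge along almost every ray to `G`. -/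
theorem IsLeveled.tendsto_blowup (H : IsLeveled q b lev R C) {G : E3 → E3}
    (hG : ∀ᵐ x : E3, Tendsto (fun r : ℝ => activeSlope q b Set.univ (r • x)) (𝓝[>] 0) (𝓝 (G x)))
    {ψ : E3 → ℝ} (hψ : ContDiff ℝ 1 ψ) (hc : HasCompactSupport ψ) (v w : E3) :
    Tendsto (fun r : ℝ => (r ^ 2)⁻¹ * ∫ z, ψ (r⁻¹ • z.1) *
        (inner ℝ z.2 v * inner ℝ z.2 w / ‖z.2‖ ^ 2) ∂(facetMeasure q b Set.univ)) (𝓝[>] 0)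
      (𝓝 (- ∫ x, inner ℝ (G x) v * fderiv ℝ ψ x w)) := by
  have hcψ' : Continuous fun x => fderiv ℝ ψ x w :=
    (hψ.continuous_fderiv (by simp)).clm_apply continuous_const
  have hcs' : HasCompactSupport fun x => fderiv ℝ ψ x w := hc.fderiv_apply ℝ w
  have hlim : Tendsto (fun r : ℝ => - ∫ x, inner ℝ (activeSlope q b Set.univ (r • x)) v *
      fderiv ℝ ψ x w) (𝓝[>] 0) (𝓝 (- ∫ x, inner ℝ (G x) v * fderiv ℝ ψ x w)) := by
    refine Tendsto.neg ?_
    refine tendsto_integral_filter_of_dominated_convergence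
      (fun x => (C * ‖v‖) * ‖fderiv ℝ ψ x w‖) ?_ ?_ ?_ ?_
    · filter_upwards [self_mem_nhdsWithin] with r hr
      refine AEStronglyMeasurable.mul ?_ hcψ'.aestronglyMeasurable
      have hqmp : Measure.QuasiMeasurePreserving (fun x : E3 => r • x) volume volume := by
        refine ⟨by fun_prop, ?_⟩
        rw [Measure.map_addHaar_smul _ (ne_of_gt hr)]
        exact Measure.smul_absolutelyContinuous
      exact (H.aestronglyMeasurable_univ v).comp_quasiMeasurePreserving hqmp
    · refine Eventually.of_forall fun r => Eventually.of_forall fun x => ?_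
      rw [norm_mul]
      refine mul_le_mul_of_nonneg_right ((norm_inner_le_norm _ _).trans ?_) (norm_nonneg _)
      exact mul_le_mul_of_nonneg_right (norm_activeSlope_le H.nonneg H.bound _) (norm_nonneg _)
    · exact (hcψ'.norm.integrable_of_hasCompactSupport hcs'.norm).const_mul _
    · filter_upwards [hG] with x hx
      exact (hx.inner tendsto_const_nhds).mul_const _
  refine hlim.congr' ?_
  filter_upwards [self_mem_nhdsWithin] with r hr
  have hr : 0 < r := hr
  rw [H.integral_facetMeasure (contDiff_comp_inv_smul hψ r) (hasCompactSupport_comp_inv_smul hc hr),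
    integral_fderiv_scaled (fun x => inner ℝ (activeSlope q b Set.univ x) v) ψ hr]
  field_simp

lemma IsLeveled.integrable_scaled (H : IsLeveled q b lev R C) {ψ : E3 → ℝ} (hψ : Continuous ψ)
    (hc : HasCompactSupport ψ) {r : ℝ} (hr : 0 < r) {g : E3 → ℝ} (hg : Measurable g) {B : ℝ}
    (hB : ∀ n, ‖g n‖ ≤ B) :
    Integrable (fun z : E3 × E3 => ψ (r⁻¹ • z.1) * g z.2) (facetMeasure q b Set.univ) :=
  integrable_test H.cyl_lt_top (ψ := fun x => ψ (r⁻¹ • x)) (by fun_prop)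
    (hasCompactSupport_comp_inv_smul hc hr) hg hB

theorem IsLeveled.exists_tendsto_weight (H : IsLeveled q b lev R C) {G : E3 → E3}
    (hG : ∀ᵐ x : E3, Tendsto (fun r : ℝ => activeSlope q b Set.univ (r • x)) (𝓝[>] 0) (𝓝 (G x)))
    {ψ : E3 → ℝ} (hψ : ContDiff ℝ 1 ψ) (hc : HasCompactSupport ψ) :
    ∃ L : ℝ, Tendsto (fun r : ℝ => (r ^ 2)⁻¹ * ∫ z, ψ (r⁻¹ • z.1) ∂(facetMeasure q b Set.univ))
      (𝓝[>] 0) (𝓝 L) := by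
  refine ⟨_, (tendsto_finsetSum Finset.univ fun a _ => H.tendsto_blowup hG hψ hc
    (EuclideanSpace.single a (1 : ℝ)) (EuclideanSpace.single a (1 : ℝ))).congr' ?_⟩
  filter_upwards [self_mem_nhdsWithin] with r hr
  have hr : 0 < r := hr
  rw [← Finset.mul_sum, ← integral_finsetSum _ fun a _ =>
    H.integrable_scaled hψ.continuous hc hr (measurable_normal_form _ _)
      fun n => norm_normal_form_le n _ _]
  congr 1
  refine integral_congr_ae ?_
  filter_upwards [ae_facetMeasure_ne_zero (q := q) (b := b) Set.univ] with z hz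
  rw [← Finset.mul_sum, sum_inner_sq_div _ hz, mul_one]

/-- The density of the facet measure at the origin exists. -/
theorem IsLeveled.exists_density (H : IsLeveled q b lev R C) {G : E3 → E3}
    (hG : ∀ᵐ x : E3, Tendsto (fun r : ℝ => activeSlope q b Set.univ (r • x)) (𝓝[>] 0) (𝓝 (G x))) :
    ∃ θ : ℝ, Tendsto (fun r : ℝ => (facetMeasure q b Set.univ (cyl r)).toReal / r ^ 2) (𝓝[>] 0)
      (𝓝 θ) := by
  obtain ⟨M, hM0, -, hM⟩ := H.exists_mass_bound
  set W := facetMeasure q b Set.univ with hW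
  set m : ℝ → ℝ := fun r => (W (cyl r)).toReal / r ^ 2 with hm
  have hm0 : ∀ r, 0 ≤ m r := fun r => by positivity
  have hmM : ∀ᶠ r in 𝓝[>] (0 : ℝ), m r ≤ M := by
    filter_upwards [self_mem_nhdsWithin] with r hr
    have hr : 0 < r := hr
    rw [hm, div_le_iff₀ (by positivity)]
    exact ENNReal.toReal_le_of_le_ofReal (by positivity) (hM r hr)
  have hbd : IsBoundedUnder (· ≤ ·) (𝓝[>] 0) m := ⟨M, by simpa using hmM⟩
  have hbd' : IsBoundedUnder (· ≥ ·) (𝓝[>] 0) m :=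
    ⟨0, by simpa using Eventually.of_forall hm0⟩
  -- A bump equal to 1 on the unit ball and supported in radius `1 + δ` has a limit `L`; used at
  -- scales `r` and `r / (1 + δ)` it traps the mass ratio asymptotically between `L / (1 + δ)²` and
  -- `L`.
  have key : ∀ δ : ℝ, 0 < δ → limsup m (𝓝[>] 0) ≤ (1 + δ) ^ 2 * liminf m (𝓝[>] 0) := by
    intro δ hδ
    let φ : ContDiffBump (0 : E3) := ⟨1, 1 + δ, one_pos, by linarith⟩
    obtain ⟨L, hL⟩ := H.exists_tendsto_weight hG (ψ := φ) φ.contDiff φ.hasCompactSupport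
    set l : ℝ → ℝ := fun r => (r ^ 2)⁻¹ * ∫ z, φ (r⁻¹ • z.1) ∂W with hl
    have hint : ∀ r : ℝ, 0 < r → Integrable (fun z : E3 × E3 => φ (r⁻¹ • z.1)) W := by
      intro r hr
      simpa using H.integrable_scaled φ.continuous φ.hasCompactSupport hr
        (measurable_const (a := (1 : ℝ))) (B := 1) (by simp)
    have hcyl : ∀ r : ℝ, 0 < r → ∫ z, (cyl r).indicator (fun _ => (1 : ℝ)) z ∂W =
        (W (cyl r)).toReal := by
      intro r _
      rw [integral_indicator (measurableSet_cyl r)]; simp [Measure.real]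
    have hcylI : ∀ r : ℝ, 0 < r → Integrable ((cyl r).indicator (fun _ => (1 : ℝ))) W := by
      intro r hr
      rw [integrable_indicator_iff (measurableSet_cyl r)]
      exact integrableOn_const (H.cyl_lt_top r hr).ne
    have h1 : ∀ᶠ r in 𝓝[>] (0 : ℝ), m r ≤ l r := by
      filter_upwards [self_mem_nhdsWithin] with r hr
      have hr : 0 < r := hr
      simp only [hm, hl]
      rw [div_eq_inv_mul]
      refine mul_le_mul_of_nonneg_left ?_ (by positivity)
      rw [← hcyl r hr]
      refine integral_mono (hcylI r hr) (hint r hr) fun z => ?_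
      refine Set.indicator_le' (g := fun z : E3 × E3 => φ (r⁻¹ • z.1)) (fun z hz => ?_)
        (fun z _ => φ.nonneg) z
      refine (φ.one_of_mem_closedBall ?_).ge
      rw [mem_closedBall_zero_iff, norm_smul, norm_inv, Real.norm_of_nonneg hr.le,
        inv_mul_le_iff₀ hr]
      simpa [φ] using mem_cyl.1 hz
    have h2 : ∀ᶠ r in 𝓝[>] (0 : ℝ), ((1 + δ) ^ 2)⁻¹ * l ((1 + δ)⁻¹ * r) ≤ m r := by
      filter_upwards [self_mem_nhdsWithin] with r hr
      have hr : 0 < r := hr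
      have hr' : 0 < (1 + δ)⁻¹ * r := by positivity
      have h3 : ∫ z, φ (((1 + δ)⁻¹ * r)⁻¹ • z.1) ∂W ≤ (W (cyl r)).toReal := by
        rw [← hcyl r hr]
        refine integral_mono (hint _ hr') (hcylI r hr) fun z => ?_
        by_cases hz : z ∈ cyl r
        · simp only [Set.indicator_of_mem hz]; exact φ.le_one
        · rw [Set.indicator_of_notMem hz]
          refine (φ.zero_of_le_dist ?_).le
          rw [dist_zero_right, norm_smul, norm_inv, Real.norm_of_nonneg hr'.le,
            le_inv_mul_iff₀ hr']
          rw [mem_cyl, not_le] at hz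
          have : (1 + δ)⁻¹ * r * φ.rOut = r := by
            change (1 + δ)⁻¹ * r * (1 + δ) = r
            field_simp
          rw [this]; exact hz.le
      simp only [hm, hl]
      rw [div_eq_inv_mul, ← mul_assoc]
      have h4 : ((1 + δ) ^ 2)⁻¹ * (((1 + δ)⁻¹ * r) ^ 2)⁻¹ = (r ^ 2)⁻¹ := by
        field_simp
      rw [h4]
      exact mul_le_mul_of_nonneg_left h3 (by positivity)
    have hsc : Tendsto (fun r : ℝ => (1 + δ)⁻¹ * r) (𝓝[>] 0) (𝓝[>] 0) := by
      refine tendsto_nhdsWithin_iff.2 ⟨?_, ?_⟩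
      · have : Tendsto (fun r : ℝ => (1 + δ)⁻¹ * r) (𝓝 0) (𝓝 ((1 + δ)⁻¹ * 0)) :=
          tendsto_id.const_mul _
        rw [mul_zero] at this
        exact this.mono_left nhdsWithin_le_nhds
      · filter_upwards [self_mem_nhdsWithin] with r hr
        have hr : 0 < r := hr
        exact mul_pos (by positivity) hr
    have h5 : limsup m (𝓝[>] 0) ≤ L := by
      rw [← hL.limsup_eq]
      exact limsup_le_limsup h1 hbd'.isCoboundedUnder_le hL.isBoundedUnder_le
    have h6 : ((1 + δ) ^ 2)⁻¹ * L ≤ liminf m (𝓝[>] 0) := by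
      have h7 := (hL.comp hsc).const_mul ((1 + δ) ^ 2)⁻¹
      rw [← h7.liminf_eq]
      exact liminf_le_liminf h2 h7.isBoundedUnder_ge hbd.isCoboundedUnder_ge
    rw [inv_mul_le_iff₀ (by positivity)] at h6
    exact h5.trans h6
  refine ⟨liminf m (𝓝[>] 0), tendsto_of_le_liminf_of_limsup_le le_rfl ?_ hbd hbd'⟩
  have hlim : Tendsto (fun δ : ℝ => (1 + δ) ^ 2 * liminf m (𝓝[>] 0)) (𝓝[>] 0)
      (𝓝 ((1 + 0) ^ 2 * liminf m (𝓝[>] 0))) := by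
    have : Continuous fun δ : ℝ => (1 + δ) ^ 2 * liminf m (𝓝[>] 0) := by fun_prop
    exact (this.tendsto 0).mono_left nhdsWithin_le_nhds
  rw [add_zero, one_pow, one_mul] at hlim
  refine ge_of_tendsto hlim ?_
  filter_upwards [self_mem_nhdsWithin] with δ hδ using key δ hδ

end Blowup

/-! ### The paraboloid and its support function -/

section Paraboloid

/-- The points of a paraboloid of revolution. -/
noncomputable def paraPoint (a c : ℝ) : E3 := !₂[2 * a, 2 * c, 1 / 2 - a ^ 2 - c ^ 2]

lemma inner_paraPoint (a c : ℝ) (x : E3) :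
    inner ℝ (paraPoint a c) x = 2 * a * x 0 + 2 * c * x 1 + (1 / 2 - a ^ 2 - c ^ 2) * x 2 := by
  simp [paraPoint, PiLp.inner_apply, Fin.sum_univ_three]
  ring

lemma norm_sq_E3 (x : E3) : ‖x‖ ^ 2 = x 0 ^ 2 + x 1 ^ 2 + x 2 ^ 2 := by
  simp [EuclideanSpace.norm_sq_eq, Fin.sum_univ_three]

lemma abs_apply_le_norm (x : E3) (i : Fin 3) : |x i| ≤ ‖x‖ := by
  simpa using PiLp.norm_apply_le x i

lemma norm_paraPoint_le {a c : ℝ} (h : a ^ 2 + c ^ 2 ≤ 1) : ‖paraPoint a c‖ ≤ 3 := by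
  refine abs_le_of_sq_le_sq' ?_ (by norm_num) |>.2
  rw [norm_sq_E3]
  simp [paraPoint]
  nlinarith [sq_nonneg a, sq_nonneg c]

/-- The unit disc, as a set of parameters of the paraboloid. -/
def paraDisc : Set (ℝ × ℝ) := {p | p.1 ^ 2 + p.2 ^ 2 ≤ 1}

lemma isCompact_paraDisc : IsCompact paraDisc := by
  refine Metric.isCompact_of_isClosed_isBounded
    (isClosed_le (by fun_prop) continuous_const) ?_
  refine (Metric.isBounded_closedBall (x := (0 : ℝ × ℝ)) (r := 1)).subset fun p hp => ?_
  have hp : p.1 ^ 2 + p.2 ^ 2 ≤ 1 := hp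
  rw [mem_closedBall_zero_iff, Prod.norm_def, max_le_iff, Real.norm_eq_abs, Real.norm_eq_abs]
  exact ⟨abs_le_one_iff_mul_self_le_one.2 (by nlinarith [sq_nonneg p.2]),
    abs_le_one_iff_mul_self_le_one.2 (by nlinarith [sq_nonneg p.1])⟩

/-- The support function of the piece of the paraboloid over the unit disc. -/
noncomputable def paraSupport (x : E3) : ℝ :=
  sSup ((fun p : ℝ × ℝ => inner ℝ (paraPoint p.1 p.2) x) '' paraDisc)

lemma continuous_inner_paraPoint (x : E3) :
    Continuous fun p : ℝ × ℝ => inner ℝ (paraPoint p.1 p.2) x := by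
  simp only [inner_paraPoint]; fun_prop

lemma inner_le_paraSupport {a c : ℝ} (h : a ^ 2 + c ^ 2 ≤ 1) (x : E3) :
    inner ℝ (paraPoint a c) x ≤ paraSupport x :=
  le_csSup (isCompact_paraDisc.image (continuous_inner_paraPoint x)).bddAbove ⟨(a, c), h, rfl⟩

lemma exists_paraSupport_eq (x : E3) :
    ∃ a c : ℝ, a ^ 2 + c ^ 2 ≤ 1 ∧ paraSupport x = inner ℝ (paraPoint a c) x := by
  have hne : paraDisc.Nonempty := ⟨(0, 0), by simp [paraDisc]⟩
  obtain ⟨p, hp, h⟩ := (isCompact_paraDisc.image (continuous_inner_paraPoint x)).sSup_mem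
    (hne.image _)
  exact ⟨p.1, p.2, hp, h.symm⟩

lemma paraSupport_le (x : E3) : paraSupport x ≤ 3 * ‖x‖ := by
  obtain ⟨a, c, h, he⟩ := exists_paraSupport_eq x
  rw [he]
  exact (real_inner_le_norm _ _).trans
    (mul_le_mul_of_nonneg_right (norm_paraPoint_le h) (norm_nonneg _))

/-- Two kinds of points of the paraboloid suffice: the apex, of height `1 / 2`, and the boundary
point in the direction of `(x 0, x 1)`, of height `-1 / 2`. -/
lemma le_paraSupport (x : E3) : ‖x‖ / 4 ≤ paraSupport x := by
  have h0 : x 2 / 2 ≤ paraSupport x := by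
    have := inner_le_paraSupport (a := 0) (c := 0) (by norm_num) x
    rw [inner_paraPoint] at this
    linarith
  set z := Real.sqrt (x 0 ^ 2 + x 1 ^ 2) with hz
  have hz0 : 0 ≤ z := Real.sqrt_nonneg _
  have hz2 : z ^ 2 = x 0 ^ 2 + x 1 ^ 2 := Real.sq_sqrt (by positivity)
  have h1 : 2 * z - x 2 / 2 ≤ paraSupport x := by
    rcases hz0.eq_or_lt with h | h
    · rw [← h] at hz2 ⊢
      have h2 : x 0 = 0 := by nlinarith [sq_nonneg (x 0), sq_nonneg (x 1)]
      have h3 : x 1 = 0 := by nlinarith [sq_nonneg (x 0), sq_nonneg (x 1)]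
      have := inner_le_paraSupport (a := 1) (c := 0) (by norm_num) x
      rw [inner_paraPoint, h2, h3] at this
      linarith
    · have hd : (x 0 / z) ^ 2 + (x 1 / z) ^ 2 = 1 := by
        rw [div_pow, div_pow, ← add_div, ← hz2, div_self (by positivity)]
      have := inner_le_paraSupport hd.le x
      rw [inner_paraPoint] at this
      have h4 : 2 * (x 0 / z) * x 0 + 2 * (x 1 / z) * x 1 = 2 * z := by
        field_simp
        linarith
      nlinarith
  have h5 : ‖x‖ ≤ z + |x 2| := by
    refine abs_le_of_sq_le_sq' ?_ (by positivity) |>.2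
    rw [norm_sq_E3, ← hz2, add_sq, sq_abs]
    nlinarith [mul_nonneg hz0 (abs_nonneg (x 2))]
  rcases le_total 0 (x 2) with h | h
  · rw [abs_of_nonneg h] at h5; linarith
  · rw [abs_of_nonpos h] at h5; linarith

lemma paraSupport_nonneg (x : E3) : 0 ≤ paraSupport x :=
  (by positivity : (0 : ℝ) ≤ ‖x‖ / 4).trans (le_paraSupport x)

lemma paraSupport_smul {r : ℝ} (hr : 0 ≤ r) (x : E3) : paraSupport (r • x) = r * paraSupport x := by
  refine le_antisymm ?_ ?_
  · obtain ⟨a, c, h, he⟩ := exists_paraSupport_eq (r • x)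
    rw [he, inner_smul_right]
    exact mul_le_mul_of_nonneg_left (inner_le_paraSupport h x) hr
  · obtain ⟨a, c, h, he⟩ := exists_paraSupport_eq x
    rw [he, ← inner_smul_right]
    exact inner_le_paraSupport h _

lemma lipschitzWith_paraSupport : LipschitzWith 3 paraSupport := by
  refine LipschitzWith.of_le_add_mul 3 fun x y => ?_
  obtain ⟨a, c, h, he⟩ := exists_paraSupport_eq x
  have h1 : inner ℝ (paraPoint a c) x = inner ℝ (paraPoint a c) y +
      inner ℝ (paraPoint a c) (x - y) := by rw [← inner_add_right]; congr 1; abel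
  rw [he, h1, dist_eq_norm]
  refine add_le_add (inner_le_paraSupport h y) ((real_inner_le_norm _ _).trans ?_)
  exact mul_le_mul_of_nonneg_right (norm_paraPoint_le h) (norm_nonneg _)

/-- Completing the square, the maximising parameter is `(x 0 / x 2, x 1 / x 2)`; the cone condition
says that it lies in the unit disc. -/
lemma paraSupport_eq {x : E3} (h2 : 0 < x 2) (h : x 0 ^ 2 + x 1 ^ 2 ≤ x 2 ^ 2) :
    paraSupport x = (x 0 ^ 2 + x 1 ^ 2) / x 2 + x 2 / 2 := by
  refine le_antisymm ?_ ?_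
  · obtain ⟨a, c, -, he⟩ := exists_paraSupport_eq x
    rw [he, inner_paraPoint, ← sub_nonneg]
    have : (x 0 ^ 2 + x 1 ^ 2) / x 2 + x 2 / 2 - (2 * a * x 0 + 2 * c * x 1 +
        (1 / 2 - a ^ 2 - c ^ 2) * x 2) = ((x 0 - a * x 2) ^ 2 + (x 1 - c * x 2) ^ 2) / x 2 := by
      field_simp; ring
    rw [this]; positivity
  · have hd : (x 0 / x 2) ^ 2 + (x 1 / x 2) ^ 2 ≤ 1 := by
      rw [div_pow, div_pow, ← add_div, div_le_one (by positivity)]; exact h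
    refine le_trans (le_of_eq ?_) (inner_le_paraSupport hd x)
    rw [inner_paraPoint]; field_simp; ring

end Paraboloid

/-! ### The lattice family: domination between levels and genericity -/

section Family

/-- The number of lattice points per unit length at level `k`. -/
def gridSize (k : ℕ) : ℤ := 512 * 2 ^ k

/-- The indices `(k, i, j)`: lattice points of the disc at level `k`; at odd levels only the points
with even coordinate sum. -/
abbrev GridIdx := {t : ℕ × ℤ × ℤ // t.2.1 ^ 2 + t.2.2 ^ 2 ≤ gridSize t.1 ^ 2 ∧
  (Odd t.1 → Even (t.2.1 + t.2.2))}

/-- The level of an index. -/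
def gridLevel (t : GridIdx) : ℕ := t.1.1

/-- The first parameter of the lattice point. -/
noncomputable def gridX (t : GridIdx) : ℝ := t.1.2.1 / gridSize t.1.1

/-- The second parameter of the lattice point. -/
noncomputable def gridY (t : GridIdx) : ℝ := t.1.2.2 / gridSize t.1.1

/-- The slopes of the family. -/
noncomputable def gridSlope (t : GridIdx) : E3 :=
  (1 + (1 / 2 : ℝ) ^ gridLevel t) • paraPoint (gridX t) (gridY t)

/-- The constants of the family. -/
noncomputable def gridConst (t : GridIdx) : ℝ := (1 / 128 : ℝ) ^ gridLevel t

lemma gridSize_pos (k : ℕ) : (0 : ℝ) < gridSize k := by simp [gridSize]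

lemma grid_disc (t : GridIdx) : gridX t ^ 2 + gridY t ^ 2 ≤ 1 := by
  have h := t.2.1
  have hn := gridSize_pos t.1.1
  rw [gridX, gridY, div_pow, div_pow, ← add_div, div_le_one (by positivity)]
  exact_mod_cast h

lemma affineFun_grid (t : GridIdx) (x : E3) : affineFun gridSlope gridConst t x =
    (1 + (1 / 2 : ℝ) ^ gridLevel t) * inner ℝ (paraPoint (gridX t) (gridY t)) x -
      (1 / 128 : ℝ) ^ gridLevel t := by
  simp [affineFun, gridSlope, gridConst, inner_smul_left]

lemma affineFun_grid_le (t : GridIdx) (x : E3) : affineFun gridSlope gridConst t x ≤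
    (1 + (1 / 2 : ℝ) ^ gridLevel t) * paraSupport x - (1 / 128 : ℝ) ^ gridLevel t := by
  rw [affineFun_grid]
  have := inner_le_paraSupport (grid_disc t) x
  gcongr

/-- Rounding towards zero keeps lattice points in the disc, and even coordinates meet the parity
rule of the odd levels, so one approximation serves all levels. -/
lemma exists_even_near (s : ℝ) : ∃ m : ℤ, |(2 * m : ℝ)| ≤ |s| ∧ |s - 2 * m| ≤ 2 := by
  have key : ∀ s : ℝ, 0 ≤ s → ∃ m : ℤ, |(2 * m : ℝ)| ≤ |s| ∧ |s - 2 * m| ≤ 2 := by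
    intro s hs
    refine ⟨⌊s / 2⌋, ?_, ?_⟩
    · have h1 : (0 : ℝ) ≤ ⌊s / 2⌋ := by exact_mod_cast Int.floor_nonneg.2 (by positivity)
      rw [abs_of_nonneg (by positivity), abs_of_nonneg hs]
      linarith [Int.floor_le (s / 2)]
    · rw [abs_le]
      constructor <;> linarith [Int.floor_le (s / 2), Int.lt_floor_add_one (s / 2)]
  rcases le_total 0 s with hs | hs
  · exact key s hs
  · obtain ⟨m, h1, h2⟩ := key (-s) (by linarith)
    refine ⟨-m, ?_, ?_⟩
    · push_cast; rw [mul_neg, abs_neg]; simpa using h1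
    · rw [← abs_neg]; push_cast; convert h2 using 2; ring

lemma exists_grid_near (k : ℕ) {a c : ℝ} (h : a ^ 2 + c ^ 2 ≤ 1) :
    ∃ t : GridIdx, gridLevel t = k ∧ |a - gridX t| ≤ 2 / gridSize k ∧
      |c - gridY t| ≤ 2 / gridSize k := by
  have hn := gridSize_pos k
  obtain ⟨i, hi1, hi2⟩ := exists_even_near (a * gridSize k)
  obtain ⟨j, hj1, hj2⟩ := exists_even_near (c * gridSize k)
  have hmem : (2 * i) ^ 2 + (2 * j) ^ 2 ≤ gridSize k ^ 2 := by
    have h1 := sq_le_sq.2 hi1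
    have h2 := sq_le_sq.2 hj1
    have : (2 * i : ℝ) ^ 2 + (2 * j) ^ 2 ≤ (gridSize k : ℝ) ^ 2 := by nlinarith [sq_nonneg (gridSize k : ℝ)]
    exact_mod_cast this
  have hdiv : ∀ (a : ℝ) (i : ℤ), |a * gridSize k - 2 * i| ≤ 2 →
      |a - ((2 * i : ℤ) : ℝ) / gridSize k| ≤ 2 / gridSize k := by
    intro a i hi
    rw [le_div_iff₀ hn, ← abs_of_pos hn, ← abs_mul, abs_of_pos hn, sub_mul, div_mul_cancel₀ _ hn.ne']
    simpa using hi
  refine ⟨⟨(k, 2 * i, 2 * j), hmem, fun _ => ⟨i + j, by ring⟩⟩, rfl, hdiv a i hi2, hdiv c j hj2⟩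

lemma exists_grid_affineFun_ge (k : ℕ) (x : E3) : ∃ t : GridIdx, gridLevel t = k ∧
    (1 + (1 / 2 : ℝ) ^ k) * (paraSupport x - (1 / 2 : ℝ) ^ k / 32 * ‖x‖) - (1 / 128 : ℝ) ^ k ≤
      affineFun gridSlope gridConst t x := by
  obtain ⟨a, c, h, he⟩ := exists_paraSupport_eq x
  obtain ⟨t, rfl, hX, hY⟩ := exists_grid_near k h
  refine ⟨t, rfl, ?_⟩
  rw [affineFun_grid, he]
  -- With `e = 2⁻ᵏ`, the two linear and the two quadratic terms each lose at most `e / 128 * ‖x‖`,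
  -- together `e / 32 * ‖x‖`.
  have hn : (2 : ℝ) / gridSize (gridLevel t) = (1 / 2 : ℝ) ^ gridLevel t / 256 := by
    simp [gridSize]; field_simp; norm_num
  rw [hn] at hX hY
  have hd := grid_disc t
  set e := (1 / 2 : ℝ) ^ gridLevel t with hedef
  have he0 : 0 < e := by positivity
  set X := gridX t
  set Y := gridY t
  have habs : ∀ a c : ℝ, a ^ 2 + c ^ 2 ≤ 1 → |a| ≤ 1 := fun a c h =>
    abs_le_one_iff_mul_self_le_one.2 (by nlinarith [sq_nonneg c])
  have ha := habs a c h
  have hc := habs c a (by linarith)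
  have hX1 := habs X Y hd
  have hY1 := habs Y X (by linarith)
  have hsq : ∀ a X : ℝ, |a| ≤ 1 → |X| ≤ 1 → |a - X| ≤ e / 256 → |a ^ 2 - X ^ 2| ≤ e / 128 := by
    intro a X ha hX h
    rw [sq_sub_sq, abs_mul]
    have : |a + X| ≤ 2 := (abs_add_le _ _).trans (by linarith)
    calc |a + X| * |a - X| ≤ 2 * (e / 256) := mul_le_mul this h (abs_nonneg _) (by norm_num)
      _ = _ := by ring
  have hdiff : inner ℝ (paraPoint a c) x - inner ℝ (paraPoint X Y) x ≤ e / 32 * ‖x‖ := by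
    rw [inner_paraPoint, inner_paraPoint]
    have h0 : (a - X) * x 0 ≤ e / 256 * ‖x‖ := (le_abs_self _).trans (by
      rw [abs_mul]; exact mul_le_mul hX (abs_apply_le_norm x 0) (abs_nonneg _) (by positivity))
    have h1 : (c - Y) * x 1 ≤ e / 256 * ‖x‖ := (le_abs_self _).trans (by
      rw [abs_mul]; exact mul_le_mul hY (abs_apply_le_norm x 1) (abs_nonneg _) (by positivity))
    have h2 : -((a ^ 2 - X ^ 2) * x 2) ≤ e / 128 * ‖x‖ := (neg_le_abs _).trans (by
      rw [abs_mul]; exact mul_le_mul (hsq a X ha hX1 hX) (abs_apply_le_norm x 2) (abs_nonneg _)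
        (by positivity))
    have h3 : -((c ^ 2 - Y ^ 2) * x 2) ≤ e / 128 * ‖x‖ := (neg_le_abs _).trans (by
      rw [abs_mul]; exact mul_le_mul (hsq c Y hc hY1 hY) (abs_apply_le_norm x 2) (abs_nonneg _)
        (by positivity))
    linarith
  have : inner ℝ (paraPoint a c) x - e / 32 * ‖x‖ ≤ inner ℝ (paraPoint X Y) x := by linarith
  gcongr

lemma half_pow_le_one (k : ℕ) : (1 / 2 : ℝ) ^ k ≤ 1 := pow_le_one₀ (by norm_num) (by norm_num)

/-- With `e = 2⁻ᵏ` and `f = 64⁻ᵏ`, level `k` gains at least `e ‖x‖ / 8` through its larger factor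
and loses at most `e ‖x‖ / 16` by discretisation. The net `e ‖x‖ / 16 ≥ e f` beats its larger
constant, which costs only `127 / 128 * e f`. -/
lemma exists_grid_lt_of_far {k : ℕ} {x : E3} (hx : 16 * (1 / 64 : ℝ) ^ k ≤ ‖x‖) {t : GridIdx}
    (ht : gridLevel t = k + 1) : ∃ s : GridIdx, gridLevel s = k ∧
      affineFun gridSlope gridConst t x < affineFun gridSlope gridConst s x := by
  obtain ⟨s, hs, hge⟩ := exists_grid_affineFun_ge k x
  refine ⟨s, hs, lt_of_lt_of_le ?_ hge⟩
  refine (affineFun_grid_le t x).trans_lt ?_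
  rw [ht, pow_succ, pow_succ]
  have h128 : (1 / 128 : ℝ) ^ k = (1 / 2) ^ k * (1 / 64) ^ k := by rw [← mul_pow]; norm_num
  have hu := le_paraSupport x
  rw [h128]
  set e := (1 / 2 : ℝ) ^ k
  set f := (1 / 64 : ℝ) ^ k
  have he : 0 < e := by positivity
  have hf : 0 < f := by positivity
  have he1 : e ≤ 1 := half_pow_le_one k
  have hx0 : 0 ≤ ‖x‖ := norm_nonneg x
  have h1 : e * (‖x‖ / 4) ≤ e * paraSupport x := mul_le_mul_of_nonneg_left hu he.le
  have h2 : e * (16 * f) ≤ e * ‖x‖ := mul_le_mul_of_nonneg_left hx he.le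
  have h3 : e * (e * ‖x‖) ≤ 1 * (e * ‖x‖) := mul_le_mul_of_nonneg_right he1 (by positivity)
  have h4 : 0 < e * f := by positivity
  nlinarith

/-- The reverse comparison: since `paraSupport x ≤ 3 ‖x‖`, the advantage of level `k` in slope and
the discretisation loss of level `k + 1` total at most `3 / 2 * 65 / 64 * e ‖x‖`, which is below the
difference `127 / 128 * e f` of the constants. -/
lemma exists_grid_lt_of_near {k : ℕ} {x : E3} (hx : ‖x‖ ≤ 31 / 64 * (1 / 64 : ℝ) ^ k)
    {t : GridIdx} (ht : gridLevel t = k) : ∃ s : GridIdx, gridLevel s = k + 1 ∧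
      affineFun gridSlope gridConst t x < affineFun gridSlope gridConst s x := by
  obtain ⟨s, hs, hge⟩ := exists_grid_affineFun_ge (k + 1) x
  refine ⟨s, hs, lt_of_lt_of_le ?_ hge⟩
  refine (affineFun_grid_le t x).trans_lt ?_
  rw [ht, pow_succ, pow_succ]
  have h128 : (1 / 128 : ℝ) ^ k = (1 / 2) ^ k * (1 / 64) ^ k := by rw [← mul_pow]; norm_num
  have hu := paraSupport_le x
  rw [h128]
  set e := (1 / 2 : ℝ) ^ k
  set f := (1 / 64 : ℝ) ^ k
  have he : 0 < e := by positivity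
  have hf : 0 < f := by positivity
  have he1 : e ≤ 1 := half_pow_le_one k
  have hx0 : 0 ≤ ‖x‖ := norm_nonneg x
  have h1 : e * paraSupport x ≤ e * (3 * ‖x‖) := mul_le_mul_of_nonneg_left hu he.le
  have h2 : e * ‖x‖ ≤ e * (31 / 64 * f) := mul_le_mul_of_nonneg_left hx he.le
  have h3 : e * (e * ‖x‖) ≤ 1 * (e * ‖x‖) := mul_le_mul_of_nonneg_right he1 (by positivity)
  have h4 : 0 < e * f := by positivity
  nlinarith

lemma exists_grid_lt_of_far' {K : ℕ} {x : E3} (hx : 16 * (1 / 64 : ℝ) ^ K ≤ ‖x‖) :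
    ∀ d : ℕ, ∀ t : GridIdx, gridLevel t = K + d + 1 → ∃ s : GridIdx, gridLevel s = K ∧
      affineFun gridSlope gridConst t x < affineFun gridSlope gridConst s x := by
  intro d
  induction d with
  | zero => intro t ht; exact exists_grid_lt_of_far hx ht
  | succ d ih =>
    intro t ht
    have hx' : 16 * (1 / 64 : ℝ) ^ (K + d + 1) ≤ ‖x‖ := by
      refine le_trans ?_ hx
      gcongr ?_ * ?_
      exact pow_le_pow_of_le_one (by norm_num) (by norm_num) (by omega)
    obtain ⟨s, hs, h1⟩ := exists_grid_lt_of_far hx' (t := t) (by omega)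
    obtain ⟨s', hs', h2⟩ := ih s hs
    exact ⟨s', hs', h1.trans h2⟩

lemma exists_grid_lt_of_near' : ∀ d : ℕ, ∀ {k : ℕ} {x : E3},
    ‖x‖ ≤ 31 / 64 * (1 / 64 : ℝ) ^ (k + d) → ∀ t : GridIdx, gridLevel t = k →
      ∃ s : GridIdx, gridLevel s = k + d + 1 ∧
      affineFun gridSlope gridConst t x < affineFun gridSlope gridConst s x := by
  intro d
  induction d with
  | zero => intro k x hx t ht; exact exists_grid_lt_of_near hx ht
  | succ d ih =>
    intro k x hx t ht
    have hx' : ‖x‖ ≤ 31 / 64 * (1 / 64 : ℝ) ^ k := by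
      refine hx.trans ?_
      gcongr ?_ * ?_
      exact pow_le_pow_of_le_one (by norm_num) (by norm_num) (by omega)
    obtain ⟨s, hs, h1⟩ := exists_grid_lt_of_near hx' ht
    obtain ⟨s', hs', h2⟩ := ih (k := k + 1) (x := x) (by convert hx using 3; omega) s hs
    exact ⟨s', by omega, h1.trans h2⟩

/-- The levels of two indices active at the same point differ by at most one. -/
lemma gridLevel_le_succ {K : ℕ} {x : E3} {i j : GridIdx}
    (hi : IsActive gridSlope gridConst {i | gridLevel i ≤ K} x i)
    (hj : IsActive gridSlope gridConst {i | gridLevel i ≤ K} x j) :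
    gridLevel j ≤ gridLevel i + 1 := by
  by_contra! hcon
  have hjK : gridLevel j ≤ K := hj.1
  have h1 : 31 / 64 * (1 / 64 : ℝ) ^ gridLevel i < ‖x‖ := by
    by_contra! hx
    obtain ⟨s, hs, hlt⟩ := exists_grid_lt_of_near hx rfl
    exact absurd (hi.2 s (by simp only [Set.mem_ofPred_eq]; omega)) (not_le.2 hlt)
  have h2 : ‖x‖ < 16 * (1 / 64 : ℝ) ^ (gridLevel j - 1) := by
    by_contra! hx
    obtain ⟨s, hs, hlt⟩ := exists_grid_lt_of_far hx (t := j) (by omega)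
    exact absurd (hj.2 s (by simp only [Set.mem_ofPred_eq]; omega)) (not_le.2 hlt)
  have h3 : (1 / 64 : ℝ) ^ (gridLevel j - 1) ≤ (1 / 64) ^ (gridLevel i + 1) :=
    pow_le_pow_of_le_one (by norm_num) (by norm_num) (by omega)
  rw [pow_succ] at h3
  have h4 : (0 : ℝ) < (1 / 64) ^ gridLevel i := by positivity
  linarith

lemma gridConst_inj {i j : GridIdx} (h : gridConst i = gridConst j) :
    gridLevel i = gridLevel j :=
  (pow_right_strictAnti₀ (by norm_num : (0 : ℝ) < 1 / 128) (by norm_num)).injective h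

lemma grid_ext {i j : GridIdx} (hl : gridLevel i = gridLevel j) (hX : gridX i = gridX j)
    (hY : gridY i = gridY j) : i = j := by
  obtain ⟨⟨k, a, c⟩, hi⟩ := i
  obtain ⟨⟨k', a', c'⟩, hj⟩ := j
  simp only [gridLevel] at hl
  subst hl
  have hn := (gridSize_pos k).ne'
  simp only [gridX, gridY, div_left_inj' hn, Int.cast_inj] at hX hY
  subst hX hY
  rfl

lemma gridSlope_coords (t : GridIdx) :
    gridSlope t 0 = (1 + (1 / 2 : ℝ) ^ gridLevel t) * (2 * gridX t) ∧
    gridSlope t 1 = (1 + (1 / 2 : ℝ) ^ gridLevel t) * (2 * gridY t) ∧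
    gridSlope t 2 = (1 + (1 / 2 : ℝ) ^ gridLevel t) * (1 / 2 - gridX t ^ 2 - gridY t ^ 2) := by
  simp [gridSlope, paraPoint]

lemma gridSlope_inj {i j : GridIdx} (hl : gridLevel i = gridLevel j)
    (h : gridSlope i = gridSlope j) : i = j := by
  have h0 := congrArg (fun x : E3 => x 0) h
  have h1 := congrArg (fun x : E3 => x 1) h
  simp only [gridSlope_coords, hl] at h0 h1
  have hp : (1 + (1 / 2 : ℝ) ^ gridLevel j) ≠ 0 := by positivity
  exact grid_ext hl (by linarith [mul_left_cancel₀ hp h0]) (by linarith [mul_left_cancel₀ hp h1])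

/-- If `i` and `j` share a level, equality of constants puts `k` there too, and a line meets the
strictly convex paraboloid in at most two points: `c * (1 - c) = 0`. Otherwise `k` shares its level
with `i` or `j`, and the constants, which determine the level, force `c = 0` or `c = 1`. -/
lemma grid_not_collinear {i j k : GridIdx} (hki : k ≠ i) (hkj : k ≠ j) (hij : i ≠ j)
    (hl : (gridLevel k = gridLevel i ∨ gridLevel k = gridLevel j) ∨ gridLevel i = gridLevel j)
    {c : ℝ} (hq : gridSlope i - gridSlope k = c • (gridSlope i - gridSlope j))
    (hb : gridConst i - gridConst k = c * (gridConst i - gridConst j)) : False := by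
  by_cases hlij : gridLevel i = gridLevel j
  · have hbij : gridConst i = gridConst j := by simp [gridConst, hlij]
    rw [hbij, sub_self, mul_zero, sub_eq_zero] at hb
    have hlk : gridLevel j = gridLevel k := gridConst_inj hb
    have h0 := congrArg (fun x : E3 => x 0) hq
    have h1 := congrArg (fun x : E3 => x 1) hq
    have h2 := congrArg (fun x : E3 => x 2) hq
    simp only [PiLp.sub_apply, PiLp.smul_apply, gridSlope_coords, hlij, ← hlk, smul_eq_mul] at h0 h1 h2
    have hp : (1 + (1 / 2 : ℝ) ^ gridLevel j) ≠ 0 := by positivity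
    have h0 : gridX i - gridX k = c * (gridX i - gridX j) :=
      mul_left_cancel₀ hp (by linear_combination h0 / 2)
    have h1 : gridY i - gridY k = c * (gridY i - gridY j) :=
      mul_left_cancel₀ hp (by linear_combination h1 / 2)
    have h2 : (1 / 2 - gridX i ^ 2 - gridY i ^ 2) - (1 / 2 - gridX k ^ 2 - gridY k ^ 2) =
        c * ((1 / 2 - gridX i ^ 2 - gridY i ^ 2) - (1 / 2 - gridX j ^ 2 - gridY j ^ 2)) :=
      mul_left_cancel₀ hp (by linear_combination h2)
    have hX : gridX k = gridX i - c * (gridX i - gridX j) := by linarith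
    have hY : gridY k = gridY i - c * (gridY i - gridY j) := by linarith
    rw [hX, hY] at h2
    have h3 : c * (1 - c) * ((gridX i - gridX j) ^ 2 + (gridY i - gridY j) ^ 2) = 0 := by
      linear_combination -h2
    rcases mul_eq_zero.1 h3 with h4 | h4
    · rcases mul_eq_zero.1 h4 with h5 | h5
      · exact hki (grid_ext (by omega) (by rw [hX, h5]; ring) (by rw [hY, h5]; ring))
      · have : c = 1 := by linarith
        exact hkj (grid_ext (by omega) (by rw [hX, this]; ring) (by rw [hY, this]; ring))
    · refine hij (grid_ext hlij ?_ ?_) <;>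
        nlinarith [sq_nonneg (gridX i - gridX j), sq_nonneg (gridY i - gridY j)]
  · have hne : gridConst i - gridConst j ≠ 0 := fun h => hlij (gridConst_inj (sub_eq_zero.1 h))
    rcases hl with (hl | hl) | hl
    · have : gridConst k = gridConst i := by simp [gridConst, hl]
      rw [this, sub_self, zero_eq_mul, or_iff_left hne] at hb
      rw [hb, zero_smul, sub_eq_zero] at hq
      exact hki (gridSlope_inj hl hq.symm)
    · have : gridConst k = gridConst j := by simp [gridConst, hl]
      rw [this] at hb
      have hc : c = 1 := by
        have := mul_right_cancel₀ hne ((one_mul _).trans hb)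
        exact this.symm
      rw [hc, one_smul, sub_right_inj] at hq
      exact hkj (gridSlope_inj hl hq)
    · exact hlij hl

/-- Inside the hyperplane the condition cuts out a hyperplane whose normal is the projection of `m`,
nonzero because `m` is not a multiple of `n`. -/
lemma ae_hyperplaneMeasure_inner_ne {E : Type*} [NormedAddCommGroup E] [InnerProductSpace ℝ E]
    [FiniteDimensional ℝ E] [MeasurableSpace E] [BorelSpace E] {n m : E}
    (hm : ∀ c : ℝ, m ≠ c • n) (c d : ℝ) : ∀ᵐ x ∂hyperplaneMeasure n c, inner ℝ m x ≠ d := by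
  have hms : MeasurableSet {x : E | inner ℝ m x ≠ d} :=
    (isClosed_eq (by fun_prop) continuous_const).measurableSet.compl
  rw [hyperplaneMeasure, ae_map_iff (by fun_prop) hms]
  set m' : (ℝ ∙ n)ᗮ := (ℝ ∙ n)ᗮ.orthogonalProjectionOnto m with hm'
  have h0 : m' ≠ 0 := by
    intro h
    rw [hm', Submodule.orthogonalProjectionOnto_eq_zero_iff, Submodule.orthogonal_orthogonal,
      Submodule.mem_span_singleton] at h
    obtain ⟨a, ha⟩ := h
    exact hm a ha.symm
  have hvol := volume_hyperplane h0 (d - (c / ‖n‖ ^ 2) * inner ℝ m n)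
  rw [← compl_compl {x : (ℝ ∙ n)ᗮ | inner ℝ m' x = _}] at hvol
  filter_upwards [compl_mem_ae_iff.2 (by simpa using hvol)] with z hz heq
  apply hz
  rw [inner_add_right, inner_smul_right] at heq
  have h1 : inner ℝ m' z = inner ℝ m (z : E) := by
    exact Submodule.inner_orthogonalProjectionOnto_eq_of_mem_right z m
  have h2 : inner ℝ m' z = d - c / ‖n‖ ^ 2 * inner ℝ m n := by linarith
  exact h2

lemma isGeneric_grid (K : ℕ) : IsGeneric gridSlope gridConst {i | gridLevel i ≤ K} := by
  intro i j k hki hkj hij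
  by_cases hcol : ∃ c : ℝ, gridSlope i - gridSlope k = c • (gridSlope i - gridSlope j)
  · obtain ⟨c, hc⟩ := hcol
    refine Eventually.of_forall fun x hx => ?_
    obtain ⟨hi, hj, hk⟩ := hx
    have h1 := hi.eq hj
    have h2 := hi.eq hk
    refine grid_not_collinear hki hkj (fun h => hij (h ▸ rfl)) ?_ hc ?_
    · have := gridLevel_le_succ hi hj
      -- Three levels that differ pairwise by at most one cannot be distinct.
      have := gridLevel_le_succ hj hi
      have := gridLevel_le_succ hi hk
      have := gridLevel_le_succ hk hi
      have := gridLevel_le_succ hj hk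
      have := gridLevel_le_succ hk hj
      omega
    · simp only [affineFun] at h1 h2
      have h3 : gridConst i - gridConst j = inner ℝ (gridSlope i - gridSlope j) x := by
        rw [inner_sub_left]; linarith
      have h4 : gridConst i - gridConst k = inner ℝ (gridSlope i - gridSlope k) x := by
        rw [inner_sub_left]; linarith
      rw [h3, h4, hc, inner_smul_left]; rfl
  · push Not at hcol
    filter_upwards [ae_hyperplaneMeasure_inner_ne hcol (gridConst i - gridConst j)
      (gridConst i - gridConst k)] with x hx hact
    apply hx
    have := hact.1.eq hact.2.2
    simp only [affineFun] at this
    rw [inner_sub_left]; linarith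

/-- The radius outside of which only levels up to `K` are active. -/
noncomputable def gridRadius (K : ℕ) : ℝ := 16 * (1 / 64 : ℝ) ^ K

/-- The lattice point at the origin. -/
def gridOrigin (k : ℕ) : GridIdx := ⟨(k, 0, 0), by simp; positivity, by simp⟩

lemma isLeveled_grid : IsLeveled gridSlope gridConst gridLevel gridRadius 6 where
  inj := by
    intro i j h
    simp only [Prod.mk.injEq] at h
    exact gridSlope_inj (gridConst_inj h.2) h.1
  finite := by
    intro K
    have hfin : (Set.Iic K ×ˢ (Set.Icc (-gridSize K) (gridSize K) ×ˢ
        Set.Icc (-gridSize K) (gridSize K))).Finite :=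
      (Set.finite_Iic K).prod ((Set.finite_Icc _ _).prod (Set.finite_Icc _ _))
    refine Set.Finite.of_finite_image (f := Subtype.val) (hfin.subset ?_)
      Subtype.val_injective.injOn
    rintro _ ⟨t, ht, rfl⟩
    obtain ⟨⟨k, a, c⟩, h, hpar⟩ := t
    have hk : k ≤ K := ht
    have hs : gridSize k ≤ gridSize K := by
      unfold gridSize
      gcongr
      norm_num
    have h0 : 0 ≤ gridSize k := by unfold gridSize; positivity
    simp only at h
    have ha : |a| ≤ gridSize k := abs_le_of_sq_le_sq (by nlinarith [sq_nonneg c]) h0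
    have hc : |c| ≤ gridSize k := abs_le_of_sq_le_sq (by nlinarith [sq_nonneg a]) h0
    rw [abs_le] at ha hc
    simp only [Set.mem_prod, Set.mem_Iic, Set.mem_Icc]
    omega
  nonempty := fun K => ⟨gridOrigin 0, by simp [gridOrigin, gridLevel]⟩
  pos := fun K => by unfold gridRadius; positivity
  anti := by
    intro K L h
    unfold gridRadius
    gcongr ?_ * ?_
    exact pow_le_pow_of_le_one (by norm_num) (by norm_num) h
  tendsto := by
    have := (tendsto_pow_atTop_nhds_zero_of_lt_one (r := (1 / 64 : ℝ)) (by norm_num)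
      (by norm_num)).const_mul 16
    rw [mul_zero] at this
    exact this
  dom := by
    intro K x hx j hj
    obtain ⟨d, hd⟩ := Nat.exists_eq_add_of_lt hj
    obtain ⟨s, hs, hlt⟩ := exists_grid_lt_of_far' (K := K) (x := x) hx.le d j hd
    exact ⟨s, hs.le, hlt⟩
  bound := by
    intro t
    rw [gridSlope, norm_smul, Real.norm_of_nonneg (by positivity)]
    have h1 := half_pow_le_one (gridLevel t)
    have h2 := norm_paraPoint_le (grid_disc t)
    calc _ ≤ (2 : ℝ) * 3 := mul_le_mul (by linarith) h2 (norm_nonneg _) (by norm_num)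
      _ = 6 := by norm_num
  generic := isGeneric_grid
  zero := by
    intro i
    refine ⟨gridOrigin (gridLevel i + 1), ?_⟩
    have h : gridLevel (gridOrigin (gridLevel i + 1)) = gridLevel i + 1 := rfl
    simp only [affineFun, inner_zero_right, gridConst, h, pow_succ]
    have : (0 : ℝ) < (1 / 128) ^ gridLevel i := by positivity
    linarith

end Family

/-! ### Convergence of the active slopes to the gradient of the support function -/

section SlopeLimit

lemma exists_activeSlope_eq {E ι : Type*} [NormedAddCommGroup E] [InnerProductSpace ℝ E]
    {q : ι → E} {b : ι → ℝ} {J : Set ι} {x : E} (h : ∃ i, IsActive q b J x i) :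
    ∃ i, IsActive q b J x i ∧ activeSlope q b J x = q i :=
  ⟨h.choose, h.choose_spec, by rw [activeSlope, dif_pos h]⟩

/-- The maximum dominates every level, and the level-`k` lower bounds at `y` tend to `paraSupport
y`. -/
lemma paraSupport_le_of_isActive {i : GridIdx} {y : E3}
    (hi : IsActive gridSlope gridConst Set.univ y i) :
    paraSupport y ≤ affineFun gridSlope gridConst i y := by
  have h1 : Tendsto (fun k : ℕ => (1 / 2 : ℝ) ^ k) atTop (𝓝 0) :=
    tendsto_pow_atTop_nhds_zero_of_lt_one (by norm_num) (by norm_num)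
  have h2 : Tendsto (fun k : ℕ => (1 / 128 : ℝ) ^ k) atTop (𝓝 0) :=
    tendsto_pow_atTop_nhds_zero_of_lt_one (by norm_num) (by norm_num)
  have h3 : Tendsto (fun k : ℕ => (1 + (1 / 2 : ℝ) ^ k) *
      (paraSupport y - (1 / 2 : ℝ) ^ k / 32 * ‖y‖) - (1 / 128 : ℝ) ^ k) atTop
      (𝓝 ((1 + 0) * (paraSupport y - 0 / 32 * ‖y‖) - 0)) :=
    ((h1.const_add 1).mul (((h1.div_const 32).mul_const ‖y‖).const_sub _)).sub h2
  have h4 := le_of_tendsto' h3 fun k => by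
    obtain ⟨t, -, ht⟩ := exists_grid_affineFun_ge k y
    exact ht.trans (hi.2 t (Set.mem_univ t))
  simpa using h4

/-- High levels exceed `paraSupport` by a small factor only; each of the low levels has a fixed
negative constant, which for small `r` outweighs its excess. -/
lemma eventually_affineFun_grid_le (z : E3) {δ : ℝ} (hδ : 0 < δ) :
    ∀ᶠ r in 𝓝[>] (0 : ℝ), ∀ t, affineFun gridSlope gridConst t (r • z) ≤
      r * (paraSupport z + δ) := by
  have hu := paraSupport_nonneg z
  have h1 : Tendsto (fun k : ℕ => (1 / 2 : ℝ) ^ k * paraSupport z) atTop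
      (𝓝 (0 * paraSupport z)) :=
    (tendsto_pow_atTop_nhds_zero_of_lt_one (by norm_num) (by norm_num)).mul_const _
  rw [zero_mul] at h1
  obtain ⟨K, hK⟩ := (h1.eventually_lt_const hδ).exists
  have h2 : Tendsto (fun r : ℝ => r * (2 * paraSupport z)) (𝓝[>] 0)
      (𝓝 (0 * (2 * paraSupport z))) :=
    (tendsto_id.mono_left nhdsWithin_le_nhds).mul_const _
  rw [zero_mul] at h2
  filter_upwards [h2.eventually_lt_const (by positivity : (0 : ℝ) < (1 / 128) ^ K),
    self_mem_nhdsWithin] with r hr hr0 t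
  have hr0 : 0 < r := hr0
  have h3 := affineFun_grid_le t (r • z)
  rw [paraSupport_smul hr0.le] at h3
  have hd : (0 : ℝ) < (1 / 128) ^ gridLevel t := by positivity
  have hru : 0 ≤ r * paraSupport z := by positivity
  rcases le_total K (gridLevel t) with h | h
  · have h4 : (1 / 2 : ℝ) ^ gridLevel t ≤ (1 / 2) ^ K :=
      pow_le_pow_of_le_one (by norm_num) (by norm_num) h
    have h5 : (1 / 2 : ℝ) ^ gridLevel t * (r * paraSupport z) ≤ (1 / 2) ^ K * (r * paraSupport z) :=
      mul_le_mul_of_nonneg_right h4 hru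
    have h6 : r * ((1 / 2) ^ K * paraSupport z) ≤ r * δ := mul_le_mul_of_nonneg_left hK.le hr0.le
    linarith
  · have h4 : (1 / 128 : ℝ) ^ K ≤ (1 / 128) ^ gridLevel t :=
      pow_le_pow_of_le_one (by norm_num) (by norm_num) h
    have h5 : (1 / 2 : ℝ) ^ gridLevel t * (r * paraSupport z) ≤ 1 * (r * paraSupport z) :=
      mul_le_mul_of_nonneg_right (half_pow_le_one _) hru
    have h6 : 0 ≤ r * δ := by positivity
    linarith

/-- The active slope at `r • x` is an approximate subgradient of `paraSupport` at `x`: the active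
affine function is at least `paraSupport` at `r • x` and at most slightly above it at `r • z`. -/
lemma eventually_inner_activeSlope_le {x : E3} (hx : x ≠ 0) (z : E3) {δ : ℝ} (hδ : 0 < δ) :
    ∀ᶠ r in 𝓝[>] (0 : ℝ), inner ℝ (activeSlope gridSlope gridConst Set.univ (r • x)) (z - x) ≤
      paraSupport z - paraSupport x + δ := by
  filter_upwards [eventually_affineFun_grid_le z hδ, self_mem_nhdsWithin] with r hr hr0
  have hr0 : 0 < r := hr0
  obtain ⟨i, hi, he⟩ := exists_activeSlope_eq
    (isLeveled_grid.exists_isActive (smul_ne_zero hr0.ne' hx))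
  have h1 := paraSupport_le_of_isActive hi
  have h2 := hr i
  rw [paraSupport_smul hr0.le] at h1
  simp only [affineFun, inner_smul_right] at h1 h2
  rw [he, inner_sub_right]
  have h3 : r * (inner ℝ (gridSlope i) z - inner ℝ (gridSlope i) x) ≤
      r * (paraSupport z - paraSupport x + δ) := by linarith
  exact le_of_mul_le_mul_left h3 hr0

lemma eventually_inner_activeSlope_lt {x : E3} (hx : x ≠ 0)
    (hd : DifferentiableAt ℝ paraSupport x) (w : E3) {ε : ℝ} (hε : 0 < ε) :
    ∀ᶠ r in 𝓝[>] (0 : ℝ), inner ℝ (activeSlope gridSlope gridConst Set.univ (r • x)) w <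
      fderiv ℝ paraSupport x w + ε := by
  have h1 : HasDerivAt (fun t : ℝ => paraSupport (x + t • w)) (fderiv ℝ paraSupport x w) 0 := by
    have := hd.hasFDerivAt.hasLineDerivAt w
    exact this
  have h2 := (hasDerivAt_iff_tendsto_slope_zero.1 h1).mono_left
    (nhdsWithin_mono _ (fun t (ht : 0 < t) => ht.ne') : 𝓝[>] (0 : ℝ) ≤ 𝓝[≠] 0)
  -- One fixed step `t` has difference quotient within `ε / 2` of the derivative; the error `δ = t *
  -- (ε / 2)` uses the other half.
  obtain ⟨t, ht, ht0⟩ := ((h2.eventually_lt_const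
    (by linarith : fderiv ℝ paraSupport x w < fderiv ℝ paraSupport x w + ε / 2)).and
    self_mem_nhdsWithin).exists
  have ht0 : 0 < t := ht0
  simp only [zero_add, zero_smul, add_zero, smul_eq_mul] at ht
  rw [inv_mul_lt_iff₀ ht0] at ht
  filter_upwards [eventually_inner_activeSlope_le hx (x + t • w)
    (δ := t * (ε / 2)) (by positivity)] with r hr
  rw [add_sub_cancel_left, inner_smul_right] at hr
  exact lt_of_mul_lt_mul_left (by linarith : t * _ < t * _) ht0.le

lemma tendsto_activeSlope_grid {x : E3} (hx : x ≠ 0) (hd : DifferentiableAt ℝ paraSupport x) :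
    Tendsto (fun r : ℝ => activeSlope gridSlope gridConst Set.univ (r • x)) (𝓝[>] 0)
      (𝓝 (gradient paraSupport x)) := by
  have h1 : ∀ w : E3, Tendsto (fun r : ℝ =>
      inner ℝ (activeSlope gridSlope gridConst Set.univ (r • x)) w) (𝓝[>] 0)
      (𝓝 (inner ℝ (gradient paraSupport x) w)) := by
    intro w
    rw [gradient, InnerProductSpace.toDual_symm_apply, tendsto_order]
    refine ⟨fun a ha => ?_, fun a ha => ?_⟩
    -- Differentiability makes the one-sided estimate two-sided, by using `-w`.
    · filter_upwards [eventually_inner_activeSlope_lt hx hd (-w) (sub_pos.2 ha)] with r hr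
      rw [inner_neg_right, map_neg] at hr
      linarith
    · filter_upwards [eventually_inner_activeSlope_lt hx hd w (sub_pos.2 ha)] with r hr
      linarith
  have h2 : ∀ y : E3, y = ∑ a : Fin 3, inner ℝ y (EuclideanSpace.single a (1 : ℝ)) •
      EuclideanSpace.single a (1 : ℝ) := by
    intro y
    ext a
    simp [Fin.sum_univ_three]
    fin_cases a <;> simp [EuclideanSpace.inner_single_right]
  rw [h2 (gradient paraSupport x)]
  refine (tendsto_finsetSum Finset.univ fun a _ =>
    (h1 (EuclideanSpace.single a (1 : ℝ))).smul_const (EuclideanSpace.single a (1 : ℝ))).congr ?_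
  intro r
  exact (h2 _).symm

lemma ae_tendsto_activeSlope_grid : ∀ᵐ x : E3,
    Tendsto (fun r : ℝ => activeSlope gridSlope gridConst Set.univ (r • x)) (𝓝[>] 0)
      (𝓝 (gradient paraSupport x)) := by
  filter_upwards [ae_ne_zero, lipschitzWith_paraSupport.ae_differentiableAt] with x hx hd
  exact tendsto_activeSlope_grid hx hd

end SlopeLimit

/-! ### Positivity of a second derivative of the support function -/

section ConeHessian

/-- The open cone in which the support function is given by `paraSupport_eq`. -/
def paraCone : Set E3 := {x | 0 < x 2 ∧ x 0 ^ 2 + x 1 ^ 2 < x 2 ^ 2}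

lemma isOpen_paraCone : IsOpen paraCone :=
  (isOpen_lt (f := fun _ : E3 => (0 : ℝ)) (g := fun x => x 2) (by fun_prop) (by fun_prop)).inter
    (isOpen_lt (f := fun x : E3 => x 0 ^ 2 + x 1 ^ 2) (g := fun x => x 2 ^ 2) (by fun_prop)
      (by fun_prop))

lemma differentiableAt_apply_div {x : E3} (h2 : x 2 ≠ 0) :
    DifferentiableAt ℝ (fun x : E3 => 2 * x 0 / x 2) x := by
  fun_prop (disch := assumption)

lemma fderiv_eq_of_line {f : E3 → ℝ} {x w : E3} (hd : DifferentiableAt ℝ f x) {d : ℝ}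
    (h : HasDerivAt (fun t : ℝ => f (x + t • w)) d 0) : fderiv ℝ f x w = d := by
  rw [← hd.lineDeriv_eq_fderiv]
  exact h.deriv

lemma fderiv_apply_div {x : E3} (h2 : x 2 ≠ 0) :
    fderiv ℝ (fun x : E3 => 2 * x 0 / x 2) x (EuclideanSpace.single 0 1) = 2 / x 2 := by
  refine fderiv_eq_of_line (differentiableAt_apply_div h2) ?_
  have h : HasDerivAt (fun t : ℝ => 2 * (x 0 + t) / x 2) (2 * 1 / x 2) 0 :=
    (((hasDerivAt_id (0 : ℝ)).const_add (x 0)).const_mul 2).div_const (x 2)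
  rw [mul_one] at h
  refine h.congr_of_eventuallyEq (Eventually.of_forall fun t => ?_)
  simp

lemma inner_gradient_paraSupport {x : E3} (hx : x ∈ paraCone) :
    inner ℝ (gradient paraSupport x) (EuclideanSpace.single 0 1) = 2 * x 0 / x 2 := by
  have h2 : x 2 ≠ 0 := hx.1.ne'
  have heq : paraSupport =ᶠ[𝓝 x] fun x => (x 0 ^ 2 + x 1 ^ 2) / x 2 + x 2 / 2 := by
    filter_upwards [isOpen_paraCone.mem_nhds hx] with y hy using paraSupport_eq hy.1 hy.2.le
  have hdf : DifferentiableAt ℝ (fun x : E3 => (x 0 ^ 2 + x 1 ^ 2) / x 2 + x 2 / 2) x := by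
    fun_prop (disch := assumption)
  rw [gradient, InnerProductSpace.toDual_symm_apply, heq.fderiv_eq]
  refine fderiv_eq_of_line hdf ?_
  have h : HasDerivAt (fun t : ℝ => ((x 0 + t) ^ 2 + x 1 ^ 2) / x 2 + x 2 / 2)
      ((2 * (x 0 + 0) ^ 1 * 1) / x 2) 0 := by
    have := ((((hasDerivAt_id (0 : ℝ)).const_add (x 0)).pow 2).add_const (x 1 ^ 2)).div_const (x 2)
    simpa using this.add_const (x 2 / 2)
  simp only [add_zero, pow_one, mul_one] at h
  refine h.congr_of_eventuallyEq (Eventually.of_forall fun t => ?_)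
  simp

/-- In the cone the second derivative of `paraSupport` in direction 0 is `2 / x 2 > 0`; integrating
by parts gives its integral against `ψ`. -/
lemma integral_gradient_paraSupport_pos {ψ : E3 → ℝ} (hψ : ContDiff ℝ 1 ψ)
    (hc : HasCompactSupport ψ) (hs : tsupport ψ ⊆ paraCone) (h0 : ∀ x, 0 ≤ ψ x)
    {p : E3} (hp : ψ p ≠ 0) :
    0 < - ∫ x, inner ℝ (gradient paraSupport x) (EuclideanSpace.single 0 1) *
      fderiv ℝ ψ x (EuclideanSpace.single 0 1) := by
  set e : E3 := EuclideanSpace.single 0 1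
  have hs2 : ∀ x ∈ tsupport ψ, x 2 ≠ 0 := fun x hx => (hs hx).1.ne'
  have hsd : tsupport (fun x => fderiv ℝ ψ x e) ⊆ tsupport ψ := tsupport_fderiv_apply_subset ℝ e
  have hcont : ∀ f : E3 → ℝ, (∀ x ∈ tsupport ψ, ContinuousAt f x) → ∀ g : E3 → ℝ, Continuous g →
      tsupport g ⊆ tsupport ψ → Continuous fun x => f x * g x := by
    intro f hf g hg hgs
    refine continuous_iff_continuousAt.2 fun x => ?_
    by_cases hx : x ∈ tsupport ψ
    · exact (hf x hx).mul hg.continuousAt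
    · have : (fun x => f x * g x) =ᶠ[𝓝 x] fun _ => 0 := by
        filter_upwards [(isClosed_tsupport g).isOpen_compl.mem_nhds fun h => hx (hgs h)] with y hy
        rw [image_eq_zero_of_notMem_tsupport hy, mul_zero]
      exact continuousAt_const.congr this.symm
  have hdc : Continuous fun x => fderiv ℝ ψ x e :=
    (hψ.continuous_fderiv (by simp)).clm_apply continuous_const
  have hf1 : ∀ x ∈ tsupport ψ, ContinuousAt (fun x : E3 => 2 * x 0 / x 2) x :=
    fun x hx => (differentiableAt_apply_div (hs2 x hx)).continuousAt
  have hf2 : ∀ x ∈ tsupport ψ, ContinuousAt (fun x : E3 => 2 / x 2) x := fun x hx => by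
    have := hs2 x hx
    fun_prop (disch := assumption)
  have hcψ : ∀ f : E3 → ℝ, HasCompactSupport fun x => f x * ψ x := fun f => hc.mul_left
  have hdiv : (fun x => fderiv ℝ (fun x : E3 => 2 * x 0 / x 2) x e * ψ x) =
      fun x => 2 / x 2 * ψ x := by
    ext x
    by_cases hx : x ∈ tsupport ψ
    · rw [fderiv_apply_div (hs2 x hx)]
    · rw [image_eq_zero_of_notMem_tsupport hx, mul_zero, mul_zero]
  have hc2 : Continuous fun x => 2 / x 2 * ψ x := hcont _ hf2 ψ hψ.continuous le_rfl
  -- `2 * x 0 / x 2` is singular on `x 2 = 0`, but regularity is needed only on the support of `ψ`.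
  have hibp := integral_mul_fderiv_eq_neg_fderiv_mul_of_integrable (μ := (volume : Measure E3))
    (f := fun x : E3 => 2 * x 0 / x 2) (g := ψ) (v := e)
    (by rw [hdiv]; exact hc2.integrable_of_hasCompactSupport (hcψ _))
    ((hcont _ hf1 _ hdc hsd).integrable_of_hasCompactSupport (hc.fderiv_apply ℝ e).mul_left)
    ((hcont _ hf1 _ hψ.continuous le_rfl).integrable_of_hasCompactSupport (hcψ _))
    (fun x hx => differentiableAt_apply_div (hs2 x hx))
    (fun x _ => hψ.differentiable (by simp) x)
  have hcongr : ∀ x, inner ℝ (gradient paraSupport x) e * fderiv ℝ ψ x e =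
      2 * x 0 / x 2 * fderiv ℝ ψ x e := by
    intro x
    by_cases hx : x ∈ tsupport ψ
    · rw [inner_gradient_paraSupport (hs hx)]
    · rw [image_eq_zero_of_notMem_tsupport fun h => hx (hsd h), mul_zero, mul_zero]
  simp only [hcongr]
  rw [hibp, neg_neg, hdiv]
  refine hc2.integral_pos_of_hasCompactSupport_nonneg_nonzero (hcψ _) (x := p) (fun x => ?_) ?_
  · by_cases hx : x ∈ tsupport ψ
    · have := (hs hx).1
      have := h0 x
      positivity
    · simp [image_eq_zero_of_notMem_tsupport hx]
  · exact mul_ne_zero (div_ne_zero two_ne_zero (hs2 p (subset_tsupport ψ hp))) hp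

end ConeHessian

/-! ### Facet normals in the annuli where a single level is active -/

section Annuli

/-- Beyond `16 · 64⁻ᵏ` higher levels are dominated; since `31 · 64⁻ᵏ` is the near threshold of level
`k - 1`, the lower ones are dominated too. -/
lemma gridLevel_eq_of_isActive {k : ℕ} {x : E3} (h1 : 16 * (1 / 64 : ℝ) ^ k < ‖x‖)
    (h2 : ‖x‖ ≤ 31 * (1 / 64 : ℝ) ^ k) {i : GridIdx}
    (hi : IsActive gridSlope gridConst Set.univ x i) : gridLevel i = k := by
  refine le_antisymm ((isLeveled_grid.isActive_iff (K := k) h1 i).1 hi).1 ?_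
  by_contra! hlt
  obtain ⟨d, hd⟩ := Nat.exists_eq_add_of_lt hlt
  obtain ⟨s, -, hs⟩ := exists_grid_lt_of_near' d (k := gridLevel i) (x := x)
    (by rw [hd, pow_succ] at h2; linarith) i rfl
  exact absurd (hi.2 s (Set.mem_univ s)) (not_le.2 hs)

lemma affineFun_grid_eq (t : GridIdx) (x : E3) : affineFun gridSlope gridConst t x =
    (1 + (1 / 2 : ℝ) ^ gridLevel t) * (2 * gridX t * x 0 + 2 * gridY t * x 1 +
      (1 / 2 - gridX t ^ 2 - gridY t ^ 2) * x 2) - (1 / 128 : ℝ) ^ gridLevel t := by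
  rw [affineFun_grid, inner_paraPoint]

/-- Comparison with the lattice origin gives `|P|² x 2 ≤ 2 ⟪P, (x 0, x 1)⟫ ≤ |P| x 2 / 2` for the
active parameter `P`, so `|P| ≤ 1 / 2`. This leaves room in the disc to exchange coordinates of two
active points. -/
lemma grid_sq_le_of_isActive {x : E3} (hx2 : 0 < x 2) (hx : x 0 ^ 2 + x 1 ^ 2 ≤ (x 2 / 4) ^ 2)
    {i : GridIdx} (hi : IsActive gridSlope gridConst Set.univ x i) :
    4 * (i.1.2.1 ^ 2 + i.1.2.2 ^ 2) ≤ gridSize (gridLevel i) ^ 2 := by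
  have h1 := hi.2 (gridOrigin (gridLevel i)) (Set.mem_univ _)
  have hl : gridLevel (gridOrigin (gridLevel i)) = gridLevel i := rfl
  have hX : gridX (gridOrigin (gridLevel i)) = 0 := by simp [gridX, gridOrigin]
  have hY : gridY (gridOrigin (gridLevel i)) = 0 := by simp [gridY, gridOrigin]
  rw [affineFun_grid_eq, affineFun_grid_eq, hl, hX, hY, sub_le_sub_iff_right,
    mul_le_mul_iff_right₀ (by positivity)] at h1
  set X := gridX i with hXd
  set Y := gridY i with hYd
  have h2 : (X ^ 2 + Y ^ 2) * x 2 ≤ 2 * (X * x 0 + Y * x 1) := by linarith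
  have h3 : ((X ^ 2 + Y ^ 2) * x 2) ^ 2 ≤ (2 * (X * x 0 + Y * x 1)) ^ 2 :=
    pow_le_pow_left₀ (by positivity) h2 2
  have h4 : (X * x 0 + Y * x 1) ^ 2 ≤ (X ^ 2 + Y ^ 2) * (x 0 ^ 2 + x 1 ^ 2) := by
    nlinarith [sq_nonneg (X * x 1 - Y * x 0)]
  have h5 : (X ^ 2 + Y ^ 2) * (x 0 ^ 2 + x 1 ^ 2) ≤ (X ^ 2 + Y ^ 2) * (x 2 / 4) ^ 2 :=
    mul_le_mul_of_nonneg_left hx (by positivity)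
  have h6 : X ^ 2 + Y ^ 2 ≤ 1 / 4 := by
    by_contra! hlt
    have hpos : 0 < x 2 ^ 2 := by positivity
    have h7 : 0 < (X ^ 2 + Y ^ 2) * (X ^ 2 + Y ^ 2 - 1 / 4) * x 2 ^ 2 :=
      mul_pos (mul_pos (by linarith) (by linarith)) hpos
    nlinarith
  have hn := gridSize_pos (gridLevel i)
  rw [hXd, hYd, gridX, gridY, div_pow, div_pow, ← add_div, div_le_iff₀ (by positivity)] at h6
  have h8 : (4 * (i.1.2.1 ^ 2 + i.1.2.2 ^ 2) : ℝ) ≤ (gridSize (gridLevel i) : ℝ) ^ 2 := by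
    have : gridLevel i = i.1.1 := rfl
    rw [this]
    linarith
  exact_mod_cast h8

/-- The value at `t` is at most the maximum, so an equal sum forces the value at `s` up to the
maximum. -/
lemma IsActive.of_add_eq {E ι : Type*} [NormedAddCommGroup E] [InnerProductSpace ℝ E]
    {q : ι → E} {b : ι → ℝ} {x : E} {i j s t : ι} (hi : IsActive q b Set.univ x i)
    (hj : IsActive q b Set.univ x j)
    (h : affineFun q b s x + affineFun q b t x = affineFun q b i x + affineFun q b j x) :
    IsActive q b Set.univ x s := by
  refine ⟨Set.mem_univ s, fun k hk => ?_⟩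
  have h1 := hj.2 t (Set.mem_univ t)
  have h2 := hi.2 k hk
  linarith

lemma gridSlope_sub_coords {i j : GridIdx} (hl : gridLevel i = gridLevel j) :
    (gridSlope i - gridSlope j) 0 = 2 * (1 + (1 / 2 : ℝ) ^ gridLevel j) / gridSize (gridLevel j) *
      (i.1.2.1 - j.1.2.1) ∧
    (gridSlope i - gridSlope j) 1 = 2 * (1 + (1 / 2 : ℝ) ^ gridLevel j) / gridSize (gridLevel j) *
      (i.1.2.2 - j.1.2.2) := by
  simp only [PiLp.sub_apply, gridSlope_coords, hl, gridX, gridY]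
  have h1 : i.1.1 = gridLevel j := hl
  have h2 : j.1.1 = gridLevel j := rfl
  rw [h1, h2]
  constructor <;> ring

/-- The normals of the facets near the axis: in the even annuli they are orthogonal to one of
the two coordinate axes, in the odd annuli to one of the two diagonals. -/
lemma ae_normal_annulus : ∀ᵐ z ∂facetMeasure gridSlope gridConst Set.univ, ∀ k : ℕ,
    16 * (1 / 64 : ℝ) ^ k < ‖z.1‖ → ‖z.1‖ ≤ 31 * (1 / 64 : ℝ) ^ k → 0 < z.1 2 →
      z.1 0 ^ 2 + z.1 1 ^ 2 ≤ (z.1 2 / 4) ^ 2 →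
      (Even k → z.2 0 * z.2 1 = 0) ∧ (Odd k → z.2 0 ^ 2 = z.2 1 ^ 2) := by
  filter_upwards [ae_facetMeasure_pair isLeveled_grid.isGeneric_univ] with z hz k h1 h2 h3 h4
  obtain ⟨i, j, -, hi, hj, hzn, huniq⟩ := hz
  have hsi := grid_sq_le_of_isActive h3 h4 hi
  have hsj := grid_sq_le_of_isActive h3 h4 hj
  have hli := gridLevel_eq_of_isActive h1 h2 hi
  have hlj := gridLevel_eq_of_isActive h1 h2 hj
  obtain ⟨hn0, hn1⟩ := gridSlope_sub_coords (hli.trans hlj.symm)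
  rw [hzn, hn0, hn1]
  clear hzn hn0 hn1
  obtain ⟨⟨k1, a, c⟩, hi1, hi2⟩ := i
  obtain ⟨⟨k', a', c'⟩, hj1, hj2⟩ := j
  simp only [gridLevel] at hli hlj
  subst hli hlj
  simp only [gridLevel] at hsi hsj ⊢
  refine ⟨fun heven => ?_, fun hodd => ?_⟩
  · have hodd : ¬ Odd k' := Nat.not_odd_iff_even.2 heven
    -- Within a level the affine function is a sum of a function of `a` and a function of `c`, so
    -- exchanging one coordinate preserves the sum of values. The new point `s` is active, hence
    -- equals `i` or `j`: the two points share a coordinate.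
    let s : GridIdx := ⟨(k', a', c), by simp only; nlinarith [sq_nonneg a, sq_nonneg c'],
      fun h => absurd h hodd⟩
    let t : GridIdx := ⟨(k', a, c'), by simp only; nlinarith [sq_nonneg c, sq_nonneg a'],
      fun h => absurd h hodd⟩
    have hs := hi.of_add_eq (s := s) (t := t) hj (by
      simp only [affineFun_grid_eq, gridX, gridY, gridLevel, s, t]; ring)
    rcases huniq s hs with h | h
    · have : a' = a := congrArg (fun u : GridIdx => u.1.2.1) h
      simp [this]
    · have : c = c' := congrArg (fun u : GridIdx => u.1.2.2) h
      simp [this]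
  · obtain ⟨p, hp⟩ := hi2 hodd
    obtain ⟨p', hp'⟩ := hj2 hodd
    simp only at hp hp'
    -- The checkerboard condition allows integer diagonal coordinates `a = p + m`, `c = p - m`, in
    -- which the function separates again; the exchange argument now applies to `p` and `m`.
    obtain ⟨m, rfl⟩ : ∃ m, a = p + m := ⟨a - p, by ring⟩
    obtain ⟨m', rfl⟩ : ∃ m', a' = p' + m' := ⟨a' - p', by ring⟩
    obtain rfl : c = p - m := by linarith
    obtain rfl : c' = p' - m' := by linarith
    let s : GridIdx := ⟨(k', p' + m, p' - m), by
      simp only; nlinarith [sq_nonneg p, sq_nonneg m'], fun _ => ⟨p', by ring⟩⟩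
    let t : GridIdx := ⟨(k', p + m', p - m'), by
      simp only; nlinarith [sq_nonneg p', sq_nonneg m], fun _ => ⟨p, by ring⟩⟩
    have hs := hi.of_add_eq (s := s) (t := t) hj (by
      simp only [affineFun_grid_eq, gridX, gridY, gridLevel, s, t]; push_cast; ring)
    rcases huniq s hs with h | h
    · have h0 : p' + m = p + m := congrArg (fun u : GridIdx => u.1.2.1) h
      obtain rfl : p' = p := by linarith
      push_cast; ring
    · have h0 : p' + m = p' + m' := congrArg (fun u : GridIdx => u.1.2.1) h
      obtain rfl : m = m' := by linarith
      push_cast; ring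

end Annuli

/-! ### Vague sequential compactness of locally bounded measures -/

section VagueCompactness

open scoped CompactlySupported

variable {X : Type*} [TopologicalSpace X] [T2Space X] [LocallyCompactSpace X]
  [SecondCountableTopology X]

lemma exists_cutoff {K : Set X} (hK : IsCompact K) : ∃ χ : C(X, ℝ), HasCompactSupport χ ∧
    (∀ x ∈ K, χ x = 1) ∧ ∀ x, χ x ∈ Set.Icc (0 : ℝ) 1 := by
  obtain ⟨f, h1, -, h3, h4⟩ := exists_continuous_one_zero_of_isCompact hK isClosed_empty
    (Set.disjoint_empty K)
  exact ⟨f, h3, fun x hx => h1 hx, h4⟩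

lemma exists_denseSeq_near (f : C(X, ℝ)) {K : Set X} (hK : IsCompact K) {ε : ℝ} (hε : 0 < ε) :
    ∃ k : ℕ, ∀ x ∈ K, |f x - TopologicalSpace.denseSeq C(X, ℝ) k x| < ε := by
  have hV : {fg : C(X, ℝ) × C(X, ℝ) | ∀ x ∈ K, dist (fg.1 x) (fg.2 x) < ε} ∈
      uniformity C(X, ℝ) :=
    (ContinuousMap.mem_compactConvergence_entourage_iff _).2
      ⟨K, {p | dist p.1 p.2 < ε}, hK, Metric.dist_mem_uniformity hε, fun _ h => h⟩
  obtain ⟨_, ⟨k, rfl⟩, hg⟩ := (TopologicalSpace.denseRange_denseSeq C(X, ℝ)).inter_nhds_nonempty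
    (UniformSpace.ball_mem_nhds f hV)
  have hg : ∀ x ∈ K, dist (f x) (TopologicalSpace.denseSeq C(X, ℝ) k x) < ε := hg
  exact ⟨k, fun x hx => hg x hx⟩

variable [MeasurableSpace X] [BorelSpace X]

lemma abs_integral_le_of_le_cutoff {μ : Measure X} [IsFiniteMeasureOnCompacts μ] {χ g : X → ℝ}
    (hχ : Continuous χ) (hχc : HasCompactSupport χ) {ε c : ℝ} (hε : 0 ≤ ε)
    (hc : ∫ x, χ x ∂μ ≤ c) (h : ∀ x, |g x| ≤ ε * χ x) : |∫ x, g x ∂μ| ≤ ε * c := by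
  refine (norm_integral_le_of_norm_le (f := g) (g := fun x => ε * χ x)
    ((hχ.integrable_of_hasCompactSupport hχc).const_mul ε) (Eventually.of_forall h)).trans ?_
  rw [integral_const_mul]
  exact mul_le_mul_of_nonneg_left hc hε

/-- A sequence of measures that is bounded on compact sets has a vaguely convergent subsequence. -/
theorem exists_subseq_tendsto_integral (μ : ℕ → Measure X)
    (hμ : ∀ K, IsCompact K → ∃ B : ℝ, ∀ i, μ i K ≤ ENNReal.ofReal B) :
    ∃ φ : ℕ → ℕ, StrictMono φ ∧ ∃ ν : Measure X, IsFiniteMeasureOnCompacts ν ∧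
      ∀ f : X → ℝ, Continuous f → HasCompactSupport f →
        Tendsto (fun i => ∫ x, f x ∂μ (φ i)) atTop (𝓝 (∫ x, f x ∂ν)) := by
  have hfin : ∀ i, IsFiniteMeasureOnCompacts (μ i) := fun i => ⟨fun K hK => by
    obtain ⟨B, hB⟩ := hμ K hK
    exact (hB i).trans_lt ENNReal.ofReal_lt_top⟩
  let E : CompactExhaustion X := default
  choose χ hχc hχ1 hχ01 using fun n => exists_cutoff (E.isCompact n)
  have hc : ∀ n, ∃ c : ℝ, ∀ i, ∫ x, χ n x ∂μ i ≤ c := by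
    intro n
    obtain ⟨B, hB⟩ := hμ _ (hχc n).isCompact
    refine ⟨max B 0, fun i => ?_⟩
    have h1 : ∫ x, χ n x ∂μ i = ∫ x in tsupport (χ n), χ n x ∂μ i :=
      (setIntegral_eq_integral_of_forall_compl_eq_zero
        fun x hx => image_eq_zero_of_notMem_tsupport hx).symm
    have hlt : μ i (tsupport (χ n)) < ⊤ := (hB i).trans_lt ENNReal.ofReal_lt_top
    rw [h1]
    refine (Real.le_norm_self _).trans ((norm_setIntegral_le_of_norm_le_const (C := 1) hlt
      fun x _ => ?_).trans ?_)
    · rw [Real.norm_of_nonneg (hχ01 n x).1]; exact (hχ01 n x).2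
    · rw [one_mul]
      exact ENNReal.toReal_le_of_le_ofReal (le_max_right _ _)
        ((hB i).trans (ENNReal.ofReal_le_ofReal (le_max_left _ _)))
  choose c hc using hc
  have hc0 : ∀ n, 0 ≤ c n := fun n =>
    (integral_nonneg fun x => (hχ01 n x).1).trans (hc n 0)
  set h := TopologicalSpace.denseSeq C(X, ℝ)
  have hbd : ∀ n k, ∃ b : ℝ, 0 ≤ b ∧ ∀ x, |χ n x * h k x| ≤ b * χ n x := by
    intro n k
    obtain ⟨b, hb⟩ := (hχc n).isCompact.exists_bound_of_continuousOn (h k).continuous.continuousOn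
    refine ⟨max b 0, le_max_right _ _, fun x => ?_⟩
    by_cases hx : x ∈ tsupport (χ n)
    · rw [abs_mul, abs_of_nonneg (hχ01 n x).1, mul_comm]
      exact mul_le_mul_of_nonneg_right ((hb x hx).trans (le_max_left _ _)) (hχ01 n x).1
    · simp [image_eq_zero_of_notMem_tsupport hx]
  choose b hb0 hb using hbd
  -- Compactness of a countable product of intervals replaces the diagonal argument over all
  -- products of a cutoff and a member of the dense sequence.
  obtain ⟨L, -, φ, hφ, hL⟩ := (isCompact_univ_pi fun p : ℕ × ℕ =>
    isCompact_Icc (a := -(b p.1 p.2 * c p.1)) (b := b p.1 p.2 * c p.1)).tendsto_subseq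
    (x := fun i p => ∫ x, χ p.1 x * h p.2 x ∂μ i) (fun i p _ => abs_le.1
      (abs_integral_le_of_le_cutoff (χ p.1).continuous (hχc p.1) (hb0 _ _) (hc p.1 i) (hb _ _)))
  rw [tendsto_pi_nhds] at hL
  have hint : ∀ f : X → ℝ, Continuous f → HasCompactSupport f → ∀ i, Integrable f (μ i) :=
    fun f hf hfc i => hf.integrable_of_hasCompactSupport hfc
  -- `f` equals `χ n * f`, which is within `δ * χ n` of some `χ n * h k`; the uniform bound on `∫ χ
  -- n` makes the integrals Cauchy.
  have hconv : ∀ f : C_c(X, ℝ), ∃ l, Tendsto (fun i => ∫ x, f x ∂μ (φ i)) atTop (𝓝 l) := by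
    intro f
    obtain ⟨n, hn⟩ := E.exists_superset_of_isCompact f.hasCompactSupport.isCompact
    refine cauchySeq_tendsto_of_complete (Metric.cauchySeq_iff'.2 fun ε hε => ?_)
    have hcn : 0 < c n + 1 := by linarith [hc0 n]
    set δ := ε / (4 * (c n + 1)) with hδ
    have hδ0 : 0 < δ := by positivity
    obtain ⟨k, hk⟩ := exists_denseSeq_near f.toContinuousMap (hχc n).isCompact hδ0
    have hfx : ∀ x, f x = χ n x * f x := by
      intro x
      by_cases hx : x ∈ tsupport f
      · rw [hχ1 n x (hn hx), one_mul]
      · rw [image_eq_zero_of_notMem_tsupport hx, mul_zero]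
    have hclose : ∀ i, |∫ x, f x ∂μ i - ∫ x, χ n x * h k x ∂μ i| ≤ ε / 4 := by
      intro i
      rw [← integral_sub (hint (fun x => f x) f.continuous f.hasCompactSupport i)
        (hint (fun x => χ n x * h k x) (by fun_prop) (hχc n).mul_right i)]
      refine (abs_integral_le_of_le_cutoff (χ n).continuous (hχc n) hδ0.le (hc n i)
        fun x => ?_).trans ?_
      · by_cases hx : x ∈ tsupport (χ n)
        · rw [hfx x, ← mul_sub, abs_mul, abs_of_nonneg (hχ01 n x).1, mul_comm]
          exact mul_le_mul_of_nonneg_right (hk x hx).le (hχ01 n x).1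
        · rw [hfx x]; simp [image_eq_zero_of_notMem_tsupport hx]
      · calc δ * c n ≤ δ * (c n + 1) := by gcongr; linarith
          _ = ε / 4 := by rw [hδ]; field_simp
    obtain ⟨N, hN⟩ := Metric.cauchySeq_iff'.1 (hL (n, k)).cauchySeq (ε / 2) (by positivity)
    refine ⟨N, fun i hi => ?_⟩
    have h1 := hN i hi
    have h2 := hclose (φ i)
    have h3 := hclose (φ N)
    simp only [Real.dist_eq, Function.comp_apply] at h1 ⊢
    rw [abs_lt] at h1 ⊢
    rw [abs_le] at h2 h3
    constructor <;> linarith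
  choose Λ hΛ using hconv
  -- The limits form a positive functional, which the Riesz–Markov–Kakutani theorem represents by a
  -- measure.
  let Λ' : C_c(X, ℝ) →ₚ[ℝ] ℝ :=
  { toFun := Λ
    map_add' f g := by
      refine tendsto_nhds_unique (hΛ (f + g)) (((hΛ f).add (hΛ g)).congr fun i => ?_)
      exact (integral_add (hint _ f.continuous f.hasCompactSupport _)
        (hint _ g.continuous g.hasCompactSupport _)).symm
    map_smul' a f := by
      refine tendsto_nhds_unique (hΛ (a • f)) (((hΛ f).const_smul a).congr fun i => ?_)
      exact (integral_smul a _).symm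
    monotone' f g hfg := le_of_tendsto_of_tendsto' (hΛ f) (hΛ g) fun i =>
      integral_mono (hint _ f.continuous f.hasCompactSupport _)
        (hint _ g.continuous g.hasCompactSupport _) hfg }
  refine ⟨φ, hφ, RealRMK.rieszMeasure Λ', inferInstance, fun f hf hfc => ?_⟩
  have := hΛ ⟨⟨f, hf⟩, hfc⟩
  have h2 := RealRMK.integral_rieszMeasure Λ' ⟨⟨f, hf⟩, hfc⟩
  convert! this

end VagueCompactness

/-! ### Compactness of the Grassmannian -/

section Grassmannian

variable {n m : ℕ}

lemma Grass.proj_injective : Function.Injective (Grass.proj : Grass n m → _) := by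
  intro S T h
  have : S.space = T.space := by
    rw [← Submodule.range_starProjection S.space, ← Submodule.range_starProjection T.space]
    exact congrArg (fun f : EuclideanSpace ℝ (Fin n) →L[ℝ] EuclideanSpace ℝ (Fin n) =>
      f.range) h
  exact Subtype.ext this

lemma Grass.isInducing_proj : IsInducing (Grass.proj : Grass n m → _) := ⟨rfl⟩

lemma Grass.isEmbedding_proj : IsEmbedding (Grass.proj : Grass n m → _) :=
  ⟨Grass.isInducing_proj, Grass.proj_injective⟩

lemma Grass.continuous_proj : Continuous (Grass.proj : Grass n m → _) :=
  Grass.isInducing_proj.continuous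

instance : T2Space (Grass n m) := Grass.isEmbedding_proj.t2Space

/-- Orthogonal projections of rank `m` are the self-adjoint idempotents of trace `m`, which are
closed conditions on the operator. -/
lemma Grass.range_proj : Set.range (Grass.proj : Grass n m → _) =
    {P | IsIdempotentElem P ∧ IsSelfAdjoint P ∧
      LinearMap.trace ℝ (EuclideanSpace ℝ (Fin n)) P.toLinearMap = m} := by
  ext P
  constructor
  · rintro ⟨S, rfl⟩
    have h : IsStarProjection S.proj := isStarProjection_starProjection
    refine ⟨h.isIdempotentElem, h.isSelfAdjoint, ?_⟩
    have h2 : LinearMap.IsProj S.space S.proj.toLinearMap :=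
      ⟨fun x => Submodule.starProjection_apply_mem _ x,
        fun x hx => Submodule.starProjection_eq_self_iff.2 hx⟩
    rw [h2.trace]
    exact congrArg _ S.2
  · rintro ⟨h1, h2, h3⟩
    have h : IsStarProjection P := ⟨h1, h2⟩
    obtain ⟨hp, he⟩ := isStarProjection_iff_eq_starProjection_range.1 h
    have h4 : LinearMap.IsProj P.range P.toLinearMap := by
      refine ⟨fun x => ⟨x, rfl⟩, ?_⟩
      rintro _ ⟨x, rfl⟩
      exact congrArg (fun T : EuclideanSpace ℝ (Fin n) →L[ℝ] EuclideanSpace ℝ (Fin n) => T x) h1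
    rw [h4.trace] at h3
    refine ⟨⟨P.range, by exact_mod_cast h3⟩, ?_⟩
    exact he.symm

lemma Grass.isClosed_range_proj : IsClosed (Set.range (Grass.proj : Grass n m → _)) := by
  rw [Grass.range_proj]
  have ht : Continuous fun P : EuclideanSpace ℝ (Fin n) →L[ℝ] EuclideanSpace ℝ (Fin n) =>
      LinearMap.trace ℝ (EuclideanSpace ℝ (Fin n)) P.toLinearMap :=
    ((LinearMap.trace ℝ (EuclideanSpace ℝ (Fin n))).comp
      (ContinuousLinearMap.coeLM ℝ)).continuous_of_finiteDimensional
  exact (isClosed_eq (continuous_id.mul continuous_id) continuous_id).inter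
    ((isClosed_eq (ContinuousLinearMap.adjoint (𝕜 := ℝ)).continuous continuous_id).inter (isClosed_eq ht continuous_const))

instance : CompactSpace (Grass n m) := by
  refine ⟨?_⟩
  rw [Grass.isInducing_proj.isCompact_iff, Set.image_univ]
  refine Metric.isCompact_of_isClosed_isBounded Grass.isClosed_range_proj
    ((Metric.isBounded_closedBall (x := 0) (r := 1)).subset ?_)
  rintro _ ⟨S, rfl⟩
  rw [mem_closedBall_zero_iff]
  exact Submodule.starProjection_norm_le _

end Grassmannian

/-! ### From normals in three-space to planes in four-space -/

section Embedding

/-- Euclidean four-space. -/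
abbrev E4 := EuclideanSpace ℝ (Fin 4)

/-- The inclusion of `ℝ³` into `ℝ⁴` as the hyperplane where the last coordinate vanishes. -/
noncomputable def embed : E3 →ₗᵢ[ℝ] E4 where
  toFun x := !₂[x 0, x 1, x 2, 0]
  map_add' x y := by ext i; fin_cases i <;> simp
  map_smul' c x := by ext i; fin_cases i <;> simp
  norm_map' x := by
    simp [EuclideanSpace.norm_eq, Fin.sum_univ_four, Fin.sum_univ_three]

lemma embed_apply (x : E3) : embed x = !₂[x 0, x 1, x 2, 0] := rfl

/-- The orthogonal projection of `ℝ⁴` onto `ℝ³`. -/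
noncomputable def trunc : E4 →L[ℝ] E3 :=
  LinearMap.toContinuousLinearMap
    { toFun := fun y => !₂[y 0, y 1, y 2]
      map_add' := fun x y => by ext i; fin_cases i <;> simp
      map_smul' := fun c x => by ext i; fin_cases i <;> simp }

lemma trunc_apply (y : E4) : trunc y = !₂[y 0, y 1, y 2] := rfl

@[simp]
lemma trunc_embed (x : E3) : trunc (embed x) = x := by
  ext i; fin_cases i <;> simp [trunc_apply, embed_apply]

lemma inner_embed_left (x : E3) (y : E4) : inner ℝ (embed x) y = inner ℝ x (trunc y) := by
  simp [embed_apply, trunc_apply, PiLp.inner_apply, Fin.sum_univ_four, Fin.sum_univ_three]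

open Classical in
/-- A vector, replaced by a unit vector if it vanishes. -/
noncomputable def nonzeroVec (n : E3) : E3 := if n = 0 then EuclideanSpace.single 0 1 else n

lemma nonzeroVec_ne_zero (n : E3) : nonzeroVec n ≠ 0 := by
  unfold nonzeroVec
  split_ifs with h
  · simp
  · exact h

lemma nonzeroVec_of_ne {n : E3} (h : n ≠ 0) : nonzeroVec n = n := if_neg h

lemma finrank_orthogonal_span {n : E3} (hn : n ≠ 0) : Module.finrank ℝ (ℝ ∙ n)ᗮ = 2 := by
  have h := Submodule.finrank_add_finrank_orthogonal (ℝ ∙ n)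
  rw [finrank_span_singleton hn] at h
  simp at h
  omega

/-- The orthogonal complement in `ℝ³` of a vector `n`, as a plane in `ℝ⁴`. -/
noncomputable def normalPlane (n : E3) : Grass 4 2 :=
  ⟨(ℝ ∙ nonzeroVec n)ᗮ.map embed.toLinearMap, by
    rw [← (Submodule.equivMapOfInjective embed.toLinearMap embed.injective _).finrank_eq,
      finrank_orthogonal_span (nonzeroVec_ne_zero n)]⟩

lemma normalPlane_space {n : E3} (hn : n ≠ 0) :
    (normalPlane n).space = (ℝ ∙ n)ᗮ.map embed.toLinearMap := by
  simp only [Grass.space, normalPlane, nonzeroVec_of_ne hn]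

lemma normalPlane_neg {n : E3} (hn : n ≠ 0) : normalPlane (-n) = normalPlane n := by
  refine Subtype.ext ?_
  have h1 := normalPlane_space hn
  have h2 := normalPlane_space (neg_ne_zero.2 hn)
  rw [← neg_one_smul ℝ n, Submodule.span_singleton_smul_eq (by simp), neg_one_smul] at h2
  exact h2.trans h1.symm

lemma normalPlane_proj_apply {n : E3} (hn : n ≠ 0) (y : E4) : (normalPlane n).proj y =
    embed (trunc y - (inner ℝ n (trunc y) / ‖n‖ ^ 2) • n) := by
  have hn2 : ‖n‖ ^ 2 ≠ 0 := by positivity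
  refine (Submodule.eq_starProjection_of_mem_of_inner_eq_zero (K := (normalPlane n).space)
    ?_ ?_)
  · rw [normalPlane_space hn]
    refine ⟨_, ?_, rfl⟩
    rw [SetLike.mem_coe, Submodule.mem_orthogonal_singleton_iff_inner_right, inner_sub_right,
      inner_smul_right, real_inner_self_eq_norm_sq, div_mul_cancel₀ _ hn2, sub_self]
  · intro w hw
    rw [normalPlane_space hn] at hw
    obtain ⟨v, hv, rfl⟩ := hw
    rw [SetLike.mem_coe, Submodule.mem_orthogonal_singleton_iff_inner_right] at hv
    rw [real_inner_comm, inner_sub_right]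
    change inner ℝ (embed v) y - inner ℝ (embed v) (embed _) = 0
    rw [inner_embed_left, inner_embed_left, trunc_embed, inner_sub_right, inner_smul_right,
      real_inner_comm n v, hv]
    ring

lemma measurable_normalPlane : Measurable normalPlane := by
  refine measurable_of_continuousOn_compl_singleton 0 ?_
  rw [Grass.isInducing_proj.continuousOn_iff, continuousOn_clm_apply]
  intro y
  have : ContinuousOn (fun n : E3 => embed (trunc y - (inner ℝ n (trunc y) / ‖n‖ ^ 2) • n))
      {0}ᶜ := by
    have h : ContinuousOn (fun n : E3 => inner ℝ n (trunc y) / ‖n‖ ^ 2) {0}ᶜ := by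
      refine ContinuousOn.div (by fun_prop) (by fun_prop) fun n hn => ?_
      have : n ≠ 0 := hn
      positivity
    exact embed.continuous.comp_continuousOn
      (continuousOn_const.sub (h.smul continuousOn_id))
  exact this.congr fun n hn => normalPlane_proj_apply hn y

/-- The map sending a point of `ℝ³` and a normal vector to the point and the plane in `ℝ⁴`. -/
noncomputable def toPlane (z : E3 × E3) : E4 × Grass 4 2 := (embed z.1, normalPlane z.2)

lemma measurable_toPlane : Measurable toPlane :=
  (embed.continuous.measurable.comp measurable_fst).prodMk
    (measurable_normalPlane.comp measurable_snd)

end Embedding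

/-! ### The facet varifold and its stationarity -/

section FacetVarifold

variable {ι : Type*} [Countable ι] {q : ι → E3} {b : ι → ℝ} {lev : ι → ℕ} {R : ℕ → ℝ} {C : ℝ}

lemma IsLeveled.facet_preimage_lt_top (H : IsLeveled q b lev R C) {K : Set (E4 × Grass 4 2)}
    (hK : IsCompact K) : (facetMeasure q b Set.univ).map toPlane K < ⊤ := by
  obtain ⟨r, hr⟩ := (hK.image continuous_fst).isBounded.subset_closedBall (0 : E4)
  rw [Measure.map_apply measurable_toPlane hK.measurableSet]
  refine (measure_mono fun z hz => ?_).trans_lt (H.cyl_lt_top (max r 1) (by positivity))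
  have : embed z.1 ∈ Metric.closedBall (0 : E4) r := hr ⟨_, hz, rfl⟩
  rw [mem_closedBall_zero_iff, embed.norm_map] at this
  exact mem_cyl.2 (this.trans (le_max_left _ _))

/-- The varifold carried by the facets of the maximum of a leveled family of affine functions, with
multiplicity the jump of the gradient. -/
noncomputable def IsLeveled.varifold (H : IsLeveled q b lev R C) : Varifold 4 2 where
  measure := (facetMeasure q b Set.univ).map toPlane
  finite_on_compacts := ⟨fun _ hK => H.facet_preimage_lt_top hK⟩

lemma IsLeveled.integral_varifold (H : IsLeveled q b lev R C) {f : E4 × Grass 4 2 → ℝ}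
    (hf : Measurable f) : ∫ p, f p ∂H.varifold.measure =
      ∫ z, f (embed z.1, normalPlane z.2) ∂(facetMeasure q b Set.univ) :=
  integral_map measurable_toPlane.aemeasurable hf.aestronglyMeasurable

lemma continuous_divAlong {X : E4 → E4} (hX : ContDiff ℝ ∞ X) :
    Continuous fun p : E4 × Grass 4 2 => divAlong p.2 X p.1 := by
  have ht : Continuous fun P : E4 →L[ℝ] E4 => LinearMap.trace ℝ E4 P.toLinearMap :=
    ((LinearMap.trace ℝ E4).comp (ContinuousLinearMap.coeLM ℝ)).continuous_of_finiteDimensional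
  have h1 : Continuous fun p : E4 × Grass 4 2 => fderiv ℝ X p.1 :=
    (hX.continuous_fderiv (by simp)).comp continuous_fst
  exact ht.comp ((Grass.continuous_proj.comp continuous_snd).clm_comp h1)

/-- A component of the restriction to `ℝ³` of a vector field on `ℝ⁴`. -/
noncomputable def restrictField (X : E4 → E4) (a : Fin 3) (x : E3) : ℝ := trunc (X (embed x)) a

lemma contDiff_restrictField {X : E4 → E4} (hX : ContDiff ℝ ∞ X) (a : Fin 3) :
    ContDiff ℝ ∞ (restrictField X a) := by
  have h1 : ContDiff ℝ ∞ fun x : E3 => trunc (X (embed x)) :=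
    trunc.contDiff.comp (hX.comp embed.toContinuousLinearMap.contDiff)
  exact (EuclideanSpace.proj a : E3 →L[ℝ] ℝ).contDiff.comp h1

lemma hasCompactSupport_restrictField {X : E4 → E4} (hX : HasCompactSupport X) (a : Fin 3) :
    HasCompactSupport (restrictField X a) := by
  have h1 : HasCompactSupport fun x : E3 => X (embed x) :=
    hX.comp_isClosedEmbedding embed.isometry.isClosedEmbedding
  exact h1.comp_left (g := fun y : E4 => trunc y a) (by simp)

lemma fderiv_restrictField {X : E4 → E4} (hX : ContDiff ℝ ∞ X) (a : Fin 3) (x w : E3) :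
    fderiv ℝ (restrictField X a) x w = trunc (fderiv ℝ X (embed x) (embed w)) a := by
  have h1 : HasFDerivAt (fun x : E3 => X (embed x))
      ((fderiv ℝ X (embed x)).comp embed.toContinuousLinearMap) x :=
    (hX.differentiable (by simp) (embed x)).hasFDerivAt.comp x
      embed.toContinuousLinearMap.hasFDerivAt
  have h2 := (EuclideanSpace.proj a : E3 →L[ℝ] ℝ).hasFDerivAt.comp x
    (trunc.hasFDerivAt.comp x h1)
  have h3 : HasFDerivAt (restrictField X a) _ x := h2
  rw [h3.fderiv]
  rfl

/-- The divergence along the plane is the full `ℝ³`-divergence minus the normal part. Multiplying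
the former by the trace `1 = ∑_c n_c² / ‖n‖²` expresses everything through Hessian entries and pairs
the terms for cancellation. -/
lemma divAlong_normalPlane {X : E4 → E4} (hX : ContDiff ℝ ∞ X) (x : E3) {n : E3} (hn : n ≠ 0) :
    divAlong (normalPlane n) X (embed x) = ∑ a : Fin 3, ∑ c : Fin 3,
      (fderiv ℝ (restrictField X a) x (EuclideanSpace.single a 1) *
          (inner ℝ n (EuclideanSpace.single c 1) * inner ℝ n (EuclideanSpace.single c 1) / ‖n‖ ^ 2)
        - fderiv ℝ (restrictField X a) x (EuclideanSpace.single c 1) *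
          (inner ℝ n (EuclideanSpace.single c 1) * inner ℝ n (EuclideanSpace.single a 1) /
            ‖n‖ ^ 2)) := by
  have h1 : ∀ a : Fin 3, ∑ c : Fin 3, fderiv ℝ (restrictField X a) x (EuclideanSpace.single a 1) *
      (inner ℝ n (EuclideanSpace.single c 1) * inner ℝ n (EuclideanSpace.single c 1) / ‖n‖ ^ 2) =
      fderiv ℝ (restrictField X a) x (EuclideanSpace.single a 1) := fun a => by
    rw [← Finset.mul_sum, sum_inner_sq_div n hn, mul_one]
  simp only [Finset.sum_sub_distrib, h1]
  rw [divAlong, LinearMap.trace_eq_sum_inner _ (EuclideanSpace.basisFun (Fin 4) ℝ)]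
  have he : ∀ a : Fin 3, embed (EuclideanSpace.single a 1) =
      EuclideanSpace.single a.castSucc 1 := by
    intro a
    ext i
    fin_cases a <;> fin_cases i <;> simp [embed_apply]
  simp only [fderiv_restrictField hX, he]
  simp [Fin.sum_univ_four, Fin.sum_univ_three, normalPlane_proj_apply hn, embed_apply,
    PiLp.inner_apply]
  ring

/-- After integration by parts both sides pair the `v`-slope with the mixed second derivative of `Y`
along `u` and `w`. -/
lemma IsLeveled.integral_fderiv_symm (H : IsLeveled q b lev R C) {Y : E3 → ℝ}
    (hY : ContDiff ℝ ∞ Y) (hc : HasCompactSupport Y) (u v w : E3) :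
    ∫ z, fderiv ℝ Y z.1 u * (inner ℝ z.2 v * inner ℝ z.2 w / ‖z.2‖ ^ 2)
        ∂(facetMeasure q b Set.univ) =
      ∫ z, fderiv ℝ Y z.1 w * (inner ℝ z.2 v * inner ℝ z.2 u / ‖z.2‖ ^ 2)
        ∂(facetMeasure q b Set.univ) := by
  have hd : ContDiff ℝ 1 (fderiv ℝ Y) := hY.fderiv_right (by norm_cast)
  have hu : ∀ u : E3, ContDiff ℝ 1 fun x => fderiv ℝ Y x u := fun u =>
    hd.clm_apply contDiff_const
  rw [H.integral_facetMeasure (hu u) (hc.fderiv_apply ℝ u),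
    H.integral_facetMeasure (hu w) (hc.fderiv_apply ℝ w)]
  congr 2
  ext x
  congr 1
  have h2 : ∀ u w : E3, fderiv ℝ (fun x => fderiv ℝ Y x u) x w =
      fderiv ℝ (fderiv ℝ Y) x w u := fun u w => by
    rw [fderiv_clm_apply (hd.differentiable (by simp) x) (differentiableAt_const u)]
    simp
  rw [h2, h2]
  exact (hY.contDiffAt.isSymmSndFDerivAt (by rw [minSmoothness_of_isRCLikeNormedField]; norm_cast)).eq w u

lemma IsLeveled.integrable_fderiv_form (H : IsLeveled q b lev R C) {Y : E3 → ℝ}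
    (hY : ContDiff ℝ ∞ Y) (hc : HasCompactSupport Y) (u v w : E3) :
    Integrable (fun z : E3 × E3 => fderiv ℝ Y z.1 u *
      (inner ℝ z.2 v * inner ℝ z.2 w / ‖z.2‖ ^ 2)) (facetMeasure q b Set.univ) :=
  integrable_test H.cyl_lt_top (ψ := fun x => fderiv ℝ Y x u)
    (g := fun n => inner ℝ n v * inner ℝ n w / ‖n‖ ^ 2)
    ((hY.continuous_fderiv (by simp)).clm_apply continuous_const)
    (hc.fderiv_apply ℝ u) (measurable_normal_form v w) fun n => norm_normal_form_le n v w

theorem IsLeveled.isStationary (H : IsLeveled q b lev R C) : H.varifold.IsStationary := by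
  intro X hX hXc
  rw [Varifold.firstVariation, H.integral_varifold (continuous_divAlong hX).measurable]
  have hae := (ae_facetMeasure_ne_zero (q := q) (b := b) Set.univ).mono
    fun z hz => divAlong_normalPlane hX z.1 hz
  have hint := fun a : Fin 3 => H.integrable_fderiv_form (contDiff_restrictField hX a)
    (hasCompactSupport_restrictField hXc a)
  refine (integral_congr_ae hae).trans ?_
  have hsub : ∀ a c : Fin 3, Integrable (fun z : E3 × E3 =>
      fderiv ℝ (restrictField X a) z.1 (EuclideanSpace.single a 1) *
          (inner ℝ z.2 (EuclideanSpace.single c 1) * inner ℝ z.2 (EuclideanSpace.single c 1) /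
            ‖z.2‖ ^ 2)
        - fderiv ℝ (restrictField X a) z.1 (EuclideanSpace.single c 1) *
          (inner ℝ z.2 (EuclideanSpace.single c 1) * inner ℝ z.2 (EuclideanSpace.single a 1) /
            ‖z.2‖ ^ 2)) (facetMeasure q b Set.univ) :=
    fun a c => (hint a _ _ _).sub (hint a _ _ _)
  rw [integral_finsetSum _ fun a _ => integrable_finsetSum _ fun c _ => hsub a c]
  refine Finset.sum_eq_zero fun a _ => ?_
  rw [integral_finsetSum _ fun c _ => hsub a c]
  refine Finset.sum_eq_zero fun c _ => ?_
  rw [integral_sub (hint a _ _ _) (hint a _ _ _), sub_eq_zero]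
  exact H.integral_fderiv_symm (contDiff_restrictField hX a)
    (hasCompactSupport_restrictField hXc a) _ _ _

end FacetVarifold

/-! ### Plane measures and Hausdorff null sets -/

section PlaneMeasure

lemma integral_submodule_map (K : Submodule ℝ E3) (f : E4 → ℝ) :
    ∫ z : K.map embed.toLinearMap, f z = ∫ z : K, f (embed z) := by
  let e : K ≃ₗᵢ[ℝ] K.map embed.toLinearMap :=
    { Submodule.equivMapOfInjective embed.toLinearMap embed.injective K with
      norm_map' := fun x => embed.norm_map x }
  rw [← e.measurePreserving.integral_comp e.toHomeomorph.measurableEmbedding]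
  rfl

lemma integral_normalPlane {n : E3} (hn : n ≠ 0) (f : E4 → ℝ) :
    ∫ z : (normalPlane n).space, f z = ∫ z : (ℝ ∙ n)ᗮ, f (embed z) := by
  rw [normalPlane_space hn, integral_submodule_map]

lemma hyperplaneMeasure_neg {E : Type*} [NormedAddCommGroup E] [InnerProductSpace ℝ E]
    [FiniteDimensional ℝ E] [MeasurableSpace E] [BorelSpace E] (n : E) (c : ℝ) :
    hyperplaneMeasure (-n) (-c) = hyperplaneMeasure n c := by
  have key : ∀ K K' : Submodule ℝ E, K = K' → ∀ v : E,
      Measure.map (fun z : K => v + (z : E)) volume =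
        Measure.map (fun z : K' => v + (z : E)) volume := by
    rintro K _ rfl v; rfl
  have hs : (ℝ ∙ (-n))ᗮ = (ℝ ∙ n)ᗮ := by
    rw [← neg_one_smul ℝ n, Submodule.span_singleton_smul_eq (by simp)]
  rw [hyperplaneMeasure, hyperplaneMeasure, key _ _ hs]
  congr 2
  ext z
  rw [norm_neg, smul_neg, neg_div, neg_smul, neg_neg]

lemma volume_eq_zero_of_hausdorffMeasure {n : E3} (hn : n ≠ 0) (v : E3) {A : Set E4}
    (hA : Measure.hausdorffMeasure 2 A = 0) :
    volume {z : (ℝ ∙ n)ᗮ | embed (v + z) ∈ A} = 0 := by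
  have hiso : Isometry fun z : (ℝ ∙ n)ᗮ => embed (v + z) :=
    embed.isometry.comp ((isometry_add_left v).comp isometry_subtype_coe)
  have h1 : Measure.hausdorffMeasure 2 {z : (ℝ ∙ n)ᗮ | embed (v + z) ∈ A} = 0 := by
    have := hiso.hausdorffMeasure_preimage (d := 2) (Or.inl (by norm_num)) A
    exact this.trans (measure_mono_null Set.inter_subset_left hA)
  have h2 : (volume : Measure (ℝ ∙ n)ᗮ) ≪
      Measure.hausdorffMeasure (Module.finrank ℝ (ℝ ∙ n)ᗮ) :=
    Measure.absolutelyContinuous_isAddHaarMeasure _ _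
  rw [finrank_orthogonal_span hn] at h2
  exact h2 (by exact_mod_cast h1)

end PlaneMeasure

/-! ### Rectifiability and approximate tangent planes -/

section Rectifiable

variable {ι : Type*} {q : ι → E3} {b : ι → ℝ} {lev : ι → ℕ} {R : ℕ → ℝ} {C : ℝ}

/-- Exactly the two affine functions `i` and `j` are active at `x`. -/
def IsFacetPoint (q : ι → E3) (b : ι → ℝ) (x : E3) (i j : ι) : Prop :=
  q i ≠ q j ∧ IsActive q b Set.univ x i ∧ IsActive q b Set.univ x j ∧
    ∀ k, IsActive q b Set.univ x k → k = i ∨ k = j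

open Classical in
/-- The normal of the facet through a point. -/
noncomputable def facetNormal (q : ι → E3) (b : ι → ℝ) (x : E3) : E3 :=
  if h : ∃ p : ι × ι, q p.1 ≠ q p.2 ∧ IsActive q b Set.univ x p.1 ∧ IsActive q b Set.univ x p.2 then
    q h.choose.1 - q h.choose.2 else 0

/-- The chosen pair can only be `(i, j)` or `(j, i)`, and the plane does not see the sign of the
normal. -/
lemma IsFacetPoint.normalPlane_facetNormal {x : E3} {i j : ι} (h : IsFacetPoint q b x i j) :
    normalPlane (facetNormal q b x) = normalPlane (q i - q j) := by
  have he : ∃ p : ι × ι, q p.1 ≠ q p.2 ∧ IsActive q b Set.univ x p.1 ∧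
      IsActive q b Set.univ x p.2 := ⟨(i, j), h.1, h.2.1, h.2.2.1⟩
  rw [facetNormal, dif_pos he]
  obtain ⟨h1, h2, h3⟩ := he.choose_spec
  have hne := sub_ne_zero.2 h.1
  rcases h.2.2.2 _ h2 with h4 | h4 <;> rcases h.2.2.2 _ h3 with h5 | h5
  · rw [h4, h5] at h1; exact absurd rfl h1
  · rw [h4, h5]
  · rw [h4, h5, ← neg_sub, normalPlane_neg hne]
  · rw [h4, h5] at h1; exact absurd rfl h1

lemma affineFun_eq_iff {E : Type*} [NormedAddCommGroup E] [InnerProductSpace ℝ E] {q : ι → E}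
    {i j : ι} {x : E} : affineFun q b i x = affineFun q b j x ↔
      inner ℝ (q i - q j) x = b i - b j := by
  simp only [affineFun, inner_sub_left]
  constructor <;> intro h <;> linarith

/-- Only finitely many levels matter near `x`, and inactivity is an open condition, so nearby only
`i` and `j` compete. -/
lemma IsLeveled.exists_isOpen_isFacetPoint (H : IsLeveled q b lev R C) {x : E3} {i j : ι}
    (h : IsFacetPoint q b x i j) : ∃ U : Set E3, IsOpen U ∧ x ∈ U ∧
      (∀ y ∈ U, ∀ k, IsActive q b Set.univ y k → k = i ∨ k = j) ∧
      ∀ y ∈ U, affineFun q b i y = affineFun q b j y →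
        IsActive q b Set.univ y i ∧ IsActive q b Set.univ y j := by
  obtain ⟨K, hK⟩ := H.exists_lt (norm_pos_iff.2 (H.ne_zero h.2.1))
  have hev : ∀ᶠ y in 𝓝 x, ∀ k ∈ {k | lev k ≤ K},
      IsActive q b Set.univ y k → k = i ∨ k = j := by
    rw [Filter.eventually_all_finite (H.finite K)]
    intro k _
    by_cases hk : IsActive q b Set.univ x k
    · exact Eventually.of_forall fun y _ => h.2.2.2 k hk
    · filter_upwards [(isClosed_isActive Set.univ k).isOpen_compl.mem_nhds hk] with y hy hy'
      exact absurd hy' hy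
  have hnorm : ∀ᶠ y in 𝓝 x, R K < ‖y‖ :=
    continuous_norm.continuousAt.eventually_const_lt hK
  obtain ⟨U, hU, hUo, hxU⟩ := eventually_nhds_iff.1 (hev.and hnorm)
  have hact : ∀ y ∈ U, ∀ k, IsActive q b Set.univ y k → k = i ∨ k = j := fun y hy k hk =>
    (hU y hy).1 k ((H.isActive_iff (hU y hy).2 k).1 hk).1 hk
  refine ⟨U, hUo, hxU, hact, fun y hy heq => ?_⟩
  obtain ⟨k, hk⟩ := H.exists_isActive (norm_pos_iff.1 ((H.pos K).trans (hU y hy).2))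
  rcases hact y hy k hk with rfl | rfl
  · exact ⟨hk, Set.mem_univ _, fun l hl => heq ▸ hk.2 l hl⟩
  · exact ⟨⟨Set.mem_univ _, fun l hl => heq ▸ hk.2 l hl⟩, hk⟩

variable [Countable ι]

lemma map_fst_facetMeasure_apply {A : Set E3} (hA : MeasurableSet A) :
    (facetMeasure q b Set.univ).map Prod.fst A = ∑' p : ι × ι,
      ENNReal.ofReal (‖q p.1 - q p.2‖ / 2) *
        hyperplaneMeasure (q p.1 - q p.2) (b p.1 - b p.2) (A ∩ facet q b Set.univ p) := by
  rw [Measure.map_apply measurable_fst hA, facetMeasure, Measure.sum_apply _ (measurable_fst hA)]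
  congr 1
  ext p
  rw [Measure.smul_apply, smul_eq_mul, Measure.map_apply (by fun_prop) (measurable_fst hA)]
  congr 1
  exact Measure.restrict_apply hA

/-- Near a facet point only the ordered pairs `(i, j)` and `(j, i)` with distinct entries
contribute; their half weights add up to the full jump. -/
lemma IsFacetPoint.restrict_map_fst {x : E3} {i j : ι}
    (h : IsFacetPoint q b x i j) {U : Set E3} (hU : IsOpen U)
    (h1 : ∀ y ∈ U, ∀ k, IsActive q b Set.univ y k → k = i ∨ k = j)
    (h2 : ∀ y ∈ U, affineFun q b i y = affineFun q b j y →
      IsActive q b Set.univ y i ∧ IsActive q b Set.univ y j) :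
    ((facetMeasure q b Set.univ).map Prod.fst).restrict U =
      ENNReal.ofReal ‖q i - q j‖ • (hyperplaneMeasure (q i - q j) (b i - b j)).restrict U := by
  classical
  have hij : i ≠ j := fun he => h.1 (he ▸ rfl)
  have hne : q i - q j ≠ 0 := sub_ne_zero.2 h.1
  ext A hA
  have hAU := hA.inter hU.measurableSet
  rw [Measure.restrict_apply hA, Measure.smul_apply, Measure.restrict_apply hA, smul_eq_mul,
    map_fst_facetMeasure_apply hAU, tsum_eq_sum (s := {(i, j), (j, i)}), Finset.sum_pair]
  · have h3 : hyperplaneMeasure (q i - q j) (b i - b j) (A ∩ U ∩ facet q b Set.univ (i, j)) =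
        hyperplaneMeasure (q i - q j) (b i - b j) (A ∩ U) := by
      refine measure_congr ?_
      filter_upwards [ae_hyperplaneMeasure hne (b i - b j)] with y hy
      refine propext ⟨fun hm => hm.1, fun hm => ⟨hm, ?_⟩⟩
      exact h2 y hm.2 (affineFun_eq_iff.2 hy)
    have h4 : facet q b Set.univ (j, i) = facet q b Set.univ (i, j) := by
      ext y; exact and_comm
    have h5 : hyperplaneMeasure (q j - q i) (b j - b i) =
        hyperplaneMeasure (q i - q j) (b i - b j) := by
      rw [← neg_sub (q i), ← neg_sub (b i), hyperplaneMeasure_neg]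
    rw [h4, h5, h3, ← add_mul, norm_sub_rev (q j), ← ENNReal.ofReal_add (by positivity)
      (by positivity), add_halves]
  · simp [hij]
  · rintro ⟨k, l⟩ hkl
    by_cases hf : (A ∩ U ∩ facet q b Set.univ (k, l)).Nonempty
    · obtain ⟨y, ⟨-, hyU⟩, hk, hl⟩ := hf
      rcases h1 y hyU k hk with rfl | rfl <;> rcases h1 y hyU l hl with rfl | rfl
      · simp
      · simp at hkl
      · simp at hkl
      · simp
    · rw [Set.not_nonempty_iff_eq_empty.1 hf, measure_empty, mul_zero]

lemma measurable_isFacetPoint (i j : ι) : Measurable fun x => IsFacetPoint q b x i j := by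
  have hA : ∀ k, Measurable fun x => IsActive q b Set.univ x k := fun k =>
    measurableSet_setOfPred.1 (isClosed_isActive Set.univ k).measurableSet
  exact measurable_const.and ((hA i).and ((hA j).and
    (Measurable.forall fun k => (hA k).imp measurable_const)))

lemma measurableSet_isFacetPoint : MeasurableSet {x | ∃ i j, IsFacetPoint q b x i j} :=
  measurableSet_setOfPred.2 (Measurable.exists fun i => Measurable.exists fun j =>
    measurable_isFacetPoint i j)

lemma IsLeveled.weight_varifold (H : IsLeveled q b lev R C) :
    H.varifold.weight = ((facetMeasure q b Set.univ).map Prod.fst).map embed := by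
  rw [Varifold.weight, IsLeveled.varifold, Measure.map_map measurable_fst measurable_toPlane,
    Measure.map_map embed.continuous.measurable measurable_fst]
  rfl

lemma measurableEmbedding_embed : MeasurableEmbedding embed :=
  embed.isometry.isClosedEmbedding.measurableEmbedding

lemma IsLeveled.ae_isFacetPoint (H : IsLeveled q b lev R C) :
    ∀ᵐ z ∂facetMeasure q b Set.univ, ∃ i j, IsFacetPoint q b z.1 i j ∧ z.2 = q i - q j := by
  filter_upwards [ae_facetMeasure_pair H.isGeneric_univ] with z hz
  obtain ⟨i, j, h1, h2, h3, h4, h5⟩ := hz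
  exact ⟨i, j, ⟨h1, h2, h3, h5⟩, h4⟩

lemma IsLeveled.ae_isFacetPoint_fst (H : IsLeveled q b lev R C) :
    ∀ᵐ x ∂(facetMeasure q b Set.univ).map Prod.fst, ∃ i j, IsFacetPoint q b x i j := by
  rw [ae_map_iff measurable_fst.aemeasurable measurableSet_isFacetPoint]
  filter_upwards [H.ae_isFacetPoint] with z hz
  obtain ⟨i, j, h, -⟩ := hz
  exact ⟨i, j, h⟩

/-- Near `x` the weight is exactly a multiple of a plane measure, so the rescaled integrals are
eventually constant. -/
lemma IsLeveled.isApproxTangentPlane (H : IsLeveled q b lev R C) {x : E3} {i j : ι}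
    (h : IsFacetPoint q b x i j) :
    IsApproxTangentPlane H.varifold.weight (embed x) (normalPlane (q i - q j)) := by
  obtain ⟨U, hUo, hxU, h1, h2⟩ := H.exists_isOpen_isFacetPoint h
  have hne : q i - q j ≠ 0 := sub_ne_zero.2 h.1
  refine ⟨‖q i - q j‖, norm_pos_iff.2 hne, fun f hf hfc => ?_⟩
  refine tendsto_const_nhds.congr' ?_
  obtain ⟨δ, hδ, hball⟩ := Metric.isOpen_iff.1 hUo x hxU
  obtain ⟨ρ, hρ⟩ := hfc.isCompact.isBounded.subset_ball (0 : E4)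
  have hlim : Tendsto (fun r : ℝ => r * ρ) (𝓝[>] 0) (𝓝 (0 * ρ)) :=
    (tendsto_id.mono_left nhdsWithin_le_nhds).mul_const _
  rw [zero_mul] at hlim
  filter_upwards [hlim.eventually_lt_const hδ, self_mem_nhdsWithin] with r hr hr0
  have hr0 : 0 < r := hr0
  set g : E3 → ℝ := fun y => f (r⁻¹ • (embed y - embed x)) with hg
  have hsupp : ∀ y, y ∉ U → g y = 0 := by
    intro y hy
    by_contra hne0
    apply hy
    apply hball
    have h3 := hρ (subset_tsupport f hne0)
    rw [mem_ball_zero_iff, norm_smul, norm_inv, Real.norm_of_nonneg hr0.le, ← map_sub,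
      embed.norm_map, inv_mul_lt_iff₀ hr0] at h3
    rw [Metric.mem_ball, dist_eq_norm]
    linarith
  have hc : inner ℝ (q i - q j) x = b i - b j := affineFun_eq_iff.1 (h.2.1.eq h.2.2.1)
  have hgcont : Continuous g := by fun_prop
  set n := q i - q j with hn
  set v : E3 := ((b i - b j) / ‖n‖ ^ 2) • n with hv
  have hxv : x - v ∈ (ℝ ∙ n)ᗮ := by
    rw [Submodule.mem_orthogonal_singleton_iff_inner_right, inner_sub_right, hc, hv,
      inner_smul_right, real_inner_self_eq_norm_sq, div_mul_cancel₀ _ (by positivity), sub_self]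
  have h4 : ∫ y, f (r⁻¹ • (y - embed x)) ∂H.varifold.weight =
      ‖n‖ * ∫ y, g y ∂hyperplaneMeasure n (b i - b j) := by
    rw [H.weight_varifold, measurableEmbedding_embed.integral_map,
      ← setIntegral_eq_integral_of_forall_compl_eq_zero hsupp,
      h.restrict_map_fst hUo h1 h2, integral_smul_measure,
      setIntegral_eq_integral_of_forall_compl_eq_zero hsupp,
      ENNReal.toReal_ofReal (norm_nonneg _), smul_eq_mul]
  have h5 : ∫ y, g y ∂hyperplaneMeasure n (b i - b j) =
      r ^ 2 * ∫ z : (ℝ ∙ n)ᗮ, f (embed z) := by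
    rw [hyperplaneMeasure, integral_map (by fun_prop) hgcont.aestronglyMeasurable]
    have h6 : ∀ z : (ℝ ∙ n)ᗮ, g (((b i - b j) / ‖n‖ ^ 2) • n + z) =
        f (embed ((r⁻¹ • (z - ⟨x - v, hxv⟩) : (ℝ ∙ n)ᗮ) : E3)) := by
      intro z
      rw [hg]
      simp only
      rw [← map_sub, ← map_smul]
      congr 2
      rw [Submodule.coe_smul, ← hv]
      congr 1
      change v + (z : E3) - x = (z : E3) - (x - v)
      abel
    simp only [h6]
    rw [integral_sub_right_eq_self (fun z : (ℝ ∙ n)ᗮ => f (embed ((r⁻¹ • z : (ℝ ∙ n)ᗮ) : E3))),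
      Measure.integral_comp_inv_smul volume (fun z : (ℝ ∙ n)ᗮ => f (embed z)),
      finrank_orthogonal_span hne, abs_of_pos (by positivity), smul_eq_mul]
  rw [h4, h5, integral_normalPlane hne]
  field_simp

lemma exists_lipschitz_parametrization (n : E3) (hn : n ≠ 0) (c : ℝ) :
    ∃ g : EuclideanSpace ℝ (Fin 2) → E4, LipschitzWith 1 g ∧
      ∀ x : E3, inner ℝ n x = c → embed x ∈ Set.range g := by
  let e : (ℝ ∙ n)ᗮ ≃ₗᵢ[ℝ] EuclideanSpace ℝ (Fin 2) :=
    ((stdOrthonormalBasis ℝ (ℝ ∙ n)ᗮ).reindex (finCongr (finrank_orthogonal_span hn))).repr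
  have hiso : Isometry fun u : EuclideanSpace ℝ (Fin 2) =>
      embed ((c / ‖n‖ ^ 2) • n + (e.symm u : E3)) :=
    embed.isometry.comp ((isometry_add_left _).comp (isometry_subtype_coe.comp e.symm.isometry))
  refine ⟨_, hiso.lipschitz, fun x hx => ?_⟩
  have hxv : x - (c / ‖n‖ ^ 2) • n ∈ (ℝ ∙ n)ᗮ := by
    rw [Submodule.mem_orthogonal_singleton_iff_inner_right, inner_sub_right, hx,
      inner_smul_right, real_inner_self_eq_norm_sq, div_mul_cancel₀ _ (by positivity), sub_self]
  refine ⟨e ⟨_, hxv⟩, ?_⟩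
  simp

lemma IsLeveled.isRectifiableMeasure (H : IsLeveled q b lev R C) :
    IsRectifiableMeasure 2 H.varifold.weight where
  finite_on_compacts := by
    refine ⟨fun K hK => ?_⟩
    have := H.varifold.finite_on_compacts.lt_top_of_isCompact (K := K ×ˢ Set.univ)
      (hK.prod isCompact_univ)
    rw [Varifold.weight, Measure.map_apply measurable_fst hK.measurableSet]
    rwa [Set.prod_univ] at this
  abs_cont := by
    refine Measure.AbsolutelyContinuous.mk fun A hA hA0 => ?_
    have hA0 : Measure.hausdorffMeasure 2 A = 0 := by exact_mod_cast hA0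
    rw [H.weight_varifold, Measure.map_map embed.continuous.measurable measurable_fst,
      Measure.map_apply (embed.continuous.measurable.comp measurable_fst) hA]
    have : ∀ᵐ z ∂facetMeasure q b Set.univ, embed z.1 ∉ A := by
      refine ae_facetMeasure fun i j hij => ?_
      have hms : MeasurableSet {x : E3 | embed x ∉ A} := (embed.continuous.measurable hA).compl
      have h0 : ∀ᵐ x ∂hyperplaneMeasure (q i - q j) (b i - b j), embed x ∉ A := by
        rw [hyperplaneMeasure, ae_map_iff (by fun_prop) hms, ae_iff]
        simp only [not_not]
        exact volume_eq_zero_of_hausdorffMeasure (sub_ne_zero.2 hij) _ hA0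
      exact h0.mono fun x hx _ _ => hx
    rw [ae_iff] at this
    simp only [not_not] at this
    exact this
  lipschitz_cover := by
    classical
    have hex : ∀ p : ι × ι, ∃ g : EuclideanSpace ℝ (Fin 2) → E4, LipschitzWith 1 g ∧
        (q p.1 ≠ q p.2 → ∀ x : E3, inner ℝ (q p.1 - q p.2) x = b p.1 - b p.2 →
          embed x ∈ Set.range g) := by
      intro p
      by_cases hp : q p.1 = q p.2
      · exact ⟨fun _ => 0, LipschitzWith.const' 0, fun h => absurd hp h⟩
      · obtain ⟨g, h1, h2⟩ := exists_lipschitz_parametrization _ (sub_ne_zero.2 hp) (b p.1 - b p.2)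
        exact ⟨g, h1, fun _ => h2⟩
    choose g hg1 hg2 using hex
    obtain ⟨i₀, -⟩ := H.nonempty 0
    have : Nonempty (ι × ι) := ⟨(i₀, i₀)⟩
    obtain ⟨s, hs⟩ := exists_surjective_nat (ι × ι)
    refine ⟨fun k => g (s k), fun k => ⟨1, hg1 _⟩, ?_⟩
    rw [H.weight_varifold, measurableEmbedding_embed.map_apply]
    refine measure_mono_null (fun x hx => ?_) H.ae_isFacetPoint_fst
    rintro ⟨i, j, h⟩
    obtain ⟨k, hk⟩ := hs (i, j)
    refine hx (Set.mem_iUnion.2 ⟨k, ?_⟩)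
    simp only [hk]
    exact hg2 (i, j) h.1 x (affineFun_eq_iff.1 (h.2.1.eq h.2.2.1))

theorem IsLeveled.isRectifiable (H : IsLeveled q b lev R C) : H.varifold.IsRectifiable := by
  refine ⟨H.varifold.weight, fun y => normalPlane (facetNormal q b (trunc y)),
    H.isRectifiableMeasure, ?_, fun B hB => ?_⟩
  · rw [H.weight_varifold, measurableEmbedding_embed.ae_map_iff]
    filter_upwards [H.ae_isFacetPoint_fst] with x hx
    obtain ⟨i, j, h⟩ := hx
    rw [trunc_embed, h.normalPlane_facetNormal, ← H.weight_varifold]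
    exact H.isApproxTangentPlane h
  -- The tangent map uses choice; `S` is a measurable set that agrees almost everywhere with the
  -- preimage of `B`.
  · set S : Set E3 := {x | ∃ i j, IsFacetPoint q b x i j ∧
      (embed x, normalPlane (q i - q j)) ∈ B} with hS
    have hSm : MeasurableSet S := by
      refine measurableSet_setOfPred.2 (Measurable.exists fun i => Measurable.exists fun j => ?_)
      exact (measurable_isFacetPoint i j).and (measurableSet_setOfPred.1
        ((embed.continuous.measurable.prodMk measurable_const) hB))
    have h1 : ∀ x i j, IsFacetPoint q b x i j →
        (x ∈ S ↔ (embed x, normalPlane (q i - q j)) ∈ B) := by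
      refine fun x i j h => ⟨fun ⟨k, l, h', hm⟩ => ?_, fun hm => ⟨i, j, h, hm⟩⟩
      rwa [← h.normalPlane_facetNormal, h'.normalPlane_facetNormal]
    rw [H.weight_varifold, measurableEmbedding_embed.map_apply]
    have h2 : (facetMeasure q b Set.univ).map Prod.fst
        (embed ⁻¹' {y | (y, normalPlane (facetNormal q b (trunc y))) ∈ B}) =
        (facetMeasure q b Set.univ).map Prod.fst S := by
      refine measure_congr ?_
      filter_upwards [H.ae_isFacetPoint_fst] with x hx
      obtain ⟨i, j, h⟩ := hx
      refine propext (Iff.trans ?_ (h1 x i j h).symm)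
      rw [← h.normalPlane_facetNormal]
      change (embed x, normalPlane (facetNormal q b (trunc (embed x)))) ∈ B ↔ _
      rw [trunc_embed]
    rw [h2, Measure.map_apply measurable_fst hSm, IsLeveled.varifold,
      Measure.map_apply measurable_toPlane hB]
    refine measure_congr ?_
    filter_upwards [H.ae_isFacetPoint] with z hz
    obtain ⟨i, j, h, hn⟩ := hz
    refine propext (Iff.trans ?_ (h1 z.1 i j h).symm)
    rw [← hn]
    rfl

end Rectifiable

/-! ### Dilations and existence of tangent varifolds -/

section Dilation

variable {n m : ℕ}

lemma continuous_dilation (r : ℝ) : Continuous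
    fun p : EuclideanSpace ℝ (Fin n) × Grass n m => (r⁻¹ • p.1, p.2) := by fun_prop

lemma Varifold.dilate_lt_top (C : Varifold n m) {r : ℝ} (hr : 0 < r)
    {K : Set (EuclideanSpace ℝ (Fin n) × Grass n m)} (hK : IsCompact K) : C.dilate r K < ⊤ := by
  rw [Varifold.dilate, Measure.smul_apply, smul_eq_mul,
    Measure.map_apply (continuous_dilation r).measurable hK.measurableSet]
  refine ENNReal.mul_lt_top ENNReal.ofReal_lt_top ?_
  have := C.finite_on_compacts
  have h : (fun p : EuclideanSpace ℝ (Fin n) × Grass n m => (r⁻¹ • p.1, p.2)) ⁻¹' K ⊆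
      (fun p : EuclideanSpace ℝ (Fin n) × Grass n m => (r • p.1, p.2)) '' K := by
    intro p hp
    exact ⟨_, hp, by simp [smul_smul, hr.ne']⟩
  exact (measure_mono h).trans_lt (hK.image (by fun_prop)).measure_lt_top

/-- The dilation of a varifold, as a varifold. -/
noncomputable def Varifold.dilation (C : Varifold n m) {r : ℝ} (hr : 0 < r) : Varifold n m where
  measure := C.dilate r
  finite_on_compacts := ⟨fun _ hK => C.dilate_lt_top hr hK⟩

lemma Varifold.integral_dilate (C : Varifold n m) {r : ℝ} (hr : 0 < r)
    {f : EuclideanSpace ℝ (Fin n) × Grass n m → ℝ} (hf : Continuous f) :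
    ∫ p, f p ∂C.dilate r = (r ^ m)⁻¹ * ∫ p, f (r⁻¹ • p.1, p.2) ∂C.measure := by
  rw [Varifold.dilate, integral_smul_measure, ENNReal.toReal_ofReal (by positivity), smul_eq_mul,
    integral_map (continuous_dilation r).measurable.aemeasurable
      hf.measurable.aestronglyMeasurable]

lemma continuous_comp_dilation {f : EuclideanSpace ℝ (Fin n) × Grass n m → ℝ} (hf : Continuous f)
    (r : ℝ) : Continuous
      fun p : EuclideanSpace ℝ (Fin n) × Grass n m => f (r⁻¹ • p.1, p.2) :=
  hf.comp (continuous_dilation r)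

lemma Varifold.integral_dilate_mul (V : Varifold n m) {s r : ℝ} (hs : 0 < s) (hr : 0 < r)
    {f : EuclideanSpace ℝ (Fin n) × Grass n m → ℝ} (hf : Continuous f) :
    ∫ p, f p ∂V.dilate (s * r) = (r ^ m)⁻¹ * ∫ p, f (r⁻¹ • p.1, p.2) ∂V.dilate s := by
  rw [V.integral_dilate hs (continuous_comp_dilation hf r),
    V.integral_dilate (mul_pos hs hr) hf, mul_pow, mul_inv, ← mul_assoc, mul_comm (r ^ m)⁻¹]
  simp only [smul_smul, mul_inv, mul_comm r⁻¹]

lemma hasCompactSupport_dilation {r : ℝ} (hr : 0 < r)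
    {f : EuclideanSpace ℝ (Fin n) × Grass n m → ℝ} (hf : HasCompactSupport f) :
    HasCompactSupport fun p : EuclideanSpace ℝ (Fin n) × Grass n m => f (r⁻¹ • p.1, p.2) := by
  refine hf.comp_isClosedEmbedding
    (g := fun p : EuclideanSpace ℝ (Fin n) × Grass n m => (r⁻¹ • p.1, p.2)) ?_
  exact ((Homeomorph.smulOfNeZero r⁻¹ (inv_ne_zero hr.ne')).prodCongr
    (Homeomorph.refl _)).isClosedEmbedding

lemma Varifold.mem_tangents_zero {V C : Varifold n m} : C ∈ V.tangents 0 ↔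
    ∃ l : ℕ → ℝ, (∀ i, 0 < l i) ∧ Tendsto l atTop (𝓝 0) ∧
      ∀ f : EuclideanSpace ℝ (Fin n) × Grass n m → ℝ, Continuous f → HasCompactSupport f →
        Tendsto (fun i => ∫ p, f p ∂V.dilate (l i)) atTop (𝓝 (∫ p, f p ∂C.measure)) := by
  simp only [Varifold.tangents, sub_zero, Set.mem_ofPred_eq]
  refine exists_congr fun l => and_congr_right fun hl => and_congr_right fun _ => ?_
  refine forall_congr' fun f => forall_congr' fun hf => forall_congr' fun _ => ?_
  simp only [V.integral_dilate (hl _) hf]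

/-- The dilations of a tangent varifold are tangent varifolds. -/
lemma Varifold.dilation_mem_tangents {V C : Varifold n m} (hC : C ∈ V.tangents 0) {r : ℝ}
    (hr : 0 < r) : C.dilation hr ∈ V.tangents 0 := by
  rw [Varifold.mem_tangents_zero] at hC ⊢
  obtain ⟨l, hl, hl0, h⟩ := hC
  refine ⟨fun i => l i * r, fun i => mul_pos (hl i) hr, by simpa using hl0.mul_const r,
    fun f hf hfc => ?_⟩
  have h1 := (h (fun p => f (r⁻¹ • p.1, p.2)) (continuous_comp_dilation hf r)
    (hasCompactSupport_dilation hr hfc)).const_mul (r ^ m)⁻¹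
  rw [← C.integral_dilate hr hf] at h1
  exact h1.congr fun i => (V.integral_dilate_mul (hl i) hr hf).symm

/-- If the rescaled masses are bounded on compact sets, every sequence of scales has a
subsequence along which the rescalings converge to a tangent varifold. -/
lemma Varifold.exists_mem_tangents (V : Varifold n m) {l : ℕ → ℝ} (hl : ∀ i, 0 < l i)
    (hl0 : Tendsto l atTop (𝓝 0)) (hV : ∀ K : Set (EuclideanSpace ℝ (Fin n) × Grass n m),
      IsCompact K → ∃ B : ℝ, ∀ i, V.dilate (l i) K ≤ ENNReal.ofReal B) :
    ∃ φ : ℕ → ℕ, StrictMono φ ∧ ∃ C ∈ V.tangents 0,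
      ∀ f : EuclideanSpace ℝ (Fin n) × Grass n m → ℝ, Continuous f → HasCompactSupport f →
        Tendsto (fun i => ∫ p, f p ∂V.dilate (l (φ i))) atTop (𝓝 (∫ p, f p ∂C.measure)) := by
  obtain ⟨φ, hφ, ν, hν, h⟩ := exists_subseq_tendsto_integral (fun i => V.dilate (l i)) hV
  exact ⟨φ, hφ, ⟨ν, hν⟩, Varifold.mem_tangents_zero.2 ⟨fun i => l (φ i), fun i => hl _,
    hl0.comp hφ.tendsto_atTop, h⟩, h⟩

end Dilation

/-! ### A test function that sees the facet directions -/

section TestFunction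

/-- The centre of the test function, on the axis of the paraboloid. -/
noncomputable def axisPoint : E3 := !₂[0, 0, 20]

/-- A cutoff function on `ℝ⁴` supported near a point of the axis. -/
noncomputable def axisBump : ContDiffBump (embed axisPoint) := ⟨1, 2, one_pos, one_lt_two⟩

lemma axisBump_ne_zero {x : E3} (h : axisBump (embed x) ≠ 0) : ‖x - axisPoint‖ < 2 := by
  have : embed x ∈ Function.support axisBump := h
  rw [axisBump.support_eq, Metric.mem_ball, dist_eq_norm, ← map_sub, embed.norm_map] at this
  exact this

/-- The support lies inside the one-level annulus `16 < ‖x‖ ≤ 31`, in `paraCone` and in the narrower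
cone used for the normals. -/
lemma near_axis {x : E3} (h : ‖x - axisPoint‖ ≤ 2) :
    18 ≤ x 2 ∧ x 0 ^ 2 + x 1 ^ 2 ≤ 4 ∧ 18 ≤ ‖x‖ ∧ ‖x‖ ≤ 22 := by
  have h2 : ‖x - axisPoint‖ ^ 2 ≤ 2 ^ 2 := pow_le_pow_left₀ (norm_nonneg _) h 2
  rw [norm_sq_E3] at h2
  have h0 : axisPoint 0 = 0 ∧ axisPoint 1 = 0 ∧ axisPoint 2 = 20 := by simp [axisPoint]
  rw [PiLp.sub_apply, PiLp.sub_apply, PiLp.sub_apply, h0.1, h0.2.1, h0.2.2, sub_zero,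
    sub_zero] at h2
  have h3 : 18 ≤ x 2 := by nlinarith [sq_nonneg (x 0), sq_nonneg (x 1)]
  refine ⟨h3, by nlinarith [sq_nonneg (x 2 - 20)], ?_, ?_⟩
  · exact h3.trans ((le_abs_self _).trans (abs_apply_le_norm x 2))
  · have h4 : ‖axisPoint‖ = 20 := by
      rw [← sq_eq_sq₀ (norm_nonneg _) (by norm_num), norm_sq_E3]
      simp [axisPoint]
    have h5 := norm_add_le (x - axisPoint) axisPoint
    rw [sub_add_cancel] at h5
    linarith

/-- The restriction of the cutoff function to `ℝ³`. -/
noncomputable def axisCutoff (x : E3) : ℝ := axisBump (embed x)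

lemma contDiff_axisCutoff : ContDiff ℝ 1 axisCutoff :=
  axisBump.contDiff.comp embed.toContinuousLinearMap.contDiff

lemma hasCompactSupport_axisCutoff : HasCompactSupport axisCutoff :=
  axisBump.hasCompactSupport.comp_isClosedEmbedding embed.isometry.isClosedEmbedding

lemma tsupport_axisCutoff_subset : tsupport axisCutoff ⊆ paraCone := by
  have h1 : tsupport axisCutoff ⊆ Metric.closedBall axisPoint 2 := by
    refine closure_minimal (fun x hx => ?_) Metric.isClosed_closedBall
    rw [Metric.mem_closedBall, dist_eq_norm]
    exact (axisBump_ne_zero hx).le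
  intro x hx
  have h2 := h1 hx
  rw [Metric.mem_closedBall, dist_eq_norm] at h2
  obtain ⟨h3, h4, -, -⟩ := near_axis h2
  exact ⟨by linarith, by nlinarith⟩

lemma axisCutoff_axisPoint : axisCutoff axisPoint ≠ 0 := by
  have : axisCutoff axisPoint = 1 :=
    axisBump.one_of_mem_closedBall (Metric.mem_closedBall_self zero_le_one)
  rw [this]
  exact one_ne_zero

/-- A test function which measures how far a plane is from containing the directions of the
coordinate axes. -/
noncomputable def axisTest (p : E4 × Grass 4 2) : ℝ :=
  axisBump p.1 * |(p.2.proj (EuclideanSpace.single 0 1)) 1|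

lemma continuous_axisTest : Continuous axisTest := by
  have h1 : Continuous fun p : E4 × Grass 4 2 => p.2.proj (EuclideanSpace.single 0 1) :=
    (Grass.continuous_proj.comp continuous_snd).clm_apply continuous_const
  exact (axisBump.continuous.comp continuous_fst).mul
    (((EuclideanSpace.proj (1 : Fin 4) : E4 →L[ℝ] ℝ).continuous.comp h1).abs)

lemma hasCompactSupport_axisTest : HasCompactSupport axisTest := by
  refine HasCompactSupport.of_support_subset_isCompact
    (axisBump.hasCompactSupport.isCompact.prod isCompact_univ) fun p hp => ⟨?_, Set.mem_univ _⟩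
  exact subset_tsupport _ (left_ne_zero_of_mul hp)

/-- The off-diagonal entry of the projection is that of `-n ⊗ n / ‖n‖²`. Its absolute value is not
linear in the Hessian, so the limit of the Hessians does not determine it. -/
lemma axisTest_normalPlane (x : E3) {n : E3} (hn : n ≠ 0) :
    axisTest (embed x, normalPlane n) = axisCutoff x * (|n 0 * n 1| / ‖n‖ ^ 2) := by
  have h : (normalPlane n).proj (EuclideanSpace.single 0 1) 1 = -(n 0 * n 1 / ‖n‖ ^ 2) := by
    rw [normalPlane_proj_apply hn]
    simp [embed_apply, trunc_apply, PiLp.inner_apply, Fin.sum_univ_three]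
    ring
  rw [axisTest, h, abs_neg, abs_div, abs_of_nonneg (by positivity : (0 : ℝ) ≤ ‖n‖ ^ 2)]
  rfl

end TestFunction

/-! ### The concrete varifold: even and odd scales, density -/

section GridVarifold

/-- The facet varifold of the concrete family. -/
noncomputable def gridVarifold : Varifold 4 2 := isLeveled_grid.varifold

lemma integral_dilate_gridVarifold {r : ℝ} (hr : 0 < r) {f : E4 × Grass 4 2 → ℝ}
    (hf : Continuous f) : ∫ p, f p ∂gridVarifold.dilate r = (r ^ 2)⁻¹ *
      ∫ z, f (embed (r⁻¹ • z.1), normalPlane z.2) ∂facetMeasure gridSlope gridConst Set.univ := by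
  rw [Varifold.integral_dilate _ hr hf, gridVarifold,
    isLeveled_grid.integral_varifold (continuous_comp_dilation hf r).measurable]
  simp only [map_smul]

lemma gridVarifold_dilate_le : ∀ K : Set (E4 × Grass 4 2), IsCompact K →
    ∃ B : ℝ, ∀ r : ℝ, 0 < r → gridVarifold.dilate r K ≤ ENNReal.ofReal B := by
  intro K hK
  obtain ⟨M, hM0, -, hM⟩ := isLeveled_grid.exists_mass_bound
  obtain ⟨ρ, hρ⟩ := (hK.image continuous_fst).isBounded.subset_closedBall (0 : E4)
  set ρ' := max ρ 1
  refine ⟨M * ρ' ^ 2, fun r hr => ?_⟩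
  have hρ' : 0 < ρ' := by positivity
  rw [Varifold.dilate, Measure.smul_apply, smul_eq_mul,
    Measure.map_apply (continuous_dilation r).measurable hK.measurableSet, gridVarifold,
    IsLeveled.varifold, Measure.map_apply measurable_toPlane
      ((continuous_dilation r).measurable hK.measurableSet)]
  have h1 : facetMeasure gridSlope gridConst Set.univ (toPlane ⁻¹'
      ((fun p : E4 × Grass 4 2 => (r⁻¹ • p.1, p.2)) ⁻¹' K)) ≤ ENNReal.ofReal (M * (r * ρ') ^ 2) := by
    refine (measure_mono fun z hz => ?_).trans (hM (r * ρ') (by positivity))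
    have h2 : r⁻¹ • embed z.1 ∈ Metric.closedBall (0 : E4) ρ := hρ ⟨_, hz, rfl⟩
    rw [mem_closedBall_zero_iff, norm_smul, norm_inv, Real.norm_of_nonneg hr.le, embed.norm_map,
      inv_mul_le_iff₀ hr] at h2
    exact mem_cyl.2 (h2.trans (mul_le_mul_of_nonneg_left (le_max_left _ _) hr.le))
  calc _ ≤ ENNReal.ofReal (r ^ 2)⁻¹ * ENNReal.ofReal (M * (r * ρ') ^ 2) := by gcongr
    _ = ENNReal.ofReal (M * ρ' ^ 2) := by
      rw [← ENNReal.ofReal_mul (by positivity)]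
      congr 1
      field_simp

/-- The limit of the integrals of the test function over the odd annuli. -/
noncomputable def axisLimit : ℝ :=
  - ∫ x, inner ℝ (gradient paraSupport x) (EuclideanSpace.single 0 1) *
    fderiv ℝ axisCutoff x (EuclideanSpace.single 0 1)

lemma axisLimit_pos : 0 < axisLimit :=
  integral_gradient_paraSupport_pos contDiff_axisCutoff hasCompactSupport_axisCutoff
    tsupport_axisCutoff_subset (fun _ => axisBump.nonneg) axisCutoff_axisPoint

lemma tendsto_axisLimit : Tendsto (fun r : ℝ => (r ^ 2)⁻¹ * ∫ z, axisCutoff (r⁻¹ • z.1) *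
    (z.2 0 * z.2 0 / ‖z.2‖ ^ 2) ∂facetMeasure gridSlope gridConst Set.univ) (𝓝[>] 0)
      (𝓝 axisLimit) := by
  have := isLeveled_grid.tendsto_blowup ae_tendsto_activeSlope_grid contDiff_axisCutoff
    hasCompactSupport_axisCutoff (EuclideanSpace.single 0 1) (EuclideanSpace.single 0 1)
  refine Tendsto.congr (fun r => ?_) this
  simp [EuclideanSpace.inner_single_right]

lemma scale_near_axis {k : ℕ} {x : E3} (h : axisCutoff (((1 / 64 : ℝ) ^ k)⁻¹ • x) ≠ 0) :
    16 * (1 / 64 : ℝ) ^ k < ‖x‖ ∧ ‖x‖ ≤ 31 * (1 / 64 : ℝ) ^ k ∧ 0 < x 2 ∧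
      x 0 ^ 2 + x 1 ^ 2 ≤ (x 2 / 4) ^ 2 := by
  have hs : (0 : ℝ) < (1 / 64) ^ k := by positivity
  set s : ℝ := (1 / 64) ^ k
  obtain ⟨h1, h2, h3, h4⟩ := near_axis (axisBump_ne_zero h).le
  rw [norm_smul, norm_inv, Real.norm_of_nonneg hs.le] at h3 h4
  rw [le_inv_mul_iff₀ hs] at h3
  rw [inv_mul_le_iff₀ hs] at h4
  simp only [PiLp.smul_apply, smul_eq_mul] at h1 h2
  rw [le_inv_mul_iff₀ hs] at h1
  have h5 : x 0 ^ 2 + x 1 ^ 2 ≤ 4 * s ^ 2 := by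
    have : (s⁻¹ * x 0) ^ 2 + (s⁻¹ * x 1) ^ 2 = (x 0 ^ 2 + x 1 ^ 2) / s ^ 2 := by
      field_simp
    rwa [this, div_le_iff₀ (by positivity)] at h2
  exact ⟨by linarith, by linarith, by nlinarith, by nlinarith⟩

lemma integral_axisTest_even {k : ℕ} (hk : Even k) :
    ∫ p, axisTest p ∂gridVarifold.dilate ((1 / 64 : ℝ) ^ k) = 0 := by
  rw [integral_dilate_gridVarifold (by positivity) continuous_axisTest]
  refine mul_eq_zero_of_right _ (integral_eq_zero_of_ae ?_)
  filter_upwards [ae_normal_annulus, ae_facetMeasure_ne_zero (q := gridSlope) (b := gridConst)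
    Set.univ] with z hz hn
  rw [axisTest_normalPlane _ hn]
  by_cases h : axisCutoff (((1 / 64 : ℝ) ^ k)⁻¹ • z.1) = 0
  · rw [h, zero_mul]; rfl
  · obtain ⟨h1, h2, h3, h4⟩ := scale_near_axis h
    rw [(hz k h1 h2 h3 h4).1 hk]
    simp

lemma integral_axisTest_odd {k : ℕ} (hk : Odd k) :
    ∫ p, axisTest p ∂gridVarifold.dilate ((1 / 64 : ℝ) ^ k) =
      (((1 / 64 : ℝ) ^ k) ^ 2)⁻¹ * ∫ z, axisCutoff (((1 / 64 : ℝ) ^ k)⁻¹ • z.1) *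
        (z.2 0 * z.2 0 / ‖z.2‖ ^ 2) ∂facetMeasure gridSlope gridConst Set.univ := by
  rw [integral_dilate_gridVarifold (by positivity) continuous_axisTest]
  congr 1
  refine integral_congr_ae ?_
  filter_upwards [ae_normal_annulus, ae_facetMeasure_ne_zero (q := gridSlope) (b := gridConst)
    Set.univ] with z hz hn
  rw [axisTest_normalPlane _ hn]
  by_cases h : axisCutoff (((1 / 64 : ℝ) ^ k)⁻¹ • z.1) = 0
  · rw [h, zero_mul, zero_mul]
  · obtain ⟨h1, h2, h3, h4⟩ := scale_near_axis h
    have h5 := (hz k h1 h2 h3 h4).2 hk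
    rw [abs_mul, (sq_eq_sq_iff_abs_eq_abs _ _).1 h5.symm, abs_mul_abs_self]

lemma tendsto_scale : Tendsto (fun k : ℕ => (1 / 64 : ℝ) ^ k) atTop (𝓝[>] 0) :=
  tendsto_nhdsWithin_iff.2 ⟨tendsto_pow_atTop_nhds_zero_of_lt_one (by norm_num) (by norm_num),
    Eventually.of_forall fun k => by simp⟩

/-- A tangent varifold whose dilation by the factor `64` is a different varifold. -/
lemma exists_tangent_dilate_ne :
    ∃ C ∈ gridVarifold.tangents 0, C.dilate (1 / 64) ≠ C.measure := by
  obtain ⟨φ, hφ, C, hC, h⟩ := gridVarifold.exists_mem_tangents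
    (l := fun i => (1 / 64 : ℝ) ^ (2 * i)) (fun i => by positivity)
    ((tendsto_scale.mono_right nhdsWithin_le_nhds).comp
      (tendsto_id.const_mul_atTop' (by norm_num : 0 < 2)))
    (fun K hK => by
      obtain ⟨B, hB⟩ := gridVarifold_dilate_le K hK
      exact ⟨B, fun i => hB _ (by positivity)⟩)
  refine ⟨C, hC, fun heq => ?_⟩
  have h1 : ∫ p, axisTest p ∂C.measure = 0 := by
    refine tendsto_nhds_unique (h axisTest continuous_axisTest hasCompactSupport_axisTest) ?_
    simp only [integral_axisTest_even (even_two_mul _)]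
    exact tendsto_const_nhds
  have h2 : ∫ p, axisTest p ∂C.dilate (1 / 64) = axisLimit := by
    have hr : (0 : ℝ) < 1 / 64 := by norm_num
    -- The dilation by `1 / 64` shifts the even exponents `2 * φ i` to the odd exponents `2 * φ i +
    -- 1`.
    have h3 := (h (fun p => axisTest ((1 / 64 : ℝ)⁻¹ • p.1, p.2))
      (continuous_comp_dilation continuous_axisTest _)
      (hasCompactSupport_dilation hr hasCompactSupport_axisTest)).const_mul ((1 / 64 : ℝ) ^ 2)⁻¹
    rw [← C.integral_dilate hr continuous_axisTest] at h3
    refine tendsto_nhds_unique h3 ?_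
    have h4 := tendsto_axisLimit.comp (tendsto_scale.comp
      (tendsto_atTop_mono (fun i : ℕ => (by have := hφ.id_le i; simp only [id] at this; omega :
        i ≤ 2 * φ i + 1)) tendsto_id))
    refine h4.congr fun i => ?_
    simp only [Function.comp_apply]
    rw [← integral_axisTest_odd (odd_two_mul_add_one _), pow_succ]
    exact gridVarifold.integral_dilate_mul (by positivity) hr continuous_axisTest
  rw [heq, h1] at h2
  exact axisLimit_pos.ne h2

lemma weight_gridVarifold_closedBall (r : ℝ) : gridVarifold.weight (Metric.closedBall 0 r) =
    facetMeasure gridSlope gridConst Set.univ (cyl r) := by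
  rw [gridVarifold, IsLeveled.weight_varifold, measurableEmbedding_embed.map_apply,
    Measure.map_apply measurable_fst
      (embed.continuous.measurable Metric.isClosed_closedBall.measurableSet)]
  congr 1
  ext z
  simp [mem_cyl]

lemma exists_density_gridVarifold :
    ∃ θ : ENNReal, gridVarifold.HasDensity 0 θ ∧ 0 < θ ∧ θ < ⊤ := by
  obtain ⟨θ, hθ⟩ := isLeveled_grid.exists_density ae_tendsto_activeSlope_grid
  refine ⟨ENNReal.ofReal θ, ?_, ?_, ENNReal.ofReal_lt_top⟩
  · refine ((ENNReal.tendsto_ofReal hθ).congr' ?_)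
    filter_upwards [self_mem_nhdsWithin] with r hr
    have hr : 0 < r := hr
    rw [weight_gridVarifold_closedBall, ENNReal.ofReal_div_of_pos (by positivity),
      ENNReal.ofReal_toReal (isLeveled_grid.cyl_lt_top r hr).ne, ENNReal.ofReal_pow hr.le]
  · rw [ENNReal.ofReal_pos]
    have hsc : Tendsto (fun r : ℝ => 22 * r) (𝓝[>] 0) (𝓝[>] 0) := by
      refine tendsto_nhdsWithin_iff.2 ⟨?_, ?_⟩
      · have : Tendsto (fun r : ℝ => 22 * r) (𝓝 0) (𝓝 (22 * 0)) := tendsto_id.const_mul _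
        rw [mul_zero] at this
        exact this.mono_left nhdsWithin_le_nhds
      · filter_upwards [self_mem_nhdsWithin] with r hr
        have hr : 0 < r := hr
        exact mul_pos (by norm_num) hr
    -- The rescaled cutoff is supported in radius `22 * r`, and `484 = 22²`, so positivity of
    -- `axisLimit` passes to `θ`.
    have h1 := (hθ.comp hsc).const_mul 484
    have h2 : axisLimit ≤ 484 * θ := by
      refine le_of_tendsto_of_tendsto tendsto_axisLimit h1 ?_
      filter_upwards [self_mem_nhdsWithin] with r hr
      have hr : 0 < r := hr
      have hfin := isLeveled_grid.cyl_lt_top (22 * r) (by positivity)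
      have h3 : ∫ z, axisCutoff (r⁻¹ • z.1) * (z.2 0 * z.2 0 / ‖z.2‖ ^ 2)
          ∂facetMeasure gridSlope gridConst Set.univ ≤
          (facetMeasure gridSlope gridConst Set.univ (cyl (22 * r))).toReal := by
        have h4 : ∫ z, (cyl (22 * r)).indicator (fun _ => (1 : ℝ)) z
            ∂facetMeasure gridSlope gridConst Set.univ =
            (facetMeasure gridSlope gridConst Set.univ (cyl (22 * r))).toReal := by
          rw [integral_indicator (measurableSet_cyl _)]; simp [Measure.real]
        rw [← h4]
        refine integral_mono_of_nonneg (Eventually.of_forall fun z => ?_) ?_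
          (Eventually.of_forall fun z => ?_)
        · exact mul_nonneg axisBump.nonneg (div_nonneg (mul_self_nonneg _) (by positivity))
        · rw [integrable_indicator_iff (measurableSet_cyl _)]
          exact integrableOn_const hfin.ne
        · by_cases hz : z ∈ cyl (22 * r)
          · rw [Set.indicator_of_mem hz]
            refine mul_le_one₀ axisBump.le_one (div_nonneg (mul_self_nonneg _) (by positivity)) ?_
            refine div_le_one_of_le₀ ?_ (by positivity)
            rw [norm_sq_E3]
            nlinarith [sq_nonneg (z.2 1), sq_nonneg (z.2 2)]
          · rw [Set.indicator_of_notMem hz]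
            have : axisCutoff (r⁻¹ • z.1) = 0 := by
              by_contra hne
              apply hz
              have := (near_axis (axisBump_ne_zero hne).le).2.2.2
              rw [norm_smul, norm_inv, Real.norm_of_nonneg hr.le, inv_mul_le_iff₀ hr] at this
              exact mem_cyl.2 (by linarith)
            simp only [this, zero_mul, le_refl]
      have h5 : 484 * ((facetMeasure gridSlope gridConst Set.univ (cyl (22 * r))).toReal /
          (22 * r) ^ 2) = (r ^ 2)⁻¹ *
          (facetMeasure gridSlope gridConst Set.univ (cyl (22 * r))).toReal := by
        field_simp; norm_num
      simp only [Function.comp_apply]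
      rw [h5]
      exact mul_le_mul_of_nonneg_left h3 (by positivity)
    linarith [axisLimit_pos]

end GridVarifold

theorem theorem5p1 :
    ∃ V : Varifold 4 2, V.IsStationary ∧ V.IsRectifiable ∧
      (∃ θ : ENNReal, V.HasDensity 0 θ ∧ 0 < θ ∧ θ < ⊤) ∧
      (∃ C ∈ V.tangents 0, ¬ C.IsConical) ∧
      (V.tangents 0).Nontrivial := by
  obtain ⟨C, hC, hne⟩ := exists_tangent_dilate_ne
  have hr : (0 : ℝ) < 1 / 64 := by norm_num
  -- `C` and its dilation by `1 / 64` are two different tangent varifolds.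
  refine ⟨gridVarifold, isLeveled_grid.isStationary, isLeveled_grid.isRectifiable,
    exists_density_gridVarifold, ⟨C, hC, fun h => hne (h _ hr)⟩,
    ⟨C.dilation hr, Varifold.dilation_mem_tangents hC hr, C, hC, fun h => hne ?_⟩⟩
  exact congrArg Varifold.measure h
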